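/- **Setting.** Let $D,M\in\mathbb N$ and let $f:[0,2\pi]^D\to\mathbb C$ be (the restriction of) a continuous function that is $2\pi$-periodic in each variable and bandlimited: $\hat f(\omega)=(2\pi)^{-D}\int_{[0,2\pi]^D}e^{-i\omega\cdot x}f(x)\,dx=0$ for all $\omega\in\mathbb Z^D\setminus[-M/2,M/2]^D$. Let $P_1,\dots,P_D$ be pairwise relatively prime integers with $P_d>MD$, let $\tilde N=\prod_dP_d$ and $f_{\rm new}(x)=f\big(\tfrac{\tilde N}{P_1}x,\dots,\tfrac{\tilde N}{P_D}x\big)$. For a vector $x$ indexed by a set $I$ and $j\in\mathbb N$, $x^{\rm opt}_j$ is $x$ restricted to $j$ indices that carry entries of largest magnitude. Let $k\ge2$ and $\epsilon^{-1}\ge2$ be integers and $\kappa=k/\epsilon$. *Measurements.* For integers $c,N$, let $2\le s_1<\dots<s_K$ be pairwise relatively prime with $K=c\,\kappa\lfloor\log_{s_1}N\rfloor+1$; let $t_1<\dots<t_\lambda<s_1$ satisfy $s_1\prod_it_i\ge N$ with $t_1,\dots,t_\lambda,s_1,\dots,s_K$ pairwise relatively prime; put $t_0=1$. For a $2\pi$-periodic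 function $F$ of one variable and each $n$ of the form $t_is_j$, the measurement stage samples $F$ at $2\pi p/n$ $(0\le p<n)$ and forms $G_{n,h}=\frac1n\sum_{p<n}F(2\pi p/n)e^{-2\pi ihp/n}$. In the randomized version, with parameter $\sigma\in[2/3,1)$, $l=\lceil21\ln(N/(1-\sigma))\rceil$ of the $s_j$ are drawn independently and uniformly with replacement, and only the drawn $s_j$ are used: each is processed once and counted with its multiplicity. Let $W$ be the number of rows counted with multiplicity ($W=K$, or $W=l$ in the randomized version). *Fourier Approximate 2* (bandwidth $N$, sparsity $k$): for each used $s_j$, each $0\le h<s_j$ and each $1\le i\le\lambda$, find $b\in[0,t_i)$ minimizing $|G_{s_j,h}-G_{t_is_j,h+bs_j}|$; reconstruct by the Chinese remainder theorem the $\omega_{j,h}$ with $\omega_{j,h}\equiv h$ mod $s_j$ and $\omega_{j,h}\equiv h+bs_j$ mod $t_i$ for all $i$. For every $\omega\in(-\lceil N/2\rceil,\lfloor N/2\rfloor]$ reconstructed more than $W/2$ times, let ${\rm Re}\,x_\omega$, ${\rm Im}\,x_\omega$ be the medians of the real and imaginary parts of the $W(\lambda+1)$ values $G_{t_is_j,\,\omega\bmod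 t_is_j}$ $(0\le i\le\lambda)$. Output $x_S$, where $S$ consists of the $2k$ frequencies of the largest nonzero $|x_\omega|$ (of all of them, if there are fewer). *Fourier Approximate 1* uses only $i=0$, estimates every $\omega\in(-\lceil N/2\rceil,\lfloor N/2\rfloor]$ in this way, and outputs the $2k$ largest. Running times are numbers of steps of a random access machine with unit-cost arithmetic, comparison and memory access on integers and reals, and concern everything after the measurement stage (i.e. after sampling and discrete Fourier transforms), with sorting by merge sort and medians by median-of-medians. Sample counts are numbers of points of $[0,2\pi]^D$ at which $f$ is evaluated. **Theorem.** 1. The map $g(\omega)=\big(\sum_d\frac{\tilde N}{P_d}\omega_d\big)\bmod\tilde N$ (representative in $(-\tilde N/2,\tilde N/2]$) is a bijection from $\prod_d(-\frac{P_d}2,\frac{P_d}2]\cap\mathbb Z^D$ onto $(-\frac{\tilde N}2,\frac{\tilde N}2]\cap\mathbb Z$. There is an absolute constant $A$ such that whenever $MD\ge2$ the $P_d$ can be chosen with $\tilde N\le(MD)^{AD}$; for fixed $D$ they can also be chosen with $\tilde N=\Theta((MD)^D)$, the constants depending only on $D$. 2. Suppose $\tilde N>\kappa^2$. For all admissible $s_j,t_i$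 with $N=\tilde N$ and $c=4$, Fourier Approximate 2 applied to $f_{\rm new}$ outputs $x_S$ with $$\big\|\hat f-(x_S\circ g)\big\|_2\le\big\|\hat f-\hat f^{\rm opt}_k\big\|_2+\frac{22\,\epsilon\,\big\|\hat f-\hat f^{\rm opt}_{(k/\epsilon)}\big\|_1}{\sqrt k},\qquad(*)$$ where $x_S\circ g$ is extended by $0$ outside of the domain of $g$. If moreover $MD\ge2$ and $\tilde N\le(MD)^{AD}$, then admissible $s_j,t_i$, not depending on $f$, exist for which both the running time and the number of samples are $$O\Big(\frac{k^2D^4\log^4(MD)}{\log(k/\epsilon)\,\epsilon^2}\Big),$$ the implied constant depending only on $A$. 3. Suppose $\tilde N>\kappa$ and $\sigma\in[2/3,1)$. For all admissible $s_j,t_i$ with $N=\tilde N$ and $c=14$, the output of the randomized version of Fourier Approximate 2 applied to $f_{\rm new}$ satisfies $(*)$ with probability at least $\sigma$. If moreover $MD\ge2$ and $\tilde N\le(MD)^{AD}$, then admissible $s_j,t_i$, depending neither on $f$ nor on $\sigma$, exist for which, for every outcome of the random draws, both the running time and the number of samples are $$O\Big(\frac{kD^4}{\epsilon}\log^3(MD)\log\Big(\frac{MD}{1-\sigma}\Big)\Big),$$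 the implied constant depending only on $A$. 4. Suppose $\tilde N>\kappa$. For all admissible $s_j$ with $N=\tilde N$, the output of Fourier Approximate 1 applied to $f_{\rm new}$ satisfies $(*)$ if $c=4$, and the output of its randomized version satisfies $(*)$ with probability at least $\sigma\in[2/3,1)$ if $c=14$. Admissible $s_j$, depending neither on $f$ nor on $\sigma$, exist for which the running time is $O(\tilde N\kappa\log_\kappa\tilde N)$ with $O\big(\kappa^2\lfloor\log_\kappa\tilde N\rfloor^2\ln(\kappa\lfloor\log_\kappa\tilde N\rfloor)\big)$ samples (deterministic), respectively $O(\tilde N\log(\tilde N/(1-\sigma)))$ with $O\big(l\,\kappa\lfloor\log_\kappa\tilde N\rfloor\ln(\kappa\lfloor\log_\kappa\tilde N\rfloor)\big)$ samples, $l=\lceil21\ln(\tilde N/(1-\sigma))\rceil$ (randomized), with absolute implied constants. -/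

import Mathlib

open scoped BigOperators

noncomputable section

namespace SFT

/-! ## Vectors, best `k`-term approximations, instance optimality -/

/-- `l²` norm of a (finitely supported, in all uses) vector on an index set. -/
def l2norm {ι : Type} (x : ι → ℂ) : ℝ := Real.sqrt (∑' i, ‖x i‖ ^ 2)

/-- `l¹` norm of a (finitely supported, in all uses) vector on an index set. -/
def l1norm {ι : Type} (x : ι → ℂ) : ℝ := ∑' i, ‖x i‖

/-- `S` is the support of a best `k`-term approximation of `x`: it has `k` elements and carries
`k` of the entries of largest magnitude. The best `k`-term approximation is then `x` restricted
to `S`; the norms of `x - x_S` do not depend on how ties are broken. -/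
def IsOptSupport {ι : Type} (x : ι → ℂ) (k : ℕ) (S : Finset ι) : Prop :=
  S.card = k ∧ ∀ i ∈ S, ∀ j, j ∉ S → ‖x j‖ ≤ ‖x i‖

/-- The `l², l¹/√k` error bound for the approximation `y` of `x`, with `ε = 1 / e`, so that
`k / ε = k * e`. -/
def InstanceOptimal {ι : Type} (k e : ℕ) (x y : ι → ℂ) : Prop :=
  ∀ S T : Finset ι, IsOptSupport x k S → IsOptSupport x (k * e) T →
    l2norm (x - y) ≤ l2norm (x - Set.indicator (S : Set ι) x)
      + 22 * (1 / (e : ℝ)) * l1norm (x - Set.indicator (T : Set ι) x) / Real.sqrt k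

/-! ## Bandlimited functions of `D` variables and the reduction to one variable -/

/-- Fourier coefficients of a function on `[0, 2π]^D`. -/
def fhat {D : ℕ} (f : (Fin D → ℝ) → ℂ) (ω : Fin D → ℤ) : ℂ :=
  (1 / (2 * (Real.pi : ℂ)) ^ D) *
    ∫ x in Set.Icc (0 : Fin D → ℝ) (fun _ => 2 * Real.pi),
      Complex.exp (-Complex.I * (∑ d, (ω d : ℂ) * (x d : ℂ))) * f x

/-- Continuous functions on `ℝ^D`, `2π`-periodic in every variable, whose Fourier coefficients
vanish outside `[-M/2, M/2]^D`. -/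
structure IsBandlimited {D : ℕ} (M : ℕ) (f : (Fin D → ℝ) → ℂ) : Prop where
  continuous : Continuous f
  periodic : ∀ (x : Fin D → ℝ) (d : Fin D), f (x + Pi.single d (2 * Real.pi)) = f x
  band : ∀ ω : Fin D → ℤ, (∃ d, (M : ℤ) < 2 * |ω d|) → fhat f ω = 0

/-- Pairwise relatively prime `P_1, …, P_D`, all larger than `M * D`. -/
def IsModuli {D : ℕ} (M : ℕ) (P : Fin D → ℕ) : Prop :=
  Pairwise (fun i j => Nat.Coprime (P i) (P j)) ∧ ∀ d, M * D < P d

/-- `Ñ`. -/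
def bigN {D : ℕ} (P : Fin D → ℕ) : ℕ := ∏ d, P d

/-- The point `((Ñ / P_1) x, …, (Ñ / P_D) x)`. -/
def curve {D : ℕ} (P : Fin D → ℕ) (x : ℝ) : Fin D → ℝ :=
  fun d => ((bigN P : ℝ) / (P d : ℝ)) * x

/-- `f_new`. -/
def fnew {D : ℕ} (P : Fin D → ℕ) (f : (Fin D → ℝ) → ℂ) (x : ℝ) : ℂ := f (curve P x)

/-- The integers in `(-⌈N/2⌉, ⌊N/2⌋]`. -/
def freqRange (N : ℕ) : Finset ℤ := Finset.Ioc (-(((N + 1) / 2 : ℕ) : ℤ)) ((N / 2 : ℕ) : ℤ)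

/-- The integer points of `∏ (-P_d / 2, P_d / 2]`. -/
def freqBox {D : ℕ} (P : Fin D → ℕ) : Set (Fin D → ℤ) :=
  {ω | ∀ d, -(P d : ℤ) < 2 * ω d ∧ 2 * ω d ≤ (P d : ℤ)}

/-- The representative of `a` modulo `N` in `(-N/2, N/2]`. -/
def centeredMod (a : ℤ) (N : ℕ) : ℤ :=
  if 2 * (a % (N : ℤ)) ≤ (N : ℤ) then a % (N : ℤ) else a % (N : ℤ) - (N : ℤ)

/-- The Chinese remainder bijection `g`. -/
def crtMap {D : ℕ} (P : Fin D → ℕ) (ω : Fin D → ℤ) : ℤ :=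
  centeredMod (∑ d, ((bigN P / P d : ℕ) : ℤ) * ω d) (bigN P)

/-- The sparse vector given by a list of (frequency, coefficient) pairs. -/
def vecOf (out : List (ℤ × ℂ)) (ν : ℤ) : ℂ := (out.lookup ν).getD 0

/-- `x_S ∘ g`, extended by zero outside of the domain of `g`. -/
def pullback {D : ℕ} (P : Fin D → ℕ) (out : List (ℤ × ℂ)) : (Fin D → ℤ) → ℂ :=
  Set.indicator (freqBox P) (fun ω => vecOf out (crtMap P ω))

/-! ## Measurement matrices -/

/-- `s_1 < … < s_K` are pairwise relatively prime, with `s_1 ≥ 2` and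
`K = c κ ⌊log_{s_1} N⌋ + 1`, as required for the matrix `M_{s_1, K}`. -/
structure IsRowModuli (N κ c : ℕ) (s : List ℕ) : Prop where
  two_le : 2 ≤ s.headD 0
  increasing : s.Pairwise (· < ·)
  coprime : s.Pairwise Nat.Coprime
  length_eq : s.length = c * κ * Nat.log (s.headD 0) N + 1

/-- `t_1 < … < t_λ < s_1`, `∏ t_i ≥ N / s_1`, and all `t_i`, `s_j` together are pairwise
relatively prime, as required for the matrix `N_{λ, s_1}`. -/
structure IsIdModuli (N : ℕ) (s t : List ℕ) : Prop where
  increasing : t.Pairwise (· < ·)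
  lt_head : ∀ a ∈ t, a < s.headD 0
  prod_ge : N ≤ t.prod * s.headD 0
  coprime : (t ++ s).Pairwise Nat.Coprime

/-- The row data of the deterministic matrix: every `s_j` with multiplicity one. -/
def detRows (s : List ℕ) : List (ℕ × ℕ) := s.map (fun a => (a, 1))

/-- The row data of the random matrix: the distinct `s_j` that were drawn, each with the number of
times it was drawn (every drawn row is processed once and counted with multiplicity). -/
def drawnRows (s : List ℕ) {l : ℕ} (τ : Fin l → Fin s.length) : List (ℕ × ℕ) :=
  (List.finRange s.length).filterMap fun j =>
    if (Finset.univ.filter fun h => τ h = j).card = 0 then none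
    else some (s.get j, (Finset.univ.filter fun h => τ h = j).card)

/-- The number `l` of draws. -/
def numDraws (N : ℕ) (σ : ℝ) : ℕ := ⌈21 * Real.log ((N : ℝ) / (1 - σ))⌉₊

/-- The law of `l` independent draws, uniform with replacement, from `K` indices. -/
def drawLaw (K l : ℕ) : MeasureTheory.Measure (Fin l → Fin K) :=
  MeasureTheory.Measure.pi fun _ => ProbabilityTheory.uniformOn Set.univ

/-- The lengths `s_j` and `t_i s_j` of the sample arrays. -/
def sizes (rows : List (ℕ × ℕ)) (t : List ℕ) : List ℕ :=
  rows.flatMap fun r => (1 :: t).map (· * r.1)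

/-- The discrete Fourier transform of `F(0), F(2π/n), …, F(2π(n-1)/n)` at `h`. -/
def sampleDFT (F : ℝ → ℂ) (n h : ℕ) : ℂ :=
  (1 / (n : ℂ)) * ∑ p ∈ Finset.range n,
    F (2 * Real.pi * (p : ℝ) / (n : ℝ)) *
      Complex.exp (-2 * (Real.pi : ℂ) * Complex.I * (h : ℂ) * (p : ℂ) / (n : ℂ))

/-- The measurement stage (Fast Multiply): one DFT for each of the given lengths. The entry at
`(n, h)` belongs to the matrix row that selects the frequencies congruent to `h` modulo `n`. -/
def fastMultiply (ns : List ℕ) (F : ℝ → ℂ) : ℕ → ℕ → ℂ :=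
  fun n h => if n ∈ ns then sampleDFT F n h else 0

/-- The points at which the measurement stage evaluates its one-dimensional input. -/
def samplePoints (ns : List ℕ) : Finset ℝ :=
  ns.toFinset.biUnion fun n =>
    (Finset.range n).image fun p : ℕ => 2 * Real.pi * (p : ℝ) / (n : ℝ)

/-- The points of `[0, 2π]^D` at which the periodic function `f` is evaluated when the
measurement stage is run on `f_new`. -/
def evalPoints {D : ℕ} (P : Fin D → ℕ) (ns : List ℕ) : Finset (Fin D → ℝ) :=
  (samplePoints ns).image fun x d => toIcoMod Real.two_pi_pos 0 (curve P x d)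

/-! ## Step counting

A real random access machine: one step for each arithmetic operation (including absolute
values and integer division with remainder), comparison, table or memory access on integers and
reals. Programs are written in a monad that carries the number of steps. -/

/-- A result together with the number of steps spent on it. -/
structure Timed (α : Type) where
  val : α
  steps : ℕ

instance : Monad Timed where
  pure a := ⟨a, 0⟩
  bind x f := ⟨(f x.val).val, x.steps + (f x.val).steps⟩

/-- Spend `n` steps. -/
def tick (n : ℕ) : Timed Unit := ⟨(), n⟩

/-- Apply a program to every element of a list; two further steps per element. -/
def mapT {α β : Type} (f : α → Timed β) : List α → Timed (List β)
  | [] => pure []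
  | a :: l => do
    tick 2
    let b ← f a
    let bs ← mapT f l
    pure (b :: bs)

/-- Concatenate a list of lists, one step per element and per list. -/
def flattenT {α : Type} : List (List α) → Timed (List α)
  | [] => pure []
  | a :: l => do
    tick (a.length + 1)
    let r ← flattenT l
    pure (a ++ r)

/-- Keep the elements that pass a test that takes boundedly many operations. -/
def filterT {α : Type} (p : α → Bool) : List α → Timed (List α)
  | [] => pure []
  | a :: l => do
    tick 6
    let r ← filterT p l
    pure (if p a then a :: r else r)

/-- Merge two sorted lists. -/
def mergeT {α : Type} (le : α → α → Bool) : List α → List α → Timed (List α)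
  | [], l => pure l
  | a :: l, [] => pure (a :: l)
  | a :: l, b :: m =>
    if le a b then do
      tick 4
      let r ← mergeT le l (b :: m)
      pure (a :: r)
    else do
      tick 4
      let r ← mergeT le (a :: l) m
      pure (b :: r)
termination_by l m => l.length + m.length

/-- Merge sort with recursion depth bounded by the first argument. -/
def sortAux {α : Type} (le : α → α → Bool) : ℕ → List α → Timed (List α)
  | 0, l => pure l
  | d + 1, l =>
    if l.length ≤ 1 then do
      tick 2
      pure l
    else do
      tick (l.length + 3)
      let a ← sortAux le d (l.take (l.length / 2))
      let b ← sortAux le d (l.drop (l.length / 2))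
      mergeT le a b

/-- Merge sort. -/
def sortT {α : Type} (le : α → α → Bool) (l : List α) : Timed (List α) :=
  sortAux le l.length l

/-- Cut a list into groups of five; the last group may be shorter. -/
def fives {α : Type} : List α → List (List α)
  | [] => []
  | a :: b :: c :: d :: e :: l => [a, b, c, d, e] :: fives l
  | l => [l]

/-- The element of rank `r` (counted from 0) by sorting. -/
def rankBySort {α : Type} [LinearOrder α] [Inhabited α] (l : List α) (r : ℕ) : Timed α := do
  let m ← sortT (fun a b => decide (a ≤ b)) l
  tick 1
  pure (m.getD r default)

/-- The element of rank `r` (counted from 0) by the median-of-medians method, with recursion depth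
bounded by the first argument. -/
def selectAux {α : Type} [LinearOrder α] [Inhabited α] : ℕ → List α → ℕ → Timed α
  | 0, _, _ => pure default
  | d + 1, l, r =>
    if l.length ≤ 100 then rankBySort l r
    else do
      tick l.length
      let ms ← mapT (fun g => rankBySort g (g.length / 2)) (fives l)
      let p ← selectAux d ms (ms.length / 2)
      let lo ← filterT (fun a => decide (a < p)) l
      let eq ← filterT (fun a => decide (a = p)) l
      let hi ← filterT (fun a => decide (p < a)) l
      tick (l.length + 4)
      if r < lo.length then selectAux d lo r
      else if r < lo.length + eq.length then pure p
      else selectAux d hi (r - (lo.length + eq.length))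

/-- The median of a multiset of reals, given as a list. -/
def medianT (l : List ℝ) : Timed ℝ := do
  tick (l.length + 2)
  selectAux (l.length + 1) l (l.length / 2)

/-! ## The two algorithms

`rows` lists pairs (modulus `s_j`, multiplicity), `t` lists the `t_i`, and `G` is the table that
the measurement stage has produced for them. -/

/-- All entries `(G_ω)_j` that estimate the coefficient at `ω`, with multiplicity. -/
def entriesT (rows : List (ℕ × ℕ)) (t : List ℕ) (G : ℕ → ℕ → ℂ) (ω : ℤ) : Timed (List ℂ) := do
  let ls ← mapT (fun r : ℕ × ℕ => do
    let v ← mapT (fun a : ℕ => do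
      tick 4
      pure (G (a * r.1) (ω % ((a * r.1 : ℕ) : ℤ)).toNat)) (1 :: t)
    flattenT (List.replicate r.2 v)) rows
  flattenT ls

/-- Estimation of one coefficient by medians of real and imaginary parts. -/
def estimateT (rows : List (ℕ × ℕ)) (t : List ℕ) (G : ℕ → ℕ → ℂ) (ω : ℤ) : Timed (ℤ × ℂ) := do
  let v ← entriesT rows t G ω
  tick (2 * v.length)
  let re ← medianT (v.map Complex.re)
  let im ← medianT (v.map Complex.im)
  pure (ω, ⟨re, im⟩)

/-- Sort by magnitude and output the `2 k` largest (all, if there are fewer). -/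
def largestT (k : ℕ) (x : List (ℤ × ℂ)) : Timed (List (ℤ × ℂ)) := do
  let y ← sortT (fun a b => decide (‖b.2‖ ≤ ‖a.2‖)) x
  tick (2 * k)
  pure (y.take (2 * k))

/-- Fourier Approximate 1 after its measurement stage: estimate all frequencies. -/
def approx1T (N k : ℕ) (rows : List (ℕ × ℕ)) (G : ℕ → ℕ → ℂ) : Timed (List (ℤ × ℂ)) := do
  let x ← mapT (fun n : ℕ => do
    tick 3
    estimateT rows [] G (1 - (((N + 1) / 2 : ℕ) : ℤ) + (n : ℤ))) (List.range N)
  largestT k x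

/-- A minimizer over `b ≤ n` of the distance between the entry for `h` modulo `s` and the entry
for `h + b s` modulo `t s`. -/
def argminT (G : ℕ → ℕ → ℂ) (s t h : ℕ) : ℕ → Timed ℕ
  | 0 => do
    tick 1
    pure 0
  | n + 1 => do
    let b ← argminT G s t h n
    tick 16
    pure (if ‖G s h - G (t * s) (h + (n + 1) * s)‖ < ‖G s h - G (t * s) (h + b * s)‖
      then n + 1 else b)

/-- The residue modulo `t` found for the pair `(s, h)`. -/
def residueT (G : ℕ → ℕ → ℂ) (s h t : ℕ) : Timed (ℕ × ℕ) := do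
  let b ← argminT G s t h (t - 1)
  tick 4
  pure (t, (h + b * s) % t)

/-- Search for `x + c Q` congruent to `a` modulo `t`, with `c < n`. -/
def crtSearchT (x Q a t : ℕ) : ℕ → Timed ℕ
  | 0 => pure x
  | c + 1 => do
    let y ← crtSearchT x Q a t c
    tick 6
    pure (if (x + c * Q) % t = a % t then x + c * Q else y)

/-- Incremental Chinese remaindering: from `x` modulo `Q` and residues for further moduli to a
solution modulo the product of all moduli, and that product. -/
def crtT : ℕ → ℕ → List (ℕ × ℕ) → Timed (ℕ × ℕ)
  | x, Q, [] => pure (x, Q)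
  | x, Q, (t, a) :: l => do
    tick 2
    let y ← crtSearchT x Q a t t
    crtT y (Q * t) l

/-- Reconstruction of `ω_{j,h}` from its residues modulo `s_j, t_1, …, t_λ`. -/
def recoverT (N : ℕ) (t : List ℕ) (G : ℕ → ℕ → ℂ) (s h : ℕ) : Timed ℤ := do
  let as ← mapT (residueT G s h) t
  let xQ ← crtT h s as
  tick 4
  pure (if 2 * xQ.1 ≤ N then (xQ.1 : ℤ) else (xQ.1 : ℤ) - (xQ.2 : ℤ))

/-- All reconstructed frequencies, each with the multiplicity of its row. -/
def identifyT (N : ℕ) (rows : List (ℕ × ℕ)) (t : List ℕ) (G : ℕ → ℕ → ℂ) :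
    Timed (List (ℤ × ℕ)) := do
  let ls ← mapT (fun r : ℕ × ℕ =>
    mapT (fun h : ℕ => do
      let ω ← recoverT N t G r.1 h
      pure (ω, r.2)) (List.range r.1)) rows
  flattenT ls

/-- Add up the multiplicities of equal neighbouring frequencies. -/
def tallyT : List (ℤ × ℕ) → Timed (List (ℤ × ℕ))
  | [] => pure []
  | (ω, w) :: l => do
    tick 4
    let r ← tallyT l
    pure (match r with
      | [] => [(ω, w)]
      | (ω', w') :: r' => if ω = ω' then (ω, w + w') :: r' else (ω, w) :: (ω', w') :: r')

/-- Fourier Approximate 2 after its measurement stage: identify frequencies, keep those in the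
bandwidth that were reconstructed by more than half of the rows, estimate their coefficients, and
output the `2 k` largest. -/
def approx2T (N k : ℕ) (rows : List (ℕ × ℕ)) (t : List ℕ) (G : ℕ → ℕ → ℂ) :
    Timed (List (ℤ × ℂ)) := do
  let all ← identifyT N rows t G
  let sorted ← sortT (fun a b => decide (a.1 ≤ b.1)) all
  let counted ← tallyT sorted
  tick rows.length
  let kept ← filterT
    (fun a => decide (a.1 ∈ freqRange N ∧ (rows.map Prod.snd).sum < 2 * a.2)) counted
  let x ← mapT (fun a : ℤ × ℕ => estimateT rows t G a.1) kept
  let y ← filterT (fun a => decide (a.2 ≠ 0)) x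
  largestT k y

/-- Fourier Approximate 1 on the one-dimensional input `F`; the steps are those after the
measurement stage. -/
def fourierApprox1 (N k : ℕ) (rows : List (ℕ × ℕ)) (F : ℝ → ℂ) : Timed (List (ℤ × ℂ)) :=
  approx1T N k rows (fastMultiply (sizes rows []) F)

/-- Fourier Approximate 2 on the one-dimensional input `F`; the steps are those after the
measurement stage. -/
def fourierApprox2 (N k : ℕ) (rows : List (ℕ × ℕ)) (t : List ℕ) (F : ℝ → ℂ) :
    Timed (List (ℤ × ℂ)) :=
  approx2T N k rows t (fastMultiply (sizes rows t) F)

end SFT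

end

/-! A bandlimited continuous `f` has only finitely many nonzero Fourier coefficients, so its Fourier
series converges everywhere and `f` is a trigonometric polynomial (`IsBandlimited.eq_sum`). On the
curve, `ω` becomes the frequency `∑ (Ñ / P_d) ω_d`. For `ω` in the band this integer already lies in
`(-Ñ/2, Ñ/2]`, because `M D < P_d`, so it equals the Chinese remainder image of `ω`. Hence `f_new`
has the coefficients of `f`, relabelled by a bijection (`crtMap_bijOn`), and a DFT of length `n`
returns exactly the sums of its coefficients over residue classes modulo `n`
(`isTable_fastMultiply`).

The remaining argument is one-dimensional. Let `x` be the relabelled coefficients, `T` a best set of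
at most `κ` frequencies, `δ` the `l¹` mass off `T` divided by `κ`, and `L = ⌊log_{s_1} N⌋`. Pairwise
coprime moduli dividing a nonzero difference of two frequencies have a product of size at most `N`,
so two frequencies collide modulo at most `L` of the `s_j`. For fixed `ω`, at most `κ L` moduli let
an element of `T` collide with `ω`, and by averaging at most `κ L` let more than `δ` of the
remaining mass collide (`card_noisy_le`). Among `4 κ L + 1` rows the noisy ones are a minority.
Among `14 κ L + 1` they are fewer than a seventh, and a Chernoff bound with a union bound over the
`N` frequencies shows that the draws keep them a minority for all `ω` at once
(`drawnRows_mostlyGood`).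

On a good row every entry for `ω` is within `δ` of `x_ω`, so the medians are within `2 δ`. If `|x_ω|
> 2 δ`, the correct refinement modulo `t_i s_j` changes the entry by at most the noise, while a
wrong one removes `x_ω` itself. The minimization therefore finds the residues of `ω`, and more than
half of the rows reconstruct it (`separates_of_noise_lt`, `approx2T_good`). Any output with these
properties has error at most the best `k`-term error plus `22 δ √k` (`error_le_of_isGoodOutput`),
and `κ = k / ε` turns this into the stated bound.

The step counts are sums along the programs. Fewer than `2 max s_j + 1` frequencies can be
reconstructed by more than half of the rows, so estimation costs no more than identification up to
constants (`approx2T_steps`). The moduli are primes, supplied by a Chebyshev bound: all primes up to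
a multiple of `log N` serve as `t_i`, and `s_1` is a prime just above both this range and `κ`, which
keeps `s_K` of order `κ log N` (`exists_moduli_approx2`). -/

noncomputable section

namespace SFT

/-! ## Timed programs -/

section Timed
variable {α β : Type}

@[simp] lemma pure_val (a : α) : (pure a : Timed α).val = a := rfl
@[simp] lemma pure_steps (a : α) : (pure a : Timed α).steps = 0 := rfl
@[simp] lemma bind_val (x : Timed α) (f : α → Timed β) : (x >>= f).val = (f x.val).val := rfl
@[simp] lemma bind_steps (x : Timed α) (f : α → Timed β) :
    (x >>= f).steps = x.steps + (f x.val).steps := rfl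
@[simp] lemma tick_steps (n : ℕ) : (tick n).steps = n := rfl

@[simp] lemma mapT_val (f : α → Timed β) (l : List α) :
    (mapT f l).val = l.map fun a => (f a).val := by
  induction l with
  | nil => rfl
  | cons a l ih => simp [mapT, ih]

lemma mapT_steps (f : α → Timed β) (l : List α) :
    (mapT f l).steps = (l.map fun a => 2 + (f a).steps).sum := by
  induction l with
  | nil => rfl
  | cons a l ih => simp [mapT, ih]; ring

lemma mapT_steps_le (f : α → Timed β) (l : List α) (B : ℕ) (h : ∀ a ∈ l, (f a).steps ≤ B) :
    (mapT f l).steps ≤ l.length * (2 + B) := by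
  rw [mapT_steps]
  have := List.sum_le_card_nsmul (l.map fun a => 2 + (f a).steps) (2 + B) (by
    intro x hx
    obtain ⟨a, ha, rfl⟩ := List.mem_map.1 hx
    have := h a ha
    omega)
  simpa using this

@[simp] lemma flattenT_val (l : List (List α)) : (flattenT l).val = l.flatten := by
  induction l with
  | nil => rfl
  | cons a l ih => simp [flattenT, ih]

lemma flattenT_steps (l : List (List α)) :
    (flattenT l).steps = l.flatten.length + l.length := by
  induction l with
  | nil => rfl
  | cons a l ih => simp [flattenT, ih]; ring

@[simp] lemma filterT_val (p : α → Bool) (l : List α) : (filterT p l).val = l.filter p := by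
  induction l with
  | nil => rfl
  | cons a l ih => simp [filterT, ih, List.filter_cons]

lemma filterT_steps (p : α → Bool) (l : List α) : (filterT p l).steps = 6 * l.length := by
  induction l with
  | nil => rfl
  | cons a l ih => simp [filterT, ih]; ring

lemma mergeT_val (le : α → α → Bool) (l m : List α) :
    (mergeT le l m).val = List.merge l m le := by
  induction l, m using mergeT.induct (le := le) with
  | case1 l => simp [mergeT]
  | case2 a l => simp [mergeT]
  | case3 a l b m h ih => rw [mergeT]; simp [h, ih]
  | case4 a l b m h ih => rw [mergeT]; simp [h, ih]

lemma mergeT_steps (le : α → α → Bool) (l m : List α) :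
    (mergeT le l m).steps ≤ 4 * (l.length + m.length) := by
  induction l, m using mergeT.induct (le := le) with
  | case1 l => simp [mergeT]
  | case2 a l => simp [mergeT]
  | case3 a l b m h ih => rw [mergeT]; simp [h] at ih ⊢; omega
  | case4 a l b m h ih => rw [mergeT]; simp [h] at ih ⊢; omega

lemma sortAux_perm (le : α → α → Bool) (d : ℕ) (l : List α) :
    (sortAux le d l).val.Perm l := by
  induction d generalizing l with
  | zero => simp [sortAux]
  | succ d ih =>
    rw [sortAux]
    split_ifs with h
    · simp
    · simp only [bind_val, mergeT_val]
      refine (List.merge_perm_append _).trans ?_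
      refine ((ih _).append (ih _)).trans ?_
      rw [List.take_append_drop]

lemma sortAux_pairwise (le : α → α → Bool) (trans : ∀ a b c, le a b → le b c → le a c)
    (total : ∀ a b, le a b || le b a) (d : ℕ) (l : List α) (hd : l.length ≤ d) :
    (sortAux le d l).val.Pairwise fun a b => le a b := by
  induction d generalizing l with
  | zero =>
    obtain rfl : l = [] := List.length_eq_zero_iff.1 (by omega)
    simp [sortAux]
  | succ d ih =>
    rw [sortAux]
    split_ifs with h
    · simp only [bind_val, pure_val]
      match l, h with
      | [], _ => simp
      | [a], _ => simp
    · simp only [bind_val, mergeT_val]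
      refine List.pairwise_merge trans total _ _ (ih _ ?_) (ih _ ?_)
      · simp; omega
      · simp; omega

/-- `Nat.clog 2` falls by exactly one from `n` to the larger half `⌈n/2⌉`. A level costs `n + 3` for
splitting, at most `4 n` for merging, and the constants 2 of both halves; for `n ≥ 2` this fits into
`10 n + 2`. -/
lemma sortAux_steps (le : α → α → Bool) (d : ℕ) (l : List α) :
    (sortAux le d l).steps ≤ 10 * l.length * Nat.clog 2 l.length + 2 := by
  induction d generalizing l with
  | zero => simp [sortAux]
  | succ d ih =>
    rw [sortAux]
    split_ifs with h
    · simp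
    · simp only [bind_steps, tick_steps]
      have h1 := ih (l.take (l.length / 2))
      have h2 := ih (l.drop (l.length / 2))
      have h3 := mergeT_steps le (sortAux le d (l.take (l.length / 2))).val
        (sortAux le d (l.drop (l.length / 2))).val
      rw [(sortAux_perm le d _).length_eq, (sortAux_perm le d _).length_eq] at h3
      simp only [List.length_take, List.length_drop] at h1 h2 h3
      have hn : 2 ≤ l.length := by omega
      generalize l.length = n at *
      have hm : min (n / 2) n = n / 2 := by omega
      rw [hm] at h1 h3
      have hc : Nat.clog 2 n = Nat.clog 2 ((n + 1) / 2) + 1 := by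
        rw [Nat.clog_of_two_le (by norm_num) hn]
        rfl
      have hc1 : Nat.clog 2 (n / 2) ≤ Nat.clog 2 ((n + 1) / 2) := Nat.clog_mono_right _ (by omega)
      have hc2 : n - n / 2 = (n + 1) / 2 := by omega
      rw [hc2] at h2 h3
      rw [hc]
      generalize Nat.clog 2 ((n + 1) / 2) = c at *
      have e : n / 2 + (n + 1) / 2 = n := by omega
      have h4 : 10 * (n / 2) * Nat.clog 2 (n / 2) ≤ 10 * (n / 2) * c := Nat.mul_le_mul_left _ hc1
      have h5 : 10 * (n / 2) * c + 10 * ((n + 1) / 2) * c = 10 * n * c := by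
        rw [← add_mul, ← mul_add, e]
      have h6 : 10 * n * (c + 1) = 10 * n * c + 10 * n := by ring
      omega

lemma sortT_perm (le : α → α → Bool) (l : List α) : (sortT le l).val.Perm l :=
  sortAux_perm le _ l

lemma sortT_pairwise (le : α → α → Bool) (trans : ∀ a b c, le a b → le b c → le a c)
    (total : ∀ a b, le a b || le b a) (l : List α) :
    (sortT le l).val.Pairwise fun a b => le a b :=
  sortAux_pairwise le trans total _ l le_rfl

lemma sortT_steps (le : α → α → Bool) (l : List α) :
    (sortT le l).steps ≤ 10 * l.length * Nat.clog 2 l.length + 2 :=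
  sortAux_steps le _ l

end Timed

/-! ## Selection and medians -/

section Select
variable {α : Type} [LinearOrder α]

/-- `v` is the entry of rank `r` (counted from `0`) of the list `l`. -/
def IsRank (l : List α) (r : ℕ) (v : α) : Prop :=
  v ∈ l ∧ l.countP (fun a => decide (a < v)) ≤ r ∧ r < l.countP (fun a => decide (a ≤ v))

lemma IsRank.perm {l m : List α} (h : l.Perm m) {r : ℕ} {v : α} (hv : IsRank l r v) :
    IsRank m r v := by
  rw [IsRank, ← h.mem_iff, ← h.countP_eq, ← h.countP_eq]
  exact hv

/-- Entries from position `r` on are not below `m[r]`, so smaller ones sit among the first `r`; the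
first `r + 1` entries are all at most `m[r]`. -/
lemma isRank_of_sorted {m : List α} (hm : m.Pairwise (· ≤ ·)) {r : ℕ} (hr : r < m.length) :
    IsRank m r m[r] := by
  have hmono : ∀ i j (hi : i < m.length) (hj : j < m.length), i ≤ j → m[i] ≤ m[j] := by
    intro i j hi hj hij
    rcases hij.eq_or_lt with rfl | h
    · exact le_rfl
    · exact List.pairwise_iff_getElem.1 hm i j hi hj h
  refine ⟨List.getElem_mem _, ?_, ?_⟩
  · have h0 := List.countP_append (p := fun a => decide (a < m[r])) (l₁ := m.take r)
      (l₂ := m.drop r)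
    rw [List.take_append_drop] at h0
    have h1 : (m.drop r).countP (fun a => decide (a < m[r])) = 0 := by
      rw [List.countP_eq_zero]
      intro a ha
      obtain ⟨i, hi, rfl⟩ := List.mem_iff_getElem.1 ha
      simp only [List.getElem_drop, decide_eq_true_eq, not_lt]
      exact hmono _ _ _ _ (by omega)
    have h2 := List.countP_le_length (p := fun a => decide (a < m[r])) (l := m.take r)
    simp only [List.length_take] at h2
    omega
  · have h : (m.take (r + 1)).countP (fun a => decide (a ≤ m[r])) = (m.take (r + 1)).length := by
      rw [List.countP_eq_length]
      intro a ha
      obtain ⟨i, hi, rfl⟩ := List.mem_iff_getElem.1 ha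
      simp only [List.getElem_take, decide_eq_true_eq]
      simp only [List.length_take] at hi
      exact hmono _ _ _ _ (by omega)
    have h2 := (List.take_sublist (r + 1) m).countP_le (p := fun a => decide (a ≤ m[r]))
    rw [h, List.length_take] at h2
    omega

variable [Inhabited α]

lemma rankBySort_val (l : List α) {r : ℕ} (hr : r < l.length) :
    IsRank l r (rankBySort l r).val := by
  set m := (sortT (fun a b : α => decide (a ≤ b)) l).val with hm
  have hp : m.Perm l := sortT_perm _ l
  have hs : m.Pairwise (· ≤ ·) := by
    have := sortT_pairwise (fun a b : α => decide (a ≤ b))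
      (fun a b c h1 h2 => by simpa using le_trans (of_decide_eq_true h1) (of_decide_eq_true h2))
      (fun a b => by simpa using le_total a b) l
    simpa using this
  have hr' : r < m.length := hp.length_eq ▸ hr
  have : (rankBySort l r).val = m[r] := by
    simp [rankBySort, ← hm, List.getD_eq_getElem?_getD, hr']
  rw [this]
  exact (isRank_of_sorted hs hr').perm hp

lemma rankBySort_steps (l : List α) (r : ℕ) :
    (rankBySort l r).steps ≤ 10 * l.length * Nat.clog 2 l.length + 3 := by
  have := sortT_steps (fun a b : α => decide (a ≤ b)) l
  simp [rankBySort]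
  omega

omit [LinearOrder α] [Inhabited α] in
lemma fives_ne_nil {l g : List α} (hg : g ∈ fives l) (hl : l ≠ []) :
    g ≠ [] ∧ g.length ≤ 5 ∧ ∀ a ∈ g, a ∈ l := by
  induction l using fives.induct with
  | case1 => exact absurd rfl hl
  | case2 a b c d e l ih =>
    rw [fives, List.mem_cons] at hg
    rcases hg with rfl | hg
    · simp
    · by_cases h : l = []
      · subst h
        simp [fives] at hg
      · obtain ⟨h1, h2, h3⟩ := ih hg h
        exact ⟨h1, h2, fun x hx => by simp [h3 x hx]⟩
  | case3 l h0 h5 =>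
    rw [fives] at hg
    · simp at hg
      subst hg
      refine ⟨hl, ?_, fun _ h => h⟩
      by_contra hlen
      match g, hlen, h5 with
      | a :: b :: c :: d :: e :: f :: l', _, h5 => exact h5 a b c d e _ rfl
      | [], h, _ => simp at h
      | [_], h, _ => simp at h
      | [_, _], h, _ => simp at h
      | [_, _, _], h, _ => simp at h
      | [_, _, _, _], h, _ => simp at h
      | [_, _, _, _, _], h, _ => simp at h
    · exact h0
    · exact h5

omit [LinearOrder α] [Inhabited α] in
lemma fives_length (l : List α) : (fives l).length = (l.length + 4) / 5 := by
  induction l using fives.induct with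
  | case1 => simp [fives]
  | case2 a b c d e l ih =>
    rw [fives, List.length_cons, ih]
    simp only [List.length_cons]
    omega
  | case3 l h0 h5 =>
    rw [fives]
    · match l, h0, h5 with
      | a :: b :: c :: d :: e :: l', _, h5 => exact absurd rfl (h5 a b c d e _)
      | [], h, _ => simp at h
      | [_], h, _ => simp
      | [_, _], h, _ => simp
      | [_, _, _], h, _ => simp
      | [_, _, _, _], h, _ => simp
    · exact h0
    · exact h5

/-- The list of medians of the groups of five. -/
def groupMedians (l : List α) : List α := (fives l).map fun g => (rankBySort g (g.length / 2)).val

omit [Inhabited α] in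
lemma countP_le_add_countP_lt (l : List α) (p : α) :
    l.countP (fun a => decide (a ≤ p)) + l.countP (fun a => decide (p < a)) = l.length := by
  rw [List.length_eq_countP_add_countP (fun a => decide (a ≤ p))]
  simp

omit [Inhabited α] in
lemma countP_lt_add_countP_le (l : List α) (p : α) :
    l.countP (fun a => decide (a < p)) + l.countP (fun a => decide (p ≤ a)) = l.length := by
  rw [List.length_eq_countP_add_countP (fun a => decide (a < p))]
  simp

lemma group_le {g : List α} (hg : g ≠ []) {p : α}
    (h : (rankBySort g (g.length / 2)).val ≤ p) :
    g.length / 2 + 1 ≤ g.countP fun a => decide (a ≤ p) := by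
  have hl : 0 < g.length := List.length_pos_iff.2 hg
  obtain ⟨-, -, h3⟩ := rankBySort_val g (r := g.length / 2) (by omega)
  refine (Nat.succ_le_of_lt h3).trans (List.countP_mono_left fun a _ ha => ?_)
  simp only [decide_eq_true_eq] at ha ⊢
  exact ha.trans h

lemma group_ge {g : List α} (hg : g ≠ []) {p : α}
    (h : p ≤ (rankBySort g (g.length / 2)).val) :
    g.length - g.length / 2 ≤ g.countP fun a => decide (p ≤ a) := by
  have hl : 0 < g.length := List.length_pos_iff.2 hg
  obtain ⟨-, h2, -⟩ := rankBySort_val g (r := g.length / 2) (by omega)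
  have h4 := countP_lt_add_countP_le g (rankBySort g (g.length / 2)).val
  have h5 : g.countP (fun a => decide ((rankBySort g (g.length / 2)).val ≤ a)) ≤
      g.countP fun a => decide (p ≤ a) := List.countP_mono_left fun a _ ha => by
    simp only [decide_eq_true_eq] at ha ⊢
    exact h.trans ha
  omega

/-- A full group with median at most `p` contains three entries at most `p`. Only the last group can
be shorter, and it still contributes one, whence the defect 2. -/
lemma medians_le (l : List α) (p : α) :
    3 * (groupMedians l).countP (fun a => decide (a ≤ p)) ≤
      l.countP (fun a => decide (a ≤ p)) + 2 := by
  induction l using fives.induct with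
  | case1 => simp [groupMedians, fives]
  | case2 a b c d e l ih =>
    have hg := group_le (g := [a, b, c, d, e]) (by simp) (p := p)
    have hs : a :: b :: c :: d :: e :: l = [a, b, c, d, e] ++ l := rfl
    rw [groupMedians, fives, List.map_cons, List.countP_cons, ← groupMedians, hs,
      List.countP_append]
    split_ifs with h
    · have := hg (by simpa using h)
      simp only [List.length_cons, List.length_nil] at this
      omega
    · omega
  | case3 l h0 h5 =>
    have hg := group_le (g := l) h0 (p := p)
    rw [groupMedians, fives, List.map_cons, List.countP_cons]
    · split_ifs with h
      · have := hg (by simpa using h)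
        simp only [List.map_nil, List.countP_nil]
        omega
      · simp
    · exact h0
    · exact h5

lemma medians_ge (l : List α) (p : α) :
    3 * (groupMedians l).countP (fun a => decide (p ≤ a)) ≤
      l.countP (fun a => decide (p ≤ a)) + 2 := by
  induction l using fives.induct with
  | case1 => simp [groupMedians, fives]
  | case2 a b c d e l ih =>
    have hg := group_ge (g := [a, b, c, d, e]) (by simp) (p := p)
    have hs : a :: b :: c :: d :: e :: l = [a, b, c, d, e] ++ l := rfl
    rw [groupMedians, fives, List.map_cons, List.countP_cons, ← groupMedians, hs,
      List.countP_append]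
    split_ifs with h
    · have := hg (by simpa using h)
      simp only [List.length_cons, List.length_nil] at this
      omega
    · omega
  | case3 l h0 h5 =>
    have hg := group_ge (g := l) h0 (p := p)
    have hl : 0 < l.length := List.length_pos_iff.2 h0
    rw [groupMedians, fives, List.map_cons, List.countP_cons]
    · split_ifs with h
      · have := hg (by simpa using h)
        simp only [List.map_nil, List.countP_nil]
        omega
      · simp
    · exact h0
    · exact h5

lemma groupMedians_subset {l : List α} {a : α} (h : a ∈ groupMedians l) : a ∈ l := by
  obtain ⟨g, hg, rfl⟩ := List.mem_map.1 h
  have hl : l ≠ [] := by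
    rintro rfl
    simp [fives] at hg
  obtain ⟨h1, -, h3⟩ := fives_ne_nil hg hl
  have hl : 0 < g.length := List.length_pos_iff.2 h1
  exact h3 _ (rankBySort_val g (r := g.length / 2) (by omega)).1

omit [Inhabited α] in
lemma countP_eq_add (l : List α) (p : α) : l.countP (fun a => decide (a ≤ p)) =
    l.countP (fun a => decide (a < p)) + l.countP (fun a => decide (a = p)) := by
  induction l with
  | nil => simp
  | cons a l ih =>
    simp only [List.countP_cons, ih, decide_eq_true_eq]
    rcases lt_trichotomy a p with h | h | h
    · simp [h, h.le, h.ne]; ring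
    · simp [h]; ring
    · simp [h.not_ge, h.not_gt, h.ne']

omit [Inhabited α] in
-- Converts ranks when selection recurses above the pivot: the entries up to `p`, all counted by
-- `q`, are the shift between the rank in `l` and the rank in the part above `p`.
lemma countP_eq_add_of_le (l : List α) (p : α) {q : α → Bool} (hq : ∀ a, a ≤ p → q a = true) :
    l.countP q =
      l.countP (fun a => decide (a ≤ p)) + l.countP (fun a => q a && decide (p < a)) := by
  induction l with
  | nil => simp
  | cons a l ih =>
    simp only [List.countP_cons, ih]
    rcases le_or_gt a p with h | h
    · simp [h, hq a h, h.not_gt]; ring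
    · simp [h, h.not_ge]; ring

/-- The recursion of `selectAux` in one formula. -/
lemma selectAux_succ {d : ℕ} {l : List α} {r : ℕ} (hl : ¬ l.length ≤ 100) :
    ∃ c, c ≤ 2 * l.length + 4 + (fives l).length * 160 + 18 * l.length ∧
    selectAux (d + 1) l r =
      let p := selectAux d (groupMedians l) ((groupMedians l).length / 2)
      let lo := l.filter fun a => decide (a < p.val)
      let eq := l.filter fun a => decide (a = p.val)
      let hi := l.filter fun a => decide (p.val < a)
      let q := if r < lo.length then selectAux d lo r
        else if r < lo.length + eq.length then ⟨p.val, 0⟩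
        else selectAux d hi (r - (lo.length + eq.length))
      ⟨q.val, c + p.steps + q.steps⟩ := by
  -- Three filters account for `18 * l.length`. A group has at most five entries, so `Nat.clog` is
  -- at most 3 and its median costs at most 153 steps; 160 leaves room for the two steps that `mapT`
  -- adds.
  refine ⟨2 * l.length + 4 + (mapT (fun g => rankBySort g (g.length / 2)) (fives l)).steps
    + 18 * l.length, ?_, ?_⟩
  · have := mapT_steps_le (fun g => rankBySort g (g.length / 2)) (fives l) 158 (by
      intro g hg
      have hne : l ≠ [] := by rintro rfl; simp at hl
      have h5 := (fives_ne_nil hg hne).2.1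
      refine (rankBySort_steps g _).trans ?_
      have : Nat.clog 2 g.length ≤ 3 :=
        (Nat.clog_mono_right 2 h5).trans (Nat.clog_le_of_le_pow (by norm_num))
      have := Nat.mul_le_mul (Nat.mul_le_mul_left 10 h5) this
      omega)
    omega
  · rw [selectAux, if_neg hl]
    simp only [Bind.bind, Pure.pure, mapT_val, filterT_val, filterT_steps, tick]
    have hg : (List.map (fun a ↦ (rankBySort a (a.length / 2)).val) (fives l)) = groupMedians l :=
      rfl
    rw [hg]
    set p := selectAux d (groupMedians l) ((groupMedians l).length / 2) with hp
    set lo := l.filter fun a => decide (a < p.val)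
    set eq := l.filter fun a => decide (a = p.val)
    set hi := l.filter fun a => decide (p.val < a)
    split_ifs <;> simp <;> ring

lemma selectAux_val (d : ℕ) (l : List α) (r : ℕ) (hd : l.length < d) (hr : r < l.length) :
    IsRank l r (selectAux d l r).val := by
  induction d generalizing l r with
  | zero => omega
  | succ d ih =>
    by_cases hl : l.length ≤ 100
    · rw [selectAux, if_pos hl]
      exact rankBySort_val l hr
    · obtain ⟨c, -, hc⟩ := selectAux_succ (d := d) (r := r) hl
      rw [hc]
      dsimp only
      have hgl : (groupMedians l).length = (l.length + 4) / 5 := by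
        rw [groupMedians, List.length_map, fives_length]
      have hp := ih (groupMedians l) ((groupMedians l).length / 2) (by omega) (by omega)
      set p := (selectAux d (groupMedians l) ((groupMedians l).length / 2)).val
      have hpl : p ∈ l := groupMedians_subset hp.1
      have e1 := countP_eq_add l p
      have e2 := countP_le_add_countP_lt l p
      have e3 : 0 < l.countP fun a => decide (a = p) := List.countP_pos_iff.2 ⟨p, hpl, by simp⟩
      simp only [← List.countP_eq_length_filter]
      split_ifs with h1 h2
      · have hlen : (l.filter fun a => decide (a < p)).length =
          l.countP fun a => decide (a < p) := List.countP_eq_length_filter.symm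
        have h := ih (l.filter fun a => decide (a < p)) r (by omega) (by omega)
        set v := (selectAux d (l.filter fun a => decide (a < p)) r).val
        obtain ⟨g1, g2, g3⟩ := h
        rw [List.mem_filter] at g1
        have hv : v < p := by simpa using g1.2
        refine ⟨g1.1, ?_, ?_⟩
        · rw [List.countP_filter] at g2
          convert g2 using 3 with a
          rw [Bool.eq_iff_iff]
          simp only [Bool.and_eq_true, decide_eq_true_eq]
          exact ⟨fun h => ⟨h, h.trans hv⟩, fun h => h.1⟩
        · rw [List.countP_filter] at g3
          convert g3 using 3 with a
          rw [Bool.eq_iff_iff]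
          simp only [Bool.and_eq_true, decide_eq_true_eq]
          exact ⟨fun h => ⟨h, h.trans_lt hv⟩, fun h => h.1⟩
      · refine ⟨hpl, ?_, ?_⟩ <;> dsimp only <;> omega
      · have hlen : (l.filter fun a => decide (p < a)).length =
          l.countP fun a => decide (p < a) := List.countP_eq_length_filter.symm
        have h := ih (l.filter fun a => decide (p < a))
          (r - (l.countP (fun a => decide (a < p)) + l.countP (fun a => decide (a = p))))
          (by omega) (by omega)
        set v := (selectAux d (l.filter fun a => decide (p < a))
          (r - (l.countP (fun a => decide (a < p)) + l.countP (fun a => decide (a = p))))).val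
        obtain ⟨g1, g2, g3⟩ := h
        rw [List.mem_filter] at g1
        have hv : p < v := by simpa using g1.2
        rw [List.countP_filter] at g2 g3
        have k : ∀ q : α → Bool, (∀ a, a ≤ p → q a = true) → l.countP q =
            l.countP (fun a => decide (a ≤ p)) + l.countP (fun a => q a && decide (p < a)) := by
          exact fun q hq => countP_eq_add_of_le l p hq
        refine ⟨g1.1, ?_, ?_⟩
        · rw [k _ (fun a ha => by simpa using ha.trans_lt hv)]
          omega
        · rw [k _ (fun a ha => by simpa using ha.trans hv.le)]
          omega

/-- About half of the `n / 5` group medians lie on either side of their median, and each brings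
three entries of its group along, so either part has at most about `7 n / 10` entries. Since `1/5 +
7/10 < 1`, the two recursive calls leave about `1000 n` steps for the linear work of about `52 n`;
rounding is harmless because lists up to length 100 are sorted directly. -/
lemma selectAux_steps (d : ℕ) (l : List α) (r : ℕ) (hd : l.length < d) :
    (selectAux d l r).steps ≤ 10000 * l.length + 3 := by
  induction d generalizing l r with
  | zero => omega
  | succ d ih =>
    by_cases hl : l.length ≤ 100
    · rw [selectAux, if_pos hl]
      refine (rankBySort_steps l r).trans ?_
      have : Nat.clog 2 l.length ≤ 7 :=
        (Nat.clog_mono_right 2 hl).trans (Nat.clog_le_of_le_pow (by norm_num))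
      have := Nat.mul_le_mul_left (10 * l.length) this
      omega
    · obtain ⟨c, hc', hc⟩ := selectAux_succ (d := d) (r := r) hl
      rw [hc]
      dsimp only
      have hfl := fives_length l
      have hgl : (groupMedians l).length = (l.length + 4) / 5 := by
        rw [groupMedians, List.length_map, fives_length]
      have hp := selectAux_val d (groupMedians l) ((groupMedians l).length / 2)
        (by omega) (by omega)
      have hps := ih (groupMedians l) ((groupMedians l).length / 2) (by omega)
      set p := (selectAux d (groupMedians l) ((groupMedians l).length / 2)).val
      obtain ⟨p1, p2, p3⟩ := hp
      have m1 := medians_le l p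
      have m2 := medians_ge l p
      have m3 := countP_lt_add_countP_le (groupMedians l) p
      have e2 := countP_le_add_countP_lt l p
      have e3 := countP_lt_add_countP_le l p
      simp only [← List.countP_eq_length_filter]
      split_ifs with h1 h2
      · have hlen : (l.filter fun a => decide (a < p)).length =
          l.countP fun a => decide (a < p) := List.countP_eq_length_filter.symm
        have h := ih (l.filter fun a => decide (a < p)) r (by omega)
        omega
      · dsimp only
        omega
      · have hlen : (l.filter fun a => decide (p < a)).length =
          l.countP fun a => decide (p < a) := List.countP_eq_length_filter.symm
        have h := ih (l.filter fun a => decide (p < a))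
          (r - (l.countP (fun a => decide (a < p)) + l.countP (fun a => decide (a = p))))
          (by omega)
        omega

end Select

lemma medianT_steps (l : List ℝ) : (medianT l).steps ≤ 10001 * l.length + 5 := by
  have := selectAux_steps (l.length + 1) l (l.length / 2) (by omega)
  simp [medianT]
  omega

/-- If more than half of the entries lie within `δ` of `c`, then so does the median. -/
lemma abs_medianT_sub_le (l : List ℝ) (c δ : ℝ)
    (h : l.length < 2 * l.countP fun a => decide (|a - c| ≤ δ)) :
    |(medianT l).val - c| ≤ δ := by
  have hle := List.countP_le_length (p := fun a => decide (|a - c| ≤ δ)) (l := l)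
  obtain ⟨-, h2, h3⟩ := selectAux_val (l.length + 1) l (l.length / 2) (by omega) (by omega)
  have hv : (medianT l).val = (selectAux (l.length + 1) l (l.length / 2)).val := rfl
  rw [← hv] at h2 h3
  set v := (medianT l).val
  have e1 := countP_le_add_countP_lt l v
  have e2 := countP_lt_add_countP_le l v
  rw [abs_le]
  constructor
  -- Otherwise all close entries, a majority, would lie strictly on one side of the median,
  -- contradicting its rank.
  · by_contra hlt
    have : l.countP (fun a => decide (|a - c| ≤ δ)) ≤ l.countP fun a => decide (v < a) :=
      List.countP_mono_left fun a _ ha => by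
        simp only [decide_eq_true_eq, abs_le] at ha ⊢
        linarith [ha.1]
    omega
  · by_contra hlt
    have : l.countP (fun a => decide (|a - c| ≤ δ)) ≤ l.countP fun a => decide (a < v) :=
      List.countP_mono_left fun a _ ha => by
        simp only [decide_eq_true_eq, abs_le] at ha ⊢
        linarith [ha.2]
    omega

/-! ## Estimation of one coefficient -/

/-- The number of rows, counted with multiplicity. -/
def rowWeight (rows : List (ℕ × ℕ)) : ℕ := (rows.map Prod.snd).sum

open Classical in
/-- The number of rows with a given property of the modulus, counted with multiplicity. -/
def goodWeight (rows : List (ℕ × ℕ)) (p : ℕ → Prop) : ℕ :=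
  (rows.map fun r => if p r.1 then r.2 else 0).sum

lemma length_le_rowWeight {rows : List (ℕ × ℕ)} (h : ∀ r ∈ rows, 1 ≤ r.2) :
    rows.length ≤ rowWeight rows := by
  have := List.card_nsmul_le_sum (rows.map Prod.snd) 1 (by
    intro x hx
    obtain ⟨r, hr, rfl⟩ := List.mem_map.1 hx
    exact h r hr)
  simpa [rowWeight] using this

lemma sum_map_le {α : Type} (l : List α) (f : α → ℕ) (B : ℕ) (h : ∀ a ∈ l, f a ≤ B) :
    (l.map f).sum ≤ l.length * B := by
  have := List.sum_le_card_nsmul (l.map f) B (by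
    intro x hx
    obtain ⟨r, hr, rfl⟩ := List.mem_map.1 hx
    exact h r hr)
  simpa using this

lemma entriesT_val (rows : List (ℕ × ℕ)) (t : List ℕ) (G : ℕ → ℕ → ℂ) (ω : ℤ) :
    (entriesT rows t G ω).val = (rows.map fun r => (List.replicate r.2
      ((1 :: t).map fun a => G (a * r.1) (ω % ((a * r.1 : ℕ) : ℤ)).toNat)).flatten).flatten := by
  simp only [entriesT, bind_val, mapT_val, flattenT_val, pure_val]

lemma entriesT_length (rows : List (ℕ × ℕ)) (t : List ℕ) (G : ℕ → ℕ → ℂ) (ω : ℤ) :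
    (entriesT rows t G ω).val.length = rowWeight rows * (t.length + 1) := by
  rw [entriesT_val, rowWeight, List.length_flatten, List.map_map]
  induction rows with
  | nil => simp
  | cons r rows ih =>
    rw [List.map_cons, List.sum_cons, ih]
    simp [add_mul]

lemma sum_map_le_of_le_add_mul (rows : List (ℕ × ℕ)) (f : ℕ × ℕ → ℕ) (c d : ℕ)
    (h : ∀ r ∈ rows, f r ≤ c + r.2 * d) :
    (rows.map f).sum ≤ rows.length * c + rowWeight rows * d := by
  rw [rowWeight]
  induction rows with
  | nil => simp
  | cons r rows ih =>
    have h1 := ih fun r hr => h r (List.mem_cons_of_mem _ hr)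
    have h2 := h r List.mem_cons_self
    simp only [List.map_cons, List.sum_cons, List.length_cons]
    nlinarith

lemma entriesT_steps (rows : List (ℕ × ℕ)) (t : List ℕ) (G : ℕ → ℕ → ℂ) (ω : ℤ)
    (h : ∀ r ∈ rows, 1 ≤ r.2) :
    (entriesT rows t G ω).steps ≤ 12 * (rowWeight rows * (t.length + 1)) := by
  have hv := entriesT_length rows t G ω
  simp only [entriesT, bind_val, flattenT_val] at hv
  simp only [entriesT, bind_steps, flattenT_steps, hv]
  rw [mapT_steps, mapT_val, List.length_map]
  have h1 := fun f => sum_map_le_of_le_add_mul rows f (2 + (t.length + 1) * 6) (t.length + 2)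
  refine (add_le_add_left (h1 _ ?_) _).trans ?_
  · intro r _
    have e : (mapT (fun b : ℕ => do
        tick 4
        pure (G (b * r.1) (ω % ((b * r.1 : ℕ) : ℤ)).toNat)) (1 :: t)).steps
        ≤ (t.length + 1) * 6 := mapT_steps_le _ _ 4 fun a _ => le_rfl
    simp only [bind_steps, flattenT_steps, mapT_val, List.length_flatten, List.map_replicate,
      List.sum_replicate, List.length_map, List.length_cons, List.length_replicate, smul_eq_mul]
    nlinarith
  · have h2 := length_le_rowWeight h
    nlinarith

lemma estimateT_steps (rows : List (ℕ × ℕ)) (t : List ℕ) (G : ℕ → ℕ → ℂ) (ω : ℤ)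
    (h : ∀ r ∈ rows, 1 ≤ r.2) (hW : 1 ≤ rowWeight rows) :
    (estimateT rows t G ω).steps ≤ 20030 * (rowWeight rows * (t.length + 1)) := by
  have h1 := entriesT_steps rows t G ω h
  have h2 := entriesT_length rows t G ω
  have h3 := medianT_steps ((entriesT rows t G ω).val.map Complex.re)
  have h4 := medianT_steps ((entriesT rows t G ω).val.map Complex.im)
  rw [List.length_map, h2] at h3 h4
  simp only [estimateT, bind_steps, tick_steps, pure_steps, h2]
  have : 1 ≤ rowWeight rows * (t.length + 1) := Nat.mul_pos hW (by omega)
  omega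

@[simp] lemma estimateT_fst (rows : List (ℕ × ℕ)) (t : List ℕ) (G : ℕ → ℕ → ℂ) (ω : ℤ) :
    (estimateT rows t G ω).val.1 = ω := rfl

/-- Each row contributes the same number `t.length + 1` of entries per unit of multiplicity, so a
majority of good rows is a majority of good entries. -/
lemma goodWeight_mul_le_countP (rows : List (ℕ × ℕ)) (t : List ℕ) (G : ℕ → ℕ → ℂ) (ω : ℤ)
    (p : ℕ → Prop) (q : ℂ → Bool)
    (h : ∀ r ∈ rows, p r.1 → ∀ a ∈ 1 :: t,
      q (G (a * r.1) (ω % ((a * r.1 : ℕ) : ℤ)).toNat) = true) :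
    goodWeight rows p * (t.length + 1) ≤ (entriesT rows t G ω).val.countP q := by
  classical
  rw [entriesT_val, List.countP_flatten, List.map_map, goodWeight]
  induction rows with
  | nil => simp
  | cons r rows ih =>
    have ih := ih fun r hr => h r (List.mem_cons_of_mem _ hr)
    rw [List.map_cons, List.sum_cons, List.map_cons, List.sum_cons, add_mul]
    refine add_le_add ?_ ih
    split_ifs with hp
    · rw [Function.comp_apply, List.countP_flatten, List.map_replicate, List.sum_replicate,
        smul_eq_mul]
      refine Nat.mul_le_mul_left _ ?_
      rw [List.countP_eq_length.2]
      · simp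
      · intro z hz
        obtain ⟨a, ha, rfl⟩ := List.mem_map.1 hz
        exact h r List.mem_cons_self hp a ha
    · simp

/-- Both coordinates of a majority of entries are within `δ` of those of `z`, so both medians are as
well; adding the two coordinate errors gives `2 δ`. -/
lemma estimateT_near (rows : List (ℕ × ℕ)) (t : List ℕ) (G : ℕ → ℕ → ℂ) (ω : ℤ)
    (p : ℕ → Prop) (z : ℂ) (δ : ℝ)
    (h : ∀ r ∈ rows, p r.1 → ∀ a ∈ 1 :: t,
      ‖G (a * r.1) (ω % ((a * r.1 : ℕ) : ℤ)).toNat - z‖ ≤ δ)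
    (hW : rowWeight rows < 2 * goodWeight rows p) :
    ‖(estimateT rows t G ω).val.2 - z‖ ≤ 2 * δ := by
  have hlen := entriesT_length rows t G ω
  set v := (entriesT rows t G ω).val with hv
  have hval : (estimateT rows t G ω).val.2 =
    ⟨(medianT (v.map Complex.re)).val, (medianT (v.map Complex.im)).val⟩ := rfl
  have hre : |(medianT (v.map Complex.re)).val - z.re| ≤ δ := by
    apply abs_medianT_sub_le
    have := goodWeight_mul_le_countP rows t G ω p (fun w => decide (|w.re - z.re| ≤ δ))
      (fun r hr hp a ha => decide_eq_true
        ((Complex.abs_re_le_norm (_ - z)).trans (h r hr hp a ha)))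
    rw [List.length_map, List.countP_map, hlen]
    have e := Nat.mul_lt_mul_of_pos_right hW (Nat.succ_pos t.length)
    refine e.trans_le ?_
    rw [mul_assoc]
    exact Nat.mul_le_mul_left _ this
  have him : |(medianT (v.map Complex.im)).val - z.im| ≤ δ := by
    apply abs_medianT_sub_le
    have := goodWeight_mul_le_countP rows t G ω p (fun w => decide (|w.im - z.im| ≤ δ))
      (fun r hr hp a ha => decide_eq_true
        ((Complex.abs_im_le_norm (_ - z)).trans (h r hr hp a ha)))
    rw [List.length_map, List.countP_map, hlen]
    have e := Nat.mul_lt_mul_of_pos_right hW (Nat.succ_pos t.length)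
    refine e.trans_le ?_
    rw [mul_assoc]
    exact Nat.mul_le_mul_left _ this
  rw [hval]
  refine (Complex.norm_le_abs_re_add_abs_im _).trans ?_
  simp only [Complex.sub_re, Complex.sub_im]
  linarith

/-! ## Output of the largest entries -/

lemma largestT_steps (k : ℕ) (x : List (ℤ × ℂ)) :
    (largestT k x).steps ≤ 10 * x.length * Nat.clog 2 x.length + 2 + 2 * k := by
  have := sortT_steps (fun a b : ℤ × ℂ => decide (‖b.2‖ ≤ ‖a.2‖)) x
  simp [largestT]
  omega

/-- `out` consists of the `m` largest entries of `x`. -/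
structure IsLargest (m : ℕ) (x out : List (ℤ × ℂ)) : Prop where
  subset : ∀ a ∈ out, a ∈ x
  nodup : (out.map Prod.fst).Nodup
  length_le : out.length ≤ m
  largest : ∀ a ∈ x, a ∉ out → out.length = m ∧ ∀ b ∈ out, ‖a.2‖ ≤ ‖b.2‖

lemma largestT_val (k : ℕ) (x : List (ℤ × ℂ)) (hx : (x.map Prod.fst).Nodup) :
    IsLargest (2 * k) x (largestT k x).val := by
  set y := (sortT (fun a b : ℤ × ℂ => decide (‖b.2‖ ≤ ‖a.2‖)) x).val with hy
  have hp : y.Perm x := sortT_perm _ x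
  have hs : y.Pairwise fun a b => ‖b.2‖ ≤ ‖a.2‖ := by
    have := sortT_pairwise (fun a b : ℤ × ℂ => decide (‖b.2‖ ≤ ‖a.2‖))
      (fun a b c h1 h2 => by
        simp only [decide_eq_true_eq] at *
        exact h2.trans h1)
      (fun a b => by simpa using le_total ‖b.2‖ ‖a.2‖) x
    simpa using this
  have hv : (largestT k x).val = y.take (2 * k) := rfl
  rw [hv]
  refine ⟨fun a ha => hp.subset (List.mem_of_mem_take ha), ?_, by simp, ?_⟩
  · exact ((hp.map Prod.fst).nodup_iff.2 hx).sublist ((List.take_sublist _ _).map _)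
  · intro a ha hna
    have ha' : a ∈ y.take (2 * k) ++ y.drop (2 * k) := by
      rw [List.take_append_drop]
      exact hp.symm.subset ha
    have had : a ∈ y.drop (2 * k) := (List.mem_append.1 ha').resolve_left hna
    constructor
    · have := List.length_pos_of_mem had
      rw [List.length_drop] at this
      rw [List.length_take]
      omega
    · intro b hb
      rw [← List.take_append_drop (2 * k) y] at hs
      exact (List.pairwise_append.1 hs).2.2 b hb a had

lemma lookup_of_mem {out : List (ℤ × ℂ)} (h : (out.map Prod.fst).Nodup) {a : ℤ × ℂ}
    (ha : a ∈ out) : vecOf out a.1 = a.2 := by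
  suffices out.lookup a.1 = some a.2 by simp [vecOf, this]
  induction out with
  | nil => simp at ha
  | cons b out ih =>
    rw [List.map_cons, List.nodup_cons] at h
    rcases List.mem_cons.1 ha with rfl | ha
    · rw [List.lookup_cons, beq_self_eq_true]
    · have hne : a.1 ≠ b.1 := fun e => h.1 (e ▸ List.mem_map_of_mem ha)
      rw [List.lookup_cons, beq_false_of_ne hne]
      exact ih h.2 ha

lemma vecOf_of_notMem {out : List (ℤ × ℂ)} {ν : ℤ} (h : ν ∉ out.map Prod.fst) :
    vecOf out ν = 0 := by
  suffices out.lookup ν = none by simp [vecOf, this]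
  induction out with
  | nil => rfl
  | cons b out ih =>
    rw [List.map_cons, List.mem_cons, not_or] at h
    rw [List.lookup_cons, beq_false_of_ne h.1]
    exact ih h.2

/-! ## Reconstruction of frequencies -/

lemma argminT_steps (G : ℕ → ℕ → ℂ) (s t h n : ℕ) : (argminT G s t h n).steps = 16 * n + 1 := by
  induction n with
  | zero => rfl
  | succ n ih => simp [argminT, ih]; ring

lemma argminT_val (G : ℕ → ℕ → ℂ) (s t h n : ℕ) : (argminT G s t h n).val ≤ n ∧
    ∀ b ≤ n, ‖G s h - G (t * s) (h + (argminT G s t h n).val * s)‖ ≤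
      ‖G s h - G (t * s) (h + b * s)‖ := by
  induction n with
  | zero =>
    refine ⟨le_rfl, fun b hb => ?_⟩
    obtain rfl : b = 0 := by omega
    exact le_rfl
  | succ n ih =>
    obtain ⟨h1, h2⟩ := ih
    simp only [argminT, bind_val, pure_val]
    split_ifs with hlt
    · refine ⟨le_rfl, fun b hb => ?_⟩
      rcases Nat.le_succ_iff.1 hb with hb | rfl
      · exact hlt.le.trans (h2 b hb)
      · exact le_rfl
    · refine ⟨by omega, fun b hb => ?_⟩
      rcases Nat.le_succ_iff.1 hb with hb | rfl
      · exact h2 b hb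
      · exact not_lt.1 hlt

lemma residueT_steps (G : ℕ → ℕ → ℂ) (s h t : ℕ) : (residueT G s h t).steps ≤ 16 * t + 5 := by
  simp only [residueT, bind_steps, tick_steps, pure_steps, argminT_steps]
  omega

/-- Among the residues modulo `t * s` over `y` modulo `s`, the entry for `y` is the unique one
closest to the entry modulo `s`. -/
def Separates (G : ℕ → ℕ → ℂ) (s t y : ℕ) : Prop :=
  ∀ b < t, h_ne b → ‖G s (y % s) - G (t * s) (y % (t * s))‖ <
    ‖G s (y % s) - G (t * s) (y % s + b * s)‖
where h_ne (b : ℕ) : Prop := y % s + b * s ≠ y % (t * s)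

/-- The residue of `y` modulo `t * s` is one of the candidates, the one with `b = y / s % t`.
Separation makes every other candidate strictly worse, so the minimizer gives this residue, and
reducing modulo `t` finishes. -/
lemma residueT_val (G : ℕ → ℕ → ℂ) (s t y : ℕ) (ht : 0 < t) (h : Separates G s t y) :
    (residueT G s (y % s) t).val = (t, y % t) := by
  obtain ⟨h1, h2⟩ := argminT_val G s t (y % s) (t - 1)
  have hval : (residueT G s (y % s) t).val =
    (t, (y % s + (argminT G s t (y % s) (t - 1)).val * s) % t) := rfl
  set b := (argminT G s t (y % s) (t - 1)).val
  have hy : y % (t * s) = y % s + (y / s % t) * s := by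
    rw [mul_comm t s, Nat.mod_mul, mul_comm s]
  have hb : y % s + b * s = y % (t * s) := by
    by_contra hne
    have h3 := h b (by omega) hne
    have h4 := h2 (y / s % t) (by have := Nat.mod_lt (y / s) ht; omega)
    rw [← hy] at h4
    exact absurd h3 (not_lt.2 h4)
  rw [hval, hb, Nat.mod_mod_of_dvd _ (dvd_mul_right t s)]

lemma crtSearchT_steps (x Q a t n : ℕ) : (crtSearchT x Q a t n).steps = 6 * n := by
  induction n with
  | zero => rfl
  | succ n ih => simp [crtSearchT, ih]; ring

lemma crtSearchT_val (x Q a t n : ℕ) (h : ∃ c < n, (x + c * Q) % t = a % t) :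
    ∃ c < n, (crtSearchT x Q a t n).val = x + c * Q ∧ (x + c * Q) % t = a % t := by
  induction n with
  | zero => obtain ⟨c, hc, -⟩ := h; omega
  | succ n ih =>
    simp only [crtSearchT, bind_val, pure_val]
    split_ifs with h1
    · exact ⟨n, by omega, rfl, h1⟩
    · obtain ⟨c, hc, e⟩ := h
      have hcn : c ≠ n := by rintro rfl; exact h1 e
      obtain ⟨c', hc', e1, e2⟩ := ih ⟨c, by omega, e⟩
      exact ⟨c', by omega, e1, e2⟩

/-- The invariant is that the running value is the remainder of `y` modulo the product of the moduli
treated so far. `c = y / Q % a` is a solution of the search, and coprimality forces every solution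
with `c < a` to give the same number. -/
lemma crtT_val (y : ℕ) (t : List ℕ) (Q : ℕ) (hQ : 0 < Q) (ht : ∀ a ∈ t, 0 < a)
    (hQt : ∀ a ∈ t, Nat.Coprime Q a) (hc : t.Pairwise Nat.Coprime) :
    (crtT (y % Q) Q (t.map fun a => (a, y % a))).val = (y % (Q * t.prod), Q * t.prod) := by
  induction t generalizing Q with
  | nil => simp [crtT]
  | cons a t ih =>
    rw [List.pairwise_cons] at hc
    have ha := ht a List.mem_cons_self
    have hy : y % (Q * a) = y % Q + (y / Q % a) * Q := by rw [Nat.mod_mul, mul_comm Q (_ % _)]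
    obtain ⟨c, hca, h1, h2⟩ := crtSearchT_val (y % Q) Q (y % a) a a
      ⟨y / Q % a, Nat.mod_lt _ ha, by
        rw [← hy, Nat.mod_mod, Nat.mod_mod_of_dvd _ (dvd_mul_left a Q)]⟩
    have h3 : y % Q + c * Q = y % (Q * a) := by
      have hlt : y % Q + c * Q < Q * a := by
        have := Nat.mod_lt y hQ
        nlinarith
      rw [← Nat.mod_eq_of_lt hlt]
      change _ ≡ _ [MOD _]
      rw [← Nat.modEq_and_modEq_iff_modEq_mul (hQt a List.mem_cons_self)]
      constructor
      · change _ % _ = _ % _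
        simp
      · change _ % _ = _ % _
        rw [h2, Nat.mod_mod]
    simp only [List.map_cons, crtT, bind_val]
    rw [h1, h3, ih (Q * a) (Nat.mul_pos hQ ha) (fun b hb => ht b (List.mem_cons_of_mem _ hb))
      (fun b hb => Nat.Coprime.mul_left (hQt b (List.mem_cons_of_mem _ hb)) (hc.1 b hb)) hc.2,
      List.prod_cons, mul_assoc]

lemma crtT_steps (x Q : ℕ) (l : List (ℕ × ℕ)) :
    (crtT x Q l).steps = (l.map fun a => 2 + 6 * a.1).sum := by
  induction l generalizing x Q with
  | nil => rfl
  | cons a l ih =>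
    obtain ⟨a, b⟩ := a
    simp [crtT, ih, crtSearchT_steps]
    ring

lemma length_le_sum {t : List ℕ} (ht : ∀ a ∈ t, 0 < a) : t.length ≤ t.sum := by
  have := List.card_nsmul_le_sum t 1 ht
  simpa using this

lemma recoverT_steps (N : ℕ) (t : List ℕ) (G : ℕ → ℕ → ℂ) (s h : ℕ) (ht : ∀ a ∈ t, 0 < a) :
    (recoverT N t G s h).steps ≤ 31 * (t.sum + 1) := by
  have h1 : (mapT (residueT G s h) t).steps + (crtT h s (mapT (residueT G s h) t).val).steps ≤
      22 * t.sum + 9 * t.length := by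
    rw [mapT_steps, crtT_steps, mapT_val, List.map_map]
    clear ht
    induction t with
    | nil => simp
    | cons a t ih =>
      have e := residueT_steps G s h a
      have e2 : (residueT G s h a).val.1 = a := rfl
      simp only [List.map_cons, List.sum_cons, List.length_cons, Function.comp_apply, e2] at ih ⊢
      omega
  have := length_le_sum ht
  simp only [recoverT, bind_steps, tick_steps, pure_steps]
  omega

/-- Remaindering yields `y`, the residue of `ω` modulo `Q = s * t.prod ≥ N`. If `ω ≥ 0` then `y =
ω`, so `2 * y ≤ N`; if `ω < 0` then `y = ω + Q`, and the lower end of the band gives `2 * y > N`.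
The final comparison in the program thus restores the sign. -/
lemma recoverT_val (N : ℕ) (t : List ℕ) (G : ℕ → ℕ → ℂ) (s : ℕ) (ω : ℤ) (hs : 0 < s)
    (hω : ω ∈ freqRange N) (hN : N ≤ t.prod * s) (ht : ∀ a ∈ t, 0 < a)
    (hst : ∀ a ∈ t, Nat.Coprime s a) (hc : t.Pairwise Nat.Coprime)
    (hsep : ∀ a ∈ t, Separates G s a (ω % ((s * t.prod : ℕ) : ℤ)).toNat) :
    (recoverT N t G s (ω % (s : ℤ)).toNat).val = ω := by
  have htp : 0 < t.prod := List.prod_pos ht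
  have hQ : 0 < s * t.prod := Nat.mul_pos hs htp
  set y := (ω % ((s * t.prod : ℕ) : ℤ)).toNat with hy
  have hyz : (y : ℤ) = ω % ((s * t.prod : ℕ) : ℤ) :=
    Int.toNat_of_nonneg (Int.emod_nonneg _ (by exact_mod_cast hQ.ne'))
  have hh : (ω % (s : ℤ)).toNat = y % s := by
    have : ((y % s : ℕ) : ℤ) = ω % (s : ℤ) := by
      push_cast
      rw [hyz, Int.emod_emod_of_dvd]
      exact_mod_cast dvd_mul_right s t.prod
    omega
  rw [hh]
  have hm : (mapT (residueT G s (y % s)) t).val = t.map fun a => (a, y % a) := by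
    rw [mapT_val]
    exact List.map_congr_left fun a ha => residueT_val G s a y (ht a ha) (hsep a ha)
  simp only [recoverT, bind_val, pure_val, hm]
  rw [crtT_val y t s hs ht hst hc]
  have hyl : y < s * t.prod := by
    have := Int.emod_lt_of_pos ω (b := ((s * t.prod : ℕ) : ℤ)) (by exact_mod_cast hQ)
    omega
  rw [Nat.mod_eq_of_lt hyl]
  dsimp only
  rw [freqRange, Finset.mem_Ioc] at hω
  rw [mul_comm] at hN
  generalize s * t.prod = Q at *
  by_cases h0 : 0 ≤ ω
  · have : ω % (Q : ℤ) = ω := Int.emod_eq_of_lt h0 (by omega)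
    rw [if_pos (by omega)]
    omega
  · have : ω % (Q : ℤ) = ω + Q := by
      rw [← Int.add_emod_right, Int.emod_eq_of_lt (by omega) (by omega)]
    rw [if_neg (by omega)]
    omega

/-! ## Tallies -/

/-- Total multiplicity of the frequency `ω`. -/
def mass (l : List (ℤ × ℕ)) (ω : ℤ) : ℕ := (l.map fun a => if a.1 = ω then a.2 else 0).sum

lemma mass_cons (a : ℤ × ℕ) (l : List (ℤ × ℕ)) (ω : ℤ) :
    mass (a :: l) ω = (if a.1 = ω then a.2 else 0) + mass l ω := by
  simp [mass]

lemma mass_perm {l m : List (ℤ × ℕ)} (h : l.Perm m) (ω : ℤ) : mass l ω = mass m ω :=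
  (h.map _).sum_eq

lemma mass_eq_zero {l : List (ℤ × ℕ)} {ω : ℤ} (h : ω ∉ l.map Prod.fst) : mass l ω = 0 := by
  rw [mass, List.sum_eq_zero_iff]
  intro x hx
  obtain ⟨a, ha, rfl⟩ := List.mem_map.1 hx
  rw [if_neg]
  rintro rfl
  exact h (List.mem_map_of_mem ha)

lemma mass_of_mem {l : List (ℤ × ℕ)} (h : (l.map Prod.fst).Nodup) {a : ℤ × ℕ} (ha : a ∈ l) :
    mass l a.1 = a.2 := by
  induction l with
  | nil => simp at ha
  | cons b l ih =>
    rw [List.map_cons, List.nodup_cons] at h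
    rw [mass_cons]
    rcases List.mem_cons.1 ha with rfl | ha
    · simp [mass_eq_zero h.1]
    · have hne : b.1 ≠ a.1 := fun e => h.1 (e ▸ List.mem_map_of_mem ha)
      rw [if_neg hne, ih h.2 ha, zero_add]

/-- One step of the tally. -/
def tallyCons (a : ℤ × ℕ) : List (ℤ × ℕ) → List (ℤ × ℕ)
  | [] => [a]
  | b :: r => if a.1 = b.1 then (a.1, a.2 + b.2) :: r else a :: b :: r

lemma tallyT_cons_val (a : ℤ × ℕ) (l : List (ℤ × ℕ)) :
    (tallyT (a :: l)).val = tallyCons a (tallyT l).val := by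
  obtain ⟨ω, w⟩ := a
  simp only [tallyT, bind_val, pure_val]
  cases (tallyT l).val <;> rfl

lemma tallyT_steps (l : List (ℤ × ℕ)) : (tallyT l).steps = 4 * l.length := by
  induction l with
  | nil => rfl
  | cons a l ih =>
    obtain ⟨ω, w⟩ := a
    simp [tallyT, ih]
    ring

lemma mass_tallyT (l : List (ℤ × ℕ)) (ω : ℤ) : mass (tallyT l).val ω = mass l ω := by
  induction l with
  | nil => rfl
  | cons a l ih =>
    rw [tallyT_cons_val, mass_cons, ← ih]
    cases (tallyT l).val with
    | nil => simp [tallyCons, mass]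
    | cons b r =>
      rw [tallyCons]
      split_ifs with h1 h2
      · rw [mass_cons, mass_cons, if_pos h2, if_pos (h1 ▸ h2)]
        ring
      · rw [mass_cons, mass_cons, if_neg h2, if_neg (h1 ▸ h2)]
        ring
      · rw [mass_cons]
        simp_all
      · rw [mass_cons]
        simp_all

lemma weight_tallyT (l : List (ℤ × ℕ)) :
    ((tallyT l).val.map Prod.snd).sum = (l.map Prod.snd).sum := by
  induction l with
  | nil => rfl
  | cons a l ih =>
    rw [tallyT_cons_val, List.map_cons, List.sum_cons, ← ih]
    cases (tallyT l).val with
    | nil => simp [tallyCons]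
    | cons b r =>
      rw [tallyCons]
      split_ifs with h1
      · simp [add_assoc]
      · simp

lemma length_tallyT (l : List (ℤ × ℕ)) : (tallyT l).val.length ≤ l.length := by
  induction l with
  | nil => exact le_rfl
  | cons a l ih =>
    rw [tallyT_cons_val, List.length_cons]
    revert ih
    cases (tallyT l).val with
    | nil => simp [tallyCons]
    | cons b r =>
      intro ih
      rw [tallyCons]
      split_ifs <;> (simp only [List.length_cons] at ih ⊢; omega)

lemma tallyT_keys_subset (l : List (ℤ × ℕ)) : ∀ b ∈ (tallyT l).val, b.1 ∈ l.map Prod.fst := by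
  induction l with
  | nil => simp [tallyT]
  | cons a l ih =>
    rw [tallyT_cons_val]
    revert ih
    cases (tallyT l).val with
    | nil => simp [tallyCons]
    | cons b r =>
      intro ih c hc
      rw [tallyCons] at hc
      split_ifs at hc with h
      · rcases List.mem_cons.1 hc with rfl | hc
        · simp
        · exact List.mem_cons_of_mem _ (ih c (List.mem_cons_of_mem _ hc))
      · rcases List.mem_cons.1 hc with rfl | hc
        · simp
        · exact List.mem_cons_of_mem _ (ih c hc)

/-- Sorting makes equal frequencies adjacent, so merging neighbours removes all repetitions. -/
lemma tallyT_pairwise (l : List (ℤ × ℕ)) (h : l.Pairwise fun a b => a.1 ≤ b.1) :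
    (tallyT l).val.Pairwise fun a b => a.1 < b.1 := by
  induction l with
  | nil => simp [tallyT]
  | cons a l ih =>
    rw [List.pairwise_cons] at h
    have ih := ih h.2
    have hk := tallyT_keys_subset l
    rw [tallyT_cons_val]
    revert ih hk
    cases (tallyT l).val with
    | nil => simp [tallyCons]
    | cons b r =>
      intro ih hk
      rw [List.pairwise_cons] at ih
      have hle : ∀ c ∈ b :: r, a.1 ≤ c.1 := by
        intro c hc
        obtain ⟨d, hd, e⟩ := List.mem_map.1 (hk c hc)
        exact e ▸ h.1 d hd
      rw [tallyCons]
      split_ifs with h1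
      · rw [List.pairwise_cons]
        exact ⟨fun c hc => h1 ▸ ih.1 c hc, ih.2⟩
      · rw [List.pairwise_cons, List.pairwise_cons]
        refine ⟨fun c hc => ?_, ih⟩
        have hb : a.1 < b.1 := lt_of_le_of_ne (hle b List.mem_cons_self) h1
        rcases List.mem_cons.1 hc with rfl | hc
        · exact hb
        · exact hb.trans (ih.1 c hc)

/-! ## The identified frequencies -/

lemma identifyT_val (N : ℕ) (rows : List (ℕ × ℕ)) (t : List ℕ) (G : ℕ → ℕ → ℂ) :
    (identifyT N rows t G).val = (rows.map fun r => (List.range r.1).map fun h =>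
      ((recoverT N t G r.1 h).val, r.2)).flatten := by
  simp only [identifyT, bind_val, mapT_val, flattenT_val, pure_val]

lemma identifyT_length (N : ℕ) (rows : List (ℕ × ℕ)) (t : List ℕ) (G : ℕ → ℕ → ℂ) :
    (identifyT N rows t G).val.length = (rows.map Prod.fst).sum := by
  rw [identifyT_val, List.length_flatten, List.map_map]
  congr 1
  exact List.map_congr_left fun r _ => by simp

lemma identifyT_steps (N : ℕ) (rows : List (ℕ × ℕ)) (t : List ℕ) (G : ℕ → ℕ → ℂ)
    (ht : ∀ a ∈ t, 0 < a) (hr : ∀ r ∈ rows, 1 ≤ r.1) :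
    (identifyT N rows t G).steps ≤ 40 * ((rows.map Prod.fst).sum * (t.sum + 1)) := by
  have hv := identifyT_length N rows t G
  simp only [identifyT, bind_val, flattenT_val] at hv
  simp only [identifyT, bind_steps, flattenT_steps, hv]
  rw [mapT_steps, mapT_val, List.length_map]
  have h2 : rows.length ≤ (rows.map Prod.fst).sum := by
    have := length_le_sum (t := rows.map Prod.fst) (by
      intro x hx
      obtain ⟨r, hr', rfl⟩ := List.mem_map.1 hx
      exact hr r hr')
    simpa using this
  have h1 : ∀ r ∈ rows, 2 + (mapT (fun h : ℕ => do
      let ω ← recoverT N t G r.1 h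
      pure (ω, r.2)) (List.range r.1)).steps ≤ 2 + r.1 * (2 + 31 * (t.sum + 1)) := by
    intro r _
    have := mapT_steps_le (fun h : ℕ => do
      let ω ← recoverT N t G r.1 h
      pure (ω, r.2)) (List.range r.1) (31 * (t.sum + 1)) fun h _ => by
        simpa using recoverT_steps N t G r.1 h ht
    rw [List.length_range] at this
    omega
  have h3 := List.sum_le_sum h1
  have h4 : (rows.map fun r => 2 + r.1 * (2 + 31 * (t.sum + 1))).sum =
      rows.length * 2 + (rows.map Prod.fst).sum * (2 + 31 * (t.sum + 1)) := by
    rw [List.sum_map_add, List.sum_map_mul_right]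
    simp
  refine (add_le_add_left (h3.trans_eq h4) _).trans ?_
  generalize (rows.map Prod.fst).sum = n at *
  have h5 : n * (2 + 31 * (t.sum + 1)) = 2 * n + 31 * (n * (t.sum + 1)) := by ring
  have h6 : n ≤ n * (t.sum + 1) := Nat.le_mul_of_pos_right _ (Nat.succ_pos _)
  omega

lemma identifyT_weight (N : ℕ) (rows : List (ℕ × ℕ)) (t : List ℕ) (G : ℕ → ℕ → ℂ) (m : ℕ)
    (hm : ∀ r ∈ rows, r.1 ≤ m) :
    ((identifyT N rows t G).val.map Prod.snd).sum ≤ m * rowWeight rows := by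
  rw [identifyT_val, List.map_flatten, List.sum_flatten, List.map_map, List.map_map, rowWeight,
    ← List.sum_map_mul_left]
  refine List.sum_le_sum fun r hr => ?_
  simp only [Function.comp_apply, List.map_map]
  refine (sum_map_le _ _ r.2 fun a _ => le_rfl).trans ?_
  rw [List.length_range]
  exact Nat.mul_le_mul_right _ (hm r hr)

/-- One residue class per good row is enough; further classes reconstructing the same frequency only
add to its mass. -/
lemma goodWeight_le_mass (N : ℕ) (rows : List (ℕ × ℕ)) (t : List ℕ) (G : ℕ → ℕ → ℂ) (ω : ℤ)
    (p : ℕ → Prop)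
    (h : ∀ r ∈ rows, p r.1 → ∃ h < r.1, (recoverT N t G r.1 h).val = ω) :
    goodWeight rows p ≤ mass (identifyT N rows t G).val ω := by
  classical
  rw [identifyT_val, mass, List.map_flatten, List.sum_flatten, List.map_map, List.map_map,
    goodWeight]
  refine List.sum_le_sum fun r hr => ?_
  split_ifs with hp
  · obtain ⟨b, hb, e⟩ := h r hr hp
    simp only [Function.comp_apply, List.map_map]
    refine List.le_sum_of_mem ?_
    rw [List.mem_map]
    exact ⟨b, List.mem_range.2 hb, by simp [e]⟩
  · exact Nat.zero_le _

/-! ## The two algorithms, given a table that is accurate on most rows -/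

/-- `out` lists at most `2 k` frequencies of the band with approximations, up to `2 δ`, of the
entries of `x`, and misses an entry above `2 δ` only if all listed ones are nearly as large. -/
structure IsGoodOutput (N k : ℕ) (x : ℤ → ℂ) (δ : ℝ) (out : List (ℤ × ℂ)) : Prop where
  nodup : (out.map Prod.fst).Nodup
  length_le : out.length ≤ 2 * k
  mem_range : ∀ a ∈ out, a.1 ∈ freqRange N
  near : ∀ a ∈ out, ‖a.2 - x a.1‖ ≤ 2 * δ
  missed : ∀ ω ∈ freqRange N, ω ∉ out.map Prod.fst → 2 * δ < ‖x ω‖ →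
    out.length = 2 * k ∧ ∀ b ∈ out, ‖x ω‖ - 2 * δ ≤ ‖b.2‖

/-- The list of frequencies that are to be estimated. -/
def keptList (N : ℕ) (rows : List (ℕ × ℕ)) (t : List ℕ) (G : ℕ → ℕ → ℂ) : List (ℤ × ℕ) :=
  (tallyT (sortT (fun a b => decide (a.1 ≤ b.1)) (identifyT N rows t G).val).val).val.filter
    fun a => decide (a.1 ∈ freqRange N ∧ rowWeight rows < 2 * a.2)

/-- The estimates for a list of frequencies. -/
def estimates (rows : List (ℕ × ℕ)) (t : List ℕ) (G : ℕ → ℕ → ℂ) (l : List ℤ) : List (ℤ × ℂ) :=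
  l.map fun ω => (estimateT rows t G ω).val

lemma estimates_fst (rows : List (ℕ × ℕ)) (t : List ℕ) (G : ℕ → ℕ → ℂ) (l : List ℤ) :
    (estimates rows t G l).map Prod.fst = l := by
  rw [estimates, List.map_map]
  simp [Function.comp_def]

lemma approx2T_val (N k : ℕ) (rows : List (ℕ × ℕ)) (t : List ℕ) (G : ℕ → ℕ → ℂ) :
    (approx2T N k rows t G).val = (largestT k
      ((estimates rows t G ((keptList N rows t G).map Prod.fst)).filter
        fun a => decide (a.2 ≠ 0))).val := by
  simp only [approx2T, bind_val, mapT_val, filterT_val, estimates, keptList, rowWeight,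
    List.map_map, Function.comp_def]
  rfl

lemma sorted_identify (l : List (ℤ × ℕ)) :
    (sortT (fun a b : ℤ × ℕ => decide (a.1 ≤ b.1)) l).val.Pairwise fun a b => a.1 ≤ b.1 := by
  have := sortT_pairwise (fun a b : ℤ × ℕ => decide (a.1 ≤ b.1))
    (fun a b c h1 h2 => by
      simp only [decide_eq_true_eq] at *
      exact h1.trans h2)
    (fun a b => by simpa using le_total a.1 b.1) l
  simpa using this

lemma keptList_nodup (N : ℕ) (rows : List (ℕ × ℕ)) (t : List ℕ) (G : ℕ → ℕ → ℂ) :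
    ((keptList N rows t G).map Prod.fst).Nodup := by
  have h := tallyT_pairwise _ (sorted_identify (identifyT N rows t G).val)
  refine List.Nodup.sublist (List.filter_sublist.map Prod.fst) ?_
  exact (List.pairwise_map.2 h).imp fun h => h.ne

/-- Sorting and tallying preserve `mass`, and after tallying a frequency occurs once, so its single
count is the mass that the filter tests. -/
lemma mem_keptList (N : ℕ) (rows : List (ℕ × ℕ)) (t : List ℕ) (G : ℕ → ℕ → ℂ) {ω : ℤ}
    (hω : ω ∈ freqRange N) (h : rowWeight rows < 2 * mass (identifyT N rows t G).val ω) :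
    ω ∈ (keptList N rows t G).map Prod.fst := by
  set c := (tallyT (sortT (fun a b : ℤ × ℕ => decide (a.1 ≤ b.1))
    (identifyT N rows t G).val).val).val with hc
  have hm : mass c ω = mass (identifyT N rows t G).val ω := by
    rw [hc, mass_tallyT, mass_perm (sortT_perm _ _)]
  have hnd : (c.map Prod.fst).Nodup :=
    (List.pairwise_map.2 (tallyT_pairwise _ (sorted_identify _))).imp fun h => h.ne
  have hmem : ω ∈ c.map Prod.fst := by
    by_contra hn
    rw [← hm, mass_eq_zero hn] at h
    omega
  obtain ⟨a, ha, rfl⟩ := List.mem_map.1 hmem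
  refine List.mem_map_of_mem (List.mem_filter.2 ⟨ha, decide_eq_true ⟨hω, ?_⟩⟩)
  rwa [← mass_of_mem hnd ha, hm]

/-- All counts together are at most `m * rowWeight rows`, and every kept count exceeds half of
`rowWeight rows`. This bound, independent of the number of rows, keeps the estimation stage cheap.
-/
lemma keptList_length (N : ℕ) (rows : List (ℕ × ℕ)) (t : List ℕ) (G : ℕ → ℕ → ℂ) (m : ℕ)
    (hm : ∀ r ∈ rows, r.1 ≤ m) : (keptList N rows t G).length ≤ 2 * m := by
  set c := (tallyT (sortT (fun a b : ℤ × ℕ => decide (a.1 ≤ b.1))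
    (identifyT N rows t G).val).val).val with hc
  have h1 : (c.map Prod.snd).sum ≤ m * rowWeight rows := by
    rw [hc, weight_tallyT, ((sortT_perm _ _).map _).sum_eq]
    exact identifyT_weight N rows t G m hm
  have h2 : ((keptList N rows t G).map Prod.snd).sum ≤ (c.map Prod.snd).sum :=
    (List.filter_sublist.map Prod.snd).sum_le_sum fun _ _ => Nat.zero_le _
  have h3 : (keptList N rows t G).length * (rowWeight rows + 1) ≤
      2 * ((keptList N rows t G).map Prod.snd).sum := by
    have := List.card_nsmul_le_sum ((keptList N rows t G).map fun a => 2 * a.2)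
      (rowWeight rows + 1) (by
        intro x hx
        obtain ⟨a, ha, rfl⟩ := List.mem_map.1 hx
        have := (of_decide_eq_true (List.mem_filter.1 ha).2).2
        omega)
    rw [List.sum_map_mul_left] at this
    simpa using this
  by_contra hlt
  have : (2 * m + 1) * (rowWeight rows + 1) ≤
    (keptList N rows t G).length * (rowWeight rows + 1) := Nat.mul_le_mul_right _ (by omega)
  nlinarith

/-- The list `l` and the test `p` are left open to serve both algorithms. Discarding zero estimates
does no harm: an entry above `2 δ` has a nonzero estimate, since estimates are off by at most `2 δ`.
The same margin turns the ordering of the estimates into the bound for missed entries. -/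
lemma isGoodOutput_of_isLargest {N k : ℕ} {x : ℤ → ℂ} {δ : ℝ} {rows : List (ℕ × ℕ)} {t : List ℕ}
    {G : ℕ → ℕ → ℂ} {l : List ℤ} {p : ℤ × ℂ → Bool} {out : List (ℤ × ℂ)}
    (hl : ∀ ω ∈ l, ω ∈ freqRange N)
    (hest : ∀ ω ∈ freqRange N, ‖(estimateT rows t G ω).val.2 - x ω‖ ≤ 2 * δ)
    (hid : ∀ ω ∈ freqRange N, 2 * δ < ‖x ω‖ → ω ∈ l)
    (hp : ∀ a : ℤ × ℂ, a.2 ≠ 0 → p a = true)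
    (hout : IsLargest (2 * k) ((estimates rows t G l).filter p) out) :
    IsGoodOutput N k x δ out := by
  have hmem : ∀ a ∈ out, a.1 ∈ l ∧ a = (estimateT rows t G a.1).val := by
    intro a ha
    obtain ⟨ω, hω, rfl⟩ := List.mem_map.1 (List.mem_filter.1 (hout.subset a ha)).1
    exact ⟨hω, rfl⟩
  refine ⟨hout.nodup, hout.length_le, fun a ha => hl _ (hmem a ha).1, fun a ha => ?_, ?_⟩
  · rw [(hmem a ha).2]
    exact hest _ (hl _ (hmem a ha).1)
  · intro ω hω hnot hlt
    have he := hest ω hω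
    have hle : ‖x ω‖ - 2 * δ ≤ ‖(estimateT rows t G ω).val.2‖ := by
      have := norm_sub_norm_le (x ω) (estimateT rows t G ω).val.2
      rw [norm_sub_rev] at this
      linarith
    have hne : (estimateT rows t G ω).val.2 ≠ 0 := by
      intro h0
      rw [h0, norm_zero] at hle
      linarith
    obtain ⟨h1, h2⟩ := hout.largest (estimateT rows t G ω).val
      (List.mem_filter.2 ⟨List.mem_map_of_mem (hid ω hω hlt), hp _ hne⟩)
      (fun h => hnot (List.mem_map.2 ⟨_, h, rfl⟩))
    exact ⟨h1, fun b hb => hle.trans (h2 b hb)⟩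

lemma approx2T_isGoodOutput {N k : ℕ} {x : ℤ → ℂ} {δ : ℝ} {rows : List (ℕ × ℕ)} {t : List ℕ}
    {G : ℕ → ℕ → ℂ}
    (hest : ∀ ω ∈ freqRange N, ‖(estimateT rows t G ω).val.2 - x ω‖ ≤ 2 * δ)
    (hid : ∀ ω ∈ freqRange N, 2 * δ < ‖x ω‖ →
      rowWeight rows < 2 * mass (identifyT N rows t G).val ω) :
    IsGoodOutput N k x δ (approx2T N k rows t G).val := by
  rw [approx2T_val]
  refine isGoodOutput_of_isLargest (l := (keptList N rows t G).map Prod.fst) ?_ hest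
    (fun ω hω h => mem_keptList N rows t G hω (hid ω hω h)) (fun a ha => decide_eq_true ha)
    (largestT_val _ _ ?_)
  · intro ω hω
    obtain ⟨a, ha, rfl⟩ := List.mem_map.1 hω
    exact (of_decide_eq_true (List.mem_filter.1 ha).2).1
  · refine List.Nodup.sublist (List.filter_sublist.map Prod.fst) ?_
    rw [estimates_fst]
    exact keptList_nodup N rows t G

lemma approx1T_isGoodOutput {N k : ℕ} {x : ℤ → ℂ} {δ : ℝ} {rows : List (ℕ × ℕ)}
    {G : ℕ → ℕ → ℂ}
    (hest : ∀ ω ∈ freqRange N, ‖(estimateT rows [] G ω).val.2 - x ω‖ ≤ 2 * δ) :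
    IsGoodOutput N k x δ (approx1T N k rows G).val := by
  set l := (List.range N).map fun n : ℕ => 1 - (((N + 1) / 2 : ℕ) : ℤ) + (n : ℤ) with hl
  -- A filter that keeps everything brings the output into the form shared with the second
  -- algorithm.
  have hv : (approx1T N k rows G).val =
      (largestT k ((estimates rows [] G l).filter fun _ => true)).val := by
    simp only [approx1T, bind_val, mapT_val, estimates, hl, List.map_map, Function.comp_def,
      List.filter_true]
  have hmem : ∀ ω, ω ∈ l ↔ ω ∈ freqRange N := by
    intro ω
    rw [hl, List.mem_map, freqRange, Finset.mem_Ioc]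
    constructor
    · rintro ⟨n, hn, rfl⟩
      rw [List.mem_range] at hn
      omega
    · intro h
      exact ⟨(ω - 1 + (((N + 1) / 2 : ℕ) : ℤ)).toNat, List.mem_range.2 (by omega), by omega⟩
  rw [hv]
  refine isGoodOutput_of_isLargest (l := l) (fun ω => (hmem ω).1) hest
    (fun ω hω _ => (hmem ω).2 hω) (fun a _ => rfl) (largestT_val _ _ ?_)
  rw [List.filter_true, estimates_fst]
  refine List.Nodup.map (fun a b h => ?_) List.nodup_range
  simpa using h

/-! ## Step counts of the two algorithms -/

lemma approx1T_steps (N k : ℕ) (rows : List (ℕ × ℕ)) (G : ℕ → ℕ → ℂ)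
    (h : ∀ r ∈ rows, 1 ≤ r.2) (hW : 1 ≤ rowWeight rows) :
    (approx1T N k rows G).steps ≤
      20035 * (N * rowWeight rows) + 10 * N * Nat.clog 2 N + 2 + 2 * k := by
  have h1 := mapT_steps_le (fun n : ℕ => do
    tick 3
    estimateT rows [] G (1 - (((N + 1) / 2 : ℕ) : ℤ) + (n : ℤ))) (List.range N)
    (3 + 20030 * rowWeight rows) (fun n _ => by
      have := estimateT_steps rows [] G (1 - (((N + 1) / 2 : ℕ) : ℤ) + (n : ℤ)) h hW
      simp only [List.length_nil, zero_add, mul_one] at this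
      simp only [bind_steps, tick_steps]
      omega)
  rw [List.length_range] at h1
  have h2 := fun x => largestT_steps k x
  simp only [approx1T, bind_steps]
  refine (add_le_add h1 (h2 _)).trans ?_
  rw [mapT_val, List.length_map, List.length_range]
  nlinarith

/-- With `n = ∑ s_j ≤ m W`, identification costs a multiple of `n (∑ t_i + 1)` and sorting of `n log
n`. At most `2 m` frequencies survive, each estimated in `20030 W (λ + 1)` steps; this produces most
of the constant. -/
lemma approx2T_steps (N k : ℕ) (rows : List (ℕ × ℕ)) (t : List ℕ) (G : ℕ → ℕ → ℂ) (m : ℕ)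
    (ht : ∀ a ∈ t, 0 < a) (h2 : ∀ r ∈ rows, 1 ≤ r.2) (h1 : ∀ r ∈ rows, 1 ≤ r.1)
    (hm : ∀ r ∈ rows, r.1 ≤ m) (hne : rows ≠ []) :
    (approx2T N k rows t G).steps ≤
      41000 * (m * rowWeight rows * (t.sum + 1 + Nat.clog 2 (rows.length * m))) + 2 * k := by
  have hlen : 1 ≤ rows.length := List.length_pos_iff.2 hne
  have hlW := length_le_rowWeight h2
  have hW : 1 ≤ rowWeight rows := hlen.trans hlW
  have hm1 : 1 ≤ m := by
    obtain ⟨r, hr⟩ := List.exists_mem_of_ne_nil _ hne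
    exact (h1 r hr).trans (hm r hr)
  set n := (rows.map Prod.fst).sum with hn
  set W := rowWeight rows with hWdef
  set c := Nat.clog 2 (rows.length * m) with hc
  set T := t.sum with hT
  have hnle : n ≤ rows.length * m := sum_map_le rows Prod.fst m hm
  have hnW : n ≤ m * W := by
    refine hnle.trans ?_
    rw [mul_comm]
    exact Nat.mul_le_mul_left _ hlW
  have hln : rows.length ≤ n := by
    have := length_le_sum (t := rows.map Prod.fst) (by
      intro x hx
      obtain ⟨r, hr', rfl⟩ := List.mem_map.1 hx
      exact h1 r hr')
    simpa using this
  have hL : t.length ≤ T := length_le_sum ht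
  have hid := identifyT_steps N rows t G ht h1
  have hidl := identifyT_length N rows t G
  rw [← hn] at hid hidl
  rw [← hT] at hid
  have hso := sortT_steps (fun a b : ℤ × ℕ => decide (a.1 ≤ b.1)) (identifyT N rows t G).val
  have hsol := (sortT_perm (fun a b : ℤ × ℕ => decide (a.1 ≤ b.1))
    (identifyT N rows t G).val).length_eq
  rw [hidl] at hso hsol
  have hta := tallyT_steps (sortT (fun a b : ℤ × ℕ => decide (a.1 ≤ b.1))
    (identifyT N rows t G).val).val
  have htal := length_tallyT (sortT (fun a b : ℤ × ℕ => decide (a.1 ≤ b.1))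
    (identifyT N rows t G).val).val
  rw [hsol] at hta htal
  have hk := keptList_length N rows t G m hm
  have hclog : Nat.clog 2 n ≤ c := Nat.clog_mono_right 2 hnle
  have hclog2 : Nat.clog 2 (2 * m) ≤ c + 1 := by
    have : 2 * m ≤ 2 * (rows.length * m) := by nlinarith
    refine (Nat.clog_mono_right 2 this).trans ?_
    refine Nat.clog_le_of_le_pow ?_
    rw [pow_succ, mul_comm]
    exact Nat.mul_le_mul_right _ (Nat.le_pow_clog (by norm_num) _)
  have hes := mapT_steps_le (fun a : ℤ × ℕ => estimateT rows t G a.1) (keptList N rows t G)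
    (20030 * (W * (t.length + 1))) (fun a _ => estimateT_steps rows t G a.1 h2 hW)
  set x := (mapT (fun a : ℤ × ℕ => estimateT rows t G a.1) (keptList N rows t G)).val with hx
  have hxl : x.length = (keptList N rows t G).length := by simp [hx]
  have hf := filterT_steps (fun a : ℤ × ℂ => decide (a.2 ≠ 0)) x
  have hfl : (x.filter fun a : ℤ × ℂ => decide (a.2 ≠ 0)).length ≤ 2 * m :=
    (List.length_filter_le _ _).trans (hxl ▸ hk)
  have hla := largestT_steps k (x.filter fun a : ℤ × ℂ => decide (a.2 ≠ 0))
  have hla' : 10 * (x.filter fun a : ℤ × ℂ => decide (a.2 ≠ 0)).length *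
      Nat.clog 2 (x.filter fun a : ℤ × ℂ => decide (a.2 ≠ 0)).length ≤ 10 * (2 * m) * (c + 1) :=
    Nat.mul_le_mul (Nat.mul_le_mul_left _ hfl) ((Nat.clog_mono_right 2 hfl).trans hclog2)
  have key : (approx2T N k rows t G).steps ≤ 40 * (n * (T + 1)) + (10 * n * Nat.clog 2 n + 2) +
      4 * n + n + 6 * n + (2 * m) * (2 + 20030 * (W * (T + 1))) + 6 * (2 * m) +
      (10 * (2 * m) * (c + 1) + 2 + 2 * k) := by
    have he : (keptList N rows t G).length * (2 + 20030 * (W * (t.length + 1))) ≤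
        (2 * m) * (2 + 20030 * (W * (T + 1))) :=
      Nat.mul_le_mul hk (by gcongr)
    have hexp : (approx2T N k rows t G).steps = (identifyT N rows t G).steps +
        ((sortT (fun a b : ℤ × ℕ => decide (a.1 ≤ b.1)) (identifyT N rows t G).val).steps +
        ((tallyT (sortT (fun a b : ℤ × ℕ => decide (a.1 ≤ b.1))
          (identifyT N rows t G).val).val).steps + (rows.length +
        (6 * (tallyT (sortT (fun a b : ℤ × ℕ => decide (a.1 ≤ b.1))
          (identifyT N rows t G).val).val).val.length +
        ((mapT (fun a : ℤ × ℕ => estimateT rows t G a.1) (keptList N rows t G)).steps +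
        (6 * x.length +
          (largestT k (x.filter fun a : ℤ × ℂ => decide (a.2 ≠ 0))).steps)))))) := by
      simp only [approx2T, bind_steps, filterT_steps, filterT_val, tick_steps]
      rfl
    rw [hexp]
    omega
  refine key.trans ?_
  have e1 : n * (T + 1) ≤ m * W * (T + 1) := Nat.mul_le_mul_right _ hnW
  have e2 : 10 * n * Nat.clog 2 n ≤ 10 * (m * W) * c :=
    Nat.mul_le_mul (Nat.mul_le_mul_left _ hnW) hclog
  have e3 : m ≤ m * W := Nat.le_mul_of_pos_right _ hW
  have e4 : m * W ≤ m * W * (T + 1) := Nat.le_mul_of_pos_right _ (Nat.succ_pos _)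
  have e5 : m * c ≤ m * W * c := Nat.mul_le_mul_right _ e3
  have e6 : (2 * m) * (2 + 20030 * (W * (T + 1))) = 4 * m + 40060 * (m * W * (T + 1)) := by ring
  have e7 : 10 * (2 * m) * (c + 1) = 20 * (m * c) + 20 * m := by ring
  have e8 : m * W * (T + 1 + c) = m * W * (T + 1) + m * W * c := by ring
  have e9 : 10 * (m * W) * c = 10 * (m * W * c) := by ring
  rw [e6, e7, e8]
  omega

/-! ## Aliasing -/

/-- The sum of the entries at all frequencies congruent to `ω` modulo `n`. -/
def aliasSum (N : ℕ) (x : ℤ → ℂ) (n : ℕ) (ω : ℤ) : ℂ :=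
  ∑ ν ∈ (freqRange N).filter fun ν => (n : ℤ) ∣ ν - ω, x ν

/-- The mass of the frequencies other than `ω` that are congruent to `ω` modulo `n`. -/
def noise (N : ℕ) (x : ℤ → ℂ) (n : ℕ) (ω : ℤ) : ℝ :=
  ∑ ν ∈ (freqRange N).filter fun ν => (n : ℤ) ∣ ν - ω ∧ ν ≠ ω, ‖x ν‖

/-- `G` is the table of the measurements of `x` for the given moduli. -/
def IsTable (N : ℕ) (x : ℤ → ℂ) (ns : List ℕ) (G : ℕ → ℕ → ℂ) : Prop :=
  ∀ n ∈ ns, ∀ h < n, G n h = aliasSum N x n h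

lemma aliasSum_congr {N : ℕ} {x : ℤ → ℂ} {n : ℕ} {ω ω' : ℤ} (h : (n : ℤ) ∣ ω - ω') :
    aliasSum N x n ω = aliasSum N x n ω' := by
  unfold aliasSum
  congr 1
  refine Finset.filter_congr fun ν _ => ?_
  have : ν - ω' = (ν - ω) + (ω - ω') := by ring
  rw [this]
  exact (dvd_add_left h).symm

lemma IsTable.apply {N : ℕ} {x : ℤ → ℂ} {ns : List ℕ} {G : ℕ → ℕ → ℂ} (hG : IsTable N x ns G)
    {n : ℕ} (hn : n ∈ ns) (hn0 : 0 < n) (ω : ℤ) :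
    G n (ω % (n : ℤ)).toNat = aliasSum N x n ω := by
  have h0 : 0 ≤ ω % (n : ℤ) := Int.emod_nonneg _ (by exact_mod_cast hn0.ne')
  have h1 : ω % (n : ℤ) < n := Int.emod_lt_of_pos _ (by exact_mod_cast hn0)
  rw [hG n hn _ (by omega), Int.toNat_of_nonneg h0]
  exact aliasSum_congr (by
    rw [← Int.emod_emod_of_dvd ω (dvd_refl (n : ℤ)), Int.emod_emod_of_dvd ω (dvd_refl (n : ℤ))]
    exact (Int.mod_modEq ω n).symm.dvd.trans (by rw [dvd_sub_comm]) |> fun h => by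
      simpa [dvd_sub_comm] using h)

/-- A finer modulus has fewer collisions. So one small noise modulo `s_j` makes all `λ + 1` entries
of that row accurate. -/
lemma noise_le_of_dvd {N : ℕ} {x : ℤ → ℂ} {s n : ℕ} (h : s ∣ n) (ω : ℤ) :
    noise N x n ω ≤ noise N x s ω := by
  refine Finset.sum_le_sum_of_subset_of_nonneg ?_ fun _ _ _ => norm_nonneg _
  intro ν
  simp only [Finset.mem_filter]
  exact fun h' => ⟨h'.1, (Int.natCast_dvd_natCast.2 h).trans h'.2.1, h'.2.2⟩

lemma norm_aliasSum_sub_le {N : ℕ} (x : ℤ → ℂ) (n : ℕ) {ω : ℤ} (hω : ω ∈ freqRange N) :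
    ‖aliasSum N x n ω - x ω‖ ≤ noise N x n ω := by
  have : aliasSum N x n ω - x ω =
      ∑ ν ∈ (freqRange N).filter fun ν => (n : ℤ) ∣ ν - ω ∧ ν ≠ ω, x ν := by
    have he : ((freqRange N).filter fun ν => (n : ℤ) ∣ ν - ω ∧ ν ≠ ω) =
        ((freqRange N).filter fun ν => (n : ℤ) ∣ ν - ω).erase ω := by
      ext ν
      simp only [Finset.mem_filter, Finset.mem_erase]
      tauto
    rw [he, aliasSum, ← Finset.add_sum_erase _ x (Finset.mem_filter.2 ⟨hω, by simp⟩)]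
    ring
  rw [this]
  exact norm_sum_le _ _

/-- The class of `h` modulo `n` is contained in the class of `ω` modulo `s`, so the difference is
the sum over the rest of the coarse class. -/
lemma aliasSum_sub_aliasSum {N : ℕ} (x : ℤ → ℂ) {s n : ℕ} {ω h : ℤ} (hsn : (s : ℤ) ∣ n)
    (hh : (s : ℤ) ∣ h - ω) : aliasSum N x s ω - aliasSum N x n h =
      ∑ ν ∈ (freqRange N).filter fun ν => (s : ℤ) ∣ ν - ω ∧ ¬ (n : ℤ) ∣ ν - h, x ν := by
  have e : ((freqRange N).filter fun ν => (n : ℤ) ∣ ν - h) =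
      ((freqRange N).filter fun ν => (s : ℤ) ∣ ν - ω).filter fun ν => (n : ℤ) ∣ ν - h := by
    ext ν
    simp only [Finset.mem_filter]
    constructor
    · rintro ⟨h1, h2⟩
      refine ⟨⟨h1, ?_⟩, h2⟩
      have : ν - ω = (ν - h) + (h - ω) := by ring
      rw [this]
      exact dvd_add (hsn.trans h2) hh
    · exact fun h => ⟨h.1.1, h.2⟩
  have := Finset.sum_filter_add_sum_filter_not ((freqRange N).filter fun ν => (s : ℤ) ∣ ν - ω)
    (fun ν => (n : ℤ) ∣ ν - h) x
  rw [← e, Finset.filter_filter] at this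
  rw [aliasSum, aliasSum, ← this]
  ring

/-- Passing to the correct class modulo `a * s` discards only frequencies other than `ω`, hence at
most the noise. A wrong class does not contain `ω`, so the difference still contains `x ω` and has
size at least `‖x ω‖` minus the noise, which is larger by assumption. -/
lemma separates_of_noise_lt {N : ℕ} {x : ℤ → ℂ} {ns : List ℕ} {G : ℕ → ℕ → ℂ}
    (hG : IsTable N x ns G) {s a y : ℕ} {ω : ℤ} (hs : 0 < s) (ha : 0 < a)
    (hsn : s ∈ ns) (han : a * s ∈ ns) (hω : ω ∈ freqRange N)
    (hy : ((a * s : ℕ) : ℤ) ∣ (y : ℤ) - ω) (hx : 2 * noise N x s ω < ‖x ω‖) :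
    Separates G s a y := by
  have hdvd : (s : ℤ) ∣ ((a * s : ℕ) : ℤ) := by exact_mod_cast dvd_mul_left s a
  have hmod : ∀ n : ℕ, (n : ℤ) ∣ ((y % n : ℕ) : ℤ) - y := fun n => by
    push_cast
    exact (Int.mod_modEq y n).symm.dvd
  have hys : (s : ℤ) ∣ ((y % s : ℕ) : ℤ) - ω := by
    have := dvd_add (hmod s) (hdvd.trans hy)
    simpa using this
  have hyas : ((a * s : ℕ) : ℤ) ∣ ((y % (a * s) : ℕ) : ℤ) - ω := by
    have := dvd_add (hmod (a * s)) hy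
    simpa using this
  have has : 0 < a * s := Nat.mul_pos ha hs
  have g0 : G s (y % s) = aliasSum N x s ω := by
    rw [hG s hsn _ (Nat.mod_lt _ hs), aliasSum_congr hys]
  have g1 : G (a * s) (y % (a * s)) = aliasSum N x (a * s) ω := by
    rw [hG _ han _ (Nat.mod_lt _ has), aliasSum_congr hyas]
  intro b hb hne
  unfold Separates.h_ne at hne
  have hlt : y % s + b * s < a * s := by
    have := Nat.mod_lt y hs
    nlinarith
  have hbs : (s : ℤ) ∣ ((y % s + b * s : ℕ) : ℤ) - ω := by
    have := dvd_add hys (dvd_mul_left (s : ℤ) b)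
    have e : ((y % s + b * s : ℕ) : ℤ) - ω = ((y % s : ℕ) : ℤ) - ω + b * s := by
      rw [Nat.cast_add, Nat.cast_mul]
      ring
    rwa [e]
  have hnot : ¬ ((a * s : ℕ) : ℤ) ∣ ω - ((y % s + b * s : ℕ) : ℤ) := by
    intro hd
    have h2 := dvd_add hyas hd
    have h3 : ((y % s + b * s : ℕ) : ℤ) ≡ ((y % (a * s) : ℕ) : ℤ) [ZMOD ((a * s : ℕ) : ℤ)] := by
      rw [Int.modEq_iff_dvd]
      rwa [sub_add_sub_cancel] at h2
    rw [Int.natCast_modEq_iff] at h3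
    have h4 : (y % s + b * s) % (a * s) = y % (a * s) % (a * s) := h3
    rw [Nat.mod_eq_of_lt hlt, Nat.mod_mod] at h4
    exact hne h4
  rw [g0, g1, hG _ han _ hlt, aliasSum_sub_aliasSum x hdvd (by simp),
    aliasSum_sub_aliasSum x hdvd hbs]
  refine lt_of_le_of_lt (b := noise N x s ω) ?_ ?_
  · refine (norm_sum_le _ _).trans ?_
    refine Finset.sum_le_sum_of_subset_of_nonneg ?_ fun _ _ _ => norm_nonneg _
    intro ν
    simp only [Finset.mem_filter]
    rintro ⟨h1, h2, h3⟩
    exact ⟨h1, h2, fun e => h3 (by simp [e])⟩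
  · set A := (freqRange N).filter fun ν =>
      (s : ℤ) ∣ ν - ω ∧ ¬ ((a * s : ℕ) : ℤ) ∣ ν - ((y % s + b * s : ℕ) : ℤ) with hA
    have hωA : ω ∈ A := Finset.mem_filter.2 ⟨hω, by simp, hnot⟩
    rw [← Finset.add_sum_erase _ x hωA]
    have h1 : ‖∑ ν ∈ A.erase ω, x ν‖ ≤ noise N x s ω := by
      refine (norm_sum_le _ _).trans ?_
      refine Finset.sum_le_sum_of_subset_of_nonneg ?_ fun _ _ _ => norm_nonneg _
      intro ν
      simp only [hA, Finset.mem_erase, Finset.mem_filter]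
      tauto
    have h2 := norm_sub_le (x ω + ∑ ν ∈ A.erase ω, x ν) (∑ ν ∈ A.erase ω, x ν)
    rw [add_sub_cancel_right] at h2
    linarith

lemma mem_sizes {rows : List (ℕ × ℕ)} {t : List ℕ} {r : ℕ × ℕ} (hr : r ∈ rows) {a : ℕ}
    (ha : a ∈ 1 :: t) : a * r.1 ∈ sizes rows t :=
  List.mem_flatMap.2 ⟨r, hr, List.mem_map_of_mem ha⟩

/-- Most rows have little noise at each frequency. -/
def MostlyGood (N : ℕ) (rows : List (ℕ × ℕ)) (x : ℤ → ℂ) (δ : ℝ) : Prop :=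
  ∀ ω ∈ freqRange N, rowWeight rows < 2 * goodWeight rows fun s => noise N x s ω ≤ δ

lemma estimateT_near_of_mostlyGood {N : ℕ} {rows : List (ℕ × ℕ)} {t : List ℕ} {x : ℤ → ℂ} {δ : ℝ}
    {G : ℕ → ℕ → ℂ} (hG : IsTable N x (sizes rows t) G) (hr : ∀ r ∈ rows, 0 < r.1)
    (ht : ∀ a ∈ t, 0 < a) (hgood : MostlyGood N rows x δ) {ω : ℤ} (hω : ω ∈ freqRange N) :
    ‖(estimateT rows t G ω).val.2 - x ω‖ ≤ 2 * δ := by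
  refine estimateT_near rows t G ω _ (x ω) δ (fun r hrr hp a ha => ?_) (hgood ω hω)
  have ha0 : 0 < a := by
    rcases List.mem_cons.1 ha with rfl | ha
    · exact one_pos
    · exact ht a ha
  rw [hG.apply (mem_sizes hrr ha) (Nat.mul_pos ha0 (hr r hrr))]
  exact ((norm_aliasSum_sub_le x _ hω).trans (noise_le_of_dvd (dvd_mul_left _ _) ω)).trans hp

lemma approx1T_good {N k : ℕ} {rows : List (ℕ × ℕ)} {x : ℤ → ℂ} {δ : ℝ}
    {G : ℕ → ℕ → ℂ} (hG : IsTable N x (sizes rows []) G) (hr : ∀ r ∈ rows, 0 < r.1)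
    (hgood : MostlyGood N rows x δ) : IsGoodOutput N k x δ (approx1T N k rows G).val :=
  approx1T_isGoodOutput fun _ hω => estimateT_near_of_mostlyGood hG hr (by simp) hgood hω

lemma approx2T_good {N k : ℕ} {rows : List (ℕ × ℕ)} {t : List ℕ} {x : ℤ → ℂ} {δ : ℝ}
    {G : ℕ → ℕ → ℂ} (hG : IsTable N x (sizes rows t) G) (hr : ∀ r ∈ rows, 0 < r.1)
    (ht : ∀ a ∈ t, 0 < a) (hN : ∀ r ∈ rows, N ≤ t.prod * r.1)
    (hrt : ∀ r ∈ rows, ∀ a ∈ t, Nat.Coprime r.1 a) (hc : t.Pairwise Nat.Coprime)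
    (hgood : MostlyGood N rows x δ) : IsGoodOutput N k x δ (approx2T N k rows t G).val := by
  refine approx2T_isGoodOutput
    (fun _ hω => estimateT_near_of_mostlyGood hG hr ht hgood hω) fun ω hω hlt => ?_
  refine (hgood ω hω).trans_le (Nat.mul_le_mul_left 2 ?_)
  refine goodWeight_le_mass N rows t G ω _ fun r hrr hp => ?_
  have hs := hr r hrr
  have hs' : (0 : ℤ) < r.1 := by exact_mod_cast hs
  refine ⟨(ω % (r.1 : ℤ)).toNat, ?_, ?_⟩
  · have := Int.emod_lt_of_pos ω hs'
    have := Int.emod_nonneg ω hs'.ne'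
    omega
  · refine recoverT_val N t G r.1 ω hs hω (hN r hrr) ht (hrt r hrr) hc fun a ha => ?_
    have h1 : a * r.1 ∣ r.1 * t.prod := by
      rw [mul_comm]
      exact Nat.mul_dvd_mul_left _ (List.dvd_prod ha)
    have hQ : 0 < r.1 * t.prod := Nat.mul_pos hs (List.prod_pos ht)
    refine separates_of_noise_lt hG hs (ht a ha) ?_ (mem_sizes hrr (List.mem_cons_of_mem _ ha)) hω
      ?_ (by linarith)
    · simpa using mem_sizes (t := t) hrr (List.mem_cons_self (a := 1))
    · rw [Int.toNat_of_nonneg (Int.emod_nonneg _ (by exact_mod_cast hQ.ne'))]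
      exact (Int.natCast_dvd_natCast.2 h1).trans (Int.mod_modEq ω _).symm.dvd

/-! ## From a good output to the error bound -/

/-- Missed elements of `S` are paid for by listed frequencies outside `S`. If a large entry is
missed, the list is full with `2 k` frequencies, so at least twice as many are listed outside `S` as
are missed in `S`, and all of them are nearly as large. -/
lemma sum_sq_missed_le {N k : ℕ} {x : ℤ → ℂ} {δ : ℝ} {out : List (ℤ × ℂ)} (hδ : 0 ≤ δ)
    (h : IsGoodOutput N k x δ out) {S : Finset ℤ} (hS : S ⊆ freqRange N) (hSk : S.card ≤ k) :
    ∑ ν ∈ S \ (out.map Prod.fst).toFinset, ‖x ν‖ ^ 2 ≤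
      ∑ ν ∈ (out.map Prod.fst).toFinset \ S, ‖x ν‖ ^ 2 + k * (14 * δ) ^ 2 := by
  set R := (out.map Prod.fst).toFinset with hR
  have hpos : 0 ≤ ∑ ν ∈ R \ S, ‖x ν‖ ^ 2 := Finset.sum_nonneg fun _ _ => by positivity
  rcases (S \ R).eq_empty_or_nonempty with he | hne
  · rw [he, Finset.sum_empty]
    positivity
  obtain ⟨ω, hω, hmax⟩ := Finset.exists_max_image (S \ R) (fun ν => ‖x ν‖) hne
  have hsum : ∑ ν ∈ S \ R, ‖x ν‖ ^ 2 ≤ (S \ R).card * ‖x ω‖ ^ 2 := by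
    rw [← nsmul_eq_mul]
    exact Finset.sum_le_card_nsmul _ _ _ fun ν hν => by
      have := hmax ν hν
      gcongr
  -- Write `a` for the largest missed magnitude. A listed magnitude is at least `a - 4 δ`: `2 δ` are
  -- lost in comparing estimates and `2 δ` in returning to the true entry. Two such entries cover
  -- one missed one when `a ^ 2 ≤ 2 (a - 4 δ) ^ 2`, that is, for `a ≥ (8 + 4 √2) δ`; 14 is the next
  -- integer.
  by_cases ha : ‖x ω‖ ≤ 14 * δ
  · have h1 : ((S \ R).card : ℝ) ≤ k := by
      exact_mod_cast (Finset.card_le_card Finset.sdiff_subset).trans hSk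
    have h2 : ((S \ R).card : ℝ) * ‖x ω‖ ^ 2 ≤ k * (14 * δ) ^ 2 := by gcongr
    linarith
  · push Not at ha
    rw [Finset.mem_sdiff] at hω
    obtain ⟨hlen, hb⟩ := h.missed ω (hS hω.1) (fun hm => hω.2 (List.mem_toFinset.2 hm))
      (by linarith)
    have hRc : R.card = 2 * k := by
      rw [hR, List.toFinset_card_of_nodup h.nodup, List.length_map, hlen]
    have hlow : ∀ ν ∈ R \ S, (‖x ω‖ - 4 * δ) ^ 2 ≤ ‖x ν‖ ^ 2 := by
      intro ν hν
      obtain ⟨b, hbo, rfl⟩ := List.mem_map.1 (List.mem_toFinset.1 (Finset.mem_sdiff.1 hν).1)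
      have h1 := hb b hbo
      have h2 := h.near b hbo
      have h3 := norm_sub_norm_le b.2 (x b.1)
      have h4 : ‖x ω‖ - 4 * δ ≤ ‖x b.1‖ := by linarith
      have h5 : 0 ≤ ‖x ω‖ - 4 * δ := by linarith
      gcongr
    have hsum2 : (R \ S).card * (‖x ω‖ - 4 * δ) ^ 2 ≤ ∑ ν ∈ R \ S, ‖x ν‖ ^ 2 := by
      rw [← nsmul_eq_mul]
      exact Finset.card_nsmul_le_sum _ _ _ hlow
    have hcard : 2 * (S \ R).card ≤ (R \ S).card := by
      have h1 := Finset.card_sdiff_add_card_inter S R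
      have h2 := Finset.card_sdiff_add_card_inter R S
      rw [Finset.inter_comm] at h2
      omega
    have hcard' : 2 * ((S \ R).card : ℝ) ≤ (R \ S).card := by exact_mod_cast hcard
    have hq : ‖x ω‖ ^ 2 ≤ 2 * (‖x ω‖ - 4 * δ) ^ 2 := by nlinarith
    have h6 : ((S \ R).card : ℝ) * ‖x ω‖ ^ 2 ≤ (S \ R).card * (2 * (‖x ω‖ - 4 * δ) ^ 2) := by
      gcongr
    have h7 : 2 * ((S \ R).card : ℝ) * (‖x ω‖ - 4 * δ) ^ 2 ≤
        (R \ S).card * (‖x ω‖ - 4 * δ) ^ 2 := by gcongr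
    have h8 : (0 : ℝ) ≤ k * (14 * δ) ^ 2 := by positivity
    linarith

/-- The listed frequencies, at most `2 k` of them, contribute at most `8 k δ²`; exchanging the
missed part of `S` for listed frequencies costs `196 k δ²`. The total of `204 k δ²` is below `(22 δ
√k)²`. -/
lemma error_le_of_isGoodOutput {N k : ℕ} {x : ℤ → ℂ} {δ : ℝ} {out : List (ℤ × ℂ)} (hδ : 0 ≤ δ)
    (h : IsGoodOutput N k x δ out) {S : Finset ℤ} (hS : S ⊆ freqRange N) (hSk : S.card ≤ k) :
    Real.sqrt (∑ ν ∈ freqRange N, ‖x ν - vecOf out ν‖ ^ 2) ≤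
      Real.sqrt (∑ ν ∈ freqRange N \ S, ‖x ν‖ ^ 2) + 22 * δ * Real.sqrt k := by
  set R := (out.map Prod.fst).toFinset with hR
  have hRΩ : R ⊆ freqRange N := by
    intro ν hν
    obtain ⟨b, hbo, rfl⟩ := List.mem_map.1 (List.mem_toFinset.1 hν)
    exact h.mem_range b hbo
  have e1 : ∑ ν ∈ freqRange N \ R, ‖x ν - vecOf out ν‖ ^ 2 = ∑ ν ∈ freqRange N \ R, ‖x ν‖ ^ 2 := by
    refine Finset.sum_congr rfl fun ν hν => ?_
    rw [vecOf_of_notMem fun hm => (Finset.mem_sdiff.1 hν).2 (List.mem_toFinset.2 hm), sub_zero]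
  have e2 : ∑ ν ∈ R, ‖x ν - vecOf out ν‖ ^ 2 ≤ k * (8 * δ ^ 2) := by
    have h1 : ∑ ν ∈ R, ‖x ν - vecOf out ν‖ ^ 2 ≤ R.card • (2 * δ) ^ 2 :=
      Finset.sum_le_card_nsmul _ _ _ fun ν hν => by
        obtain ⟨b, hbo, rfl⟩ := List.mem_map.1 (List.mem_toFinset.1 hν)
        rw [lookup_of_mem h.nodup hbo, norm_sub_rev]
        have := h.near b hbo
        gcongr
    have h2 : (R.card : ℝ) ≤ 2 * k := by
      have : R.card ≤ 2 * k :=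
        (List.toFinset_card_le _).trans (by rw [List.length_map]; exact h.length_le)
      exact_mod_cast this
    rw [nsmul_eq_mul] at h1
    have h3 : (R.card : ℝ) * (2 * δ) ^ 2 ≤ 2 * k * (2 * δ) ^ 2 := by gcongr
    linarith
  have e3 := sum_sq_missed_le hδ h hS hSk
  rw [← hR] at e3
  have e4 : ∑ ν ∈ freqRange N \ R, ‖x ν‖ ^ 2 =
      ∑ ν ∈ freqRange N \ (R ∪ S), ‖x ν‖ ^ 2 + ∑ ν ∈ S \ R, ‖x ν‖ ^ 2 := by
    rw [← Finset.sum_union]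
    · congr 1
      ext ν
      have := @hS ν
      simp only [Finset.mem_sdiff, Finset.mem_union]
      tauto
    · rw [Finset.disjoint_left]
      simp only [Finset.mem_sdiff, Finset.mem_union]
      tauto
  have e5 : ∑ ν ∈ freqRange N \ S, ‖x ν‖ ^ 2 =
      ∑ ν ∈ freqRange N \ (R ∪ S), ‖x ν‖ ^ 2 + ∑ ν ∈ R \ S, ‖x ν‖ ^ 2 := by
    rw [← Finset.sum_union]
    · congr 1
      ext ν
      have := @hRΩ ν
      simp only [Finset.mem_sdiff, Finset.mem_union]
      tauto
    · rw [Finset.disjoint_left]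
      simp only [Finset.mem_sdiff, Finset.mem_union]
      tauto
  have e6 : ∑ ν ∈ freqRange N, ‖x ν - vecOf out ν‖ ^ 2 =
      ∑ ν ∈ freqRange N \ R, ‖x ν‖ ^ 2 + ∑ ν ∈ R, ‖x ν - vecOf out ν‖ ^ 2 := by
    rw [← e1, Finset.sum_sdiff hRΩ]
  have hA : 0 ≤ ∑ ν ∈ freqRange N \ S, ‖x ν‖ ^ 2 := Finset.sum_nonneg fun _ _ => by positivity
  refine Real.sqrt_le_iff.2 ⟨by positivity, ?_⟩
  have h1 := Real.sq_sqrt hA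
  have h2 := Real.sq_sqrt (Nat.cast_nonneg (α := ℝ) k)
  have h3 : 0 ≤ Real.sqrt (∑ ν ∈ freqRange N \ S, ‖x ν‖ ^ 2) * (22 * δ * Real.sqrt k) := by
    positivity
  have h4 : (22 * δ * Real.sqrt k) ^ 2 = k * (484 * δ ^ 2) := by
    rw [mul_pow, mul_pow, h2]
    ring
  have h5 : (0 : ℝ) ≤ k * δ ^ 2 := by positivity
  nlinarith

/-! ## Collisions -/

/-- Pairwise coprime divisors of `ν - ω` have a product dividing it, and `0 < |ν - ω| ≤ N`. -/
lemma card_collisions_le {N b : ℕ} (hb : 2 ≤ b) (F : Finset ℕ) (hF : ∀ s ∈ F, b ≤ s)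
    (hc : (F : Set ℕ).Pairwise Nat.Coprime) {ω ν : ℤ} (hω : ω ∈ freqRange N)
    (hν : ν ∈ freqRange N) (hne : ν ≠ ω) :
    (F.filter fun s : ℕ => (s : ℤ) ∣ ν - ω).card ≤ Nat.log b N := by
  set B := F.filter fun s : ℕ => (s : ℤ) ∣ ν - ω with hB
  have h1 : ∏ s ∈ B, s ∣ (ν - ω).natAbs := by
    refine Finset.prod_dvd_of_isRelPrime (fun i hi j hj hij => ?_) fun s hs => ?_
    · exact Nat.coprime_iff_isRelPrime.1
        (hc (Finset.mem_filter.1 hi).1 (Finset.mem_filter.1 hj).1 hij)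
    · exact Int.natCast_dvd.1 (Finset.mem_filter.1 hs).2
  have h2 : b ^ B.card ≤ ∏ s ∈ B, s :=
    Finset.pow_card_le_prod _ _ _ fun s hs => hF s (Finset.mem_filter.1 hs).1
  have h3 : 0 < (ν - ω).natAbs := by omega
  have h4 : (ν - ω).natAbs ≤ N := by
    rw [freqRange, Finset.mem_Ioc] at hω hν
    omega
  exact Nat.le_log_of_pow_le (by omega) (h2.trans ((Nat.le_of_dvd h3 h1).trans h4))

/-- A noisy modulus either lets an element of `T` other than `ω` collide with `ω`, or collects more
than `δ` from outside `T`. Both kinds number at most `κ * Nat.log b N`: the first by counting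
collisions of single frequencies, the second by double counting. -/
lemma card_noisy_le {N b κ : ℕ} (hb : 2 ≤ b) (F : Finset ℕ) (hF : ∀ s ∈ F, b ≤ s)
    (hc : (F : Set ℕ).Pairwise Nat.Coprime) (x : ℤ → ℂ) {δ : ℝ} (hδ : 0 ≤ δ) {T : Finset ℤ}
    (hT : T ⊆ freqRange N) (hTκ : T.card ≤ κ)
    (htail : ∑ ν ∈ freqRange N \ T, ‖x ν‖ ≤ κ * δ) {ω : ℤ} (hω : ω ∈ freqRange N) :
    (F.filter fun s => ¬ noise N x s ω ≤ δ).card ≤ 2 * κ * Nat.log b N := by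
  set L := Nat.log b N with hL
  set B1 := (T.erase ω).biUnion fun ν => F.filter fun s : ℕ => (s : ℤ) ∣ ν - ω with hB1
  set tail : ℕ → ℝ := fun s =>
    ∑ ν ∈ (freqRange N \ T).filter fun ν => (s : ℤ) ∣ ν - ω ∧ ν ≠ ω, ‖x ν‖ with htl
  set B2 := F.filter fun s => δ < tail s with hB2
  have hsub : (F.filter fun s => ¬ noise N x s ω ≤ δ) ⊆ B1 ∪ B2 := by
    intro s hs
    rw [Finset.mem_filter, not_le] at hs
    by_contra hn
    rw [Finset.mem_union, not_or] at hn
    have hle : noise N x s ω ≤ tail s := by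
      refine Finset.sum_le_sum_of_subset_of_nonneg ?_ fun _ _ _ => norm_nonneg _
      intro ν hν
      simp only [Finset.mem_filter, Finset.mem_sdiff] at hν ⊢
      refine ⟨⟨hν.1, fun hνT => hn.1 ?_⟩, hν.2⟩
      exact Finset.mem_biUnion.2 ⟨ν, Finset.mem_erase.2 ⟨hν.2.2, hνT⟩,
        Finset.mem_filter.2 ⟨hs.1, hν.2.1⟩⟩
    exact hn.2 (Finset.mem_filter.2 ⟨hs.1, hs.2.trans_le hle⟩)
  have h1 : B1.card ≤ κ * L := by
    refine (Finset.card_biUnion_le_card_mul _ _ L fun ν hν => ?_).trans ?_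
    · rw [Finset.mem_erase] at hν
      exact card_collisions_le hb F hF hc hω (hT hν.2) hν.1
    · exact Nat.mul_le_mul_right _ ((Finset.card_erase_le).trans hTκ)
  -- Each frequency outside `T` is charged by at most `L` moduli, so summing the collected mass over
  -- all moduli gives at most `L` times the tail.
  have h2 : (B2.card : ℝ) * δ ≤ L * (κ * δ) := by
    calc (B2.card : ℝ) * δ = ∑ s ∈ B2, δ := by rw [Finset.sum_const, nsmul_eq_mul]
      _ ≤ ∑ s ∈ B2, tail s := Finset.sum_le_sum fun s hs => (Finset.mem_filter.1 hs).2.le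
      _ ≤ ∑ s ∈ F, tail s := Finset.sum_le_sum_of_subset_of_nonneg (Finset.filter_subset _ _)
          fun s _ _ => Finset.sum_nonneg fun _ _ => norm_nonneg _
      _ = ∑ ν ∈ freqRange N \ T, ∑ s ∈ F, if (s : ℤ) ∣ ν - ω ∧ ν ≠ ω then ‖x ν‖ else 0 := by
          rw [Finset.sum_comm]
          exact Finset.sum_congr rfl fun s _ => Finset.sum_filter _ _
      _ ≤ ∑ ν ∈ freqRange N \ T, L * ‖x ν‖ := by
          refine Finset.sum_le_sum fun ν hν => ?_
          rw [← Finset.sum_filter, Finset.sum_const, nsmul_eq_mul]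
          refine mul_le_mul_of_nonneg_right ?_ (norm_nonneg _)
          by_cases hne : ν = ω
          · simp [hne]
          · simp only [hne, ne_eq, not_false_eq_true, and_true]
            exact_mod_cast card_collisions_le hb F hF hc hω (Finset.mem_sdiff.1 hν).1 hne
      _ ≤ L * (κ * δ) := by
          rw [← Finset.mul_sum]
          gcongr
  have h3 : B2.card ≤ κ * L := by
    -- For `δ = 0` one cannot divide, but then the tail vanishes and no modulus collects anything
    -- from it.
    rcases hδ.eq_or_lt with h0 | h0
    · have hz : ∀ ν ∈ freqRange N \ T, ‖x ν‖ = 0 := by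
        rw [← h0, mul_zero] at htail
        exact (Finset.sum_eq_zero_iff_of_nonneg fun _ _ => norm_nonneg _).1
          (le_antisymm htail (Finset.sum_nonneg fun _ _ => norm_nonneg _))
      have : B2 = ∅ := by
        refine Finset.filter_eq_empty_iff.2 fun s _ => ?_
        rw [← h0, not_lt]
        exact (Finset.sum_eq_zero fun ν hν => hz ν (Finset.mem_filter.1 hν).1).le
      simp [this]
    · have : (B2.card : ℝ) ≤ κ * L := by
        by_contra hlt
        push Not at hlt
        have := mul_lt_mul_of_pos_right hlt h0
        linarith
      exact_mod_cast this
  have h4 := (Finset.card_le_card hsub).trans (Finset.card_union_le _ _)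
  have h5 : 2 * κ * L = κ * L + κ * L := by ring
  omega

/-! ## Row moduli -/

lemma IsRowModuli.ne_nil {N κ c : ℕ} {s : List ℕ} (h : IsRowModuli N κ c s) : s ≠ [] := by
  rintro rfl
  have := h.length_eq
  simp at this

lemma IsRowModuli.head_le {N κ c : ℕ} {s : List ℕ} (h : IsRowModuli N κ c s) :
    ∀ a ∈ s, s.headD 0 ≤ a := by
  intro a ha
  have hi := h.increasing
  cases s with
  | nil => simp at ha
  | cons b s =>
    rw [List.pairwise_cons] at hi
    rcases List.mem_cons.1 ha with rfl | ha
    · exact le_rfl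
    · exact (hi.1 a ha).le

lemma IsRowModuli.nodup {N κ c : ℕ} {s : List ℕ} (h : IsRowModuli N κ c s) : s.Nodup :=
  h.increasing.imp fun h => h.ne

lemma IsRowModuli.pos {N κ c : ℕ} {s : List ℕ} (h : IsRowModuli N κ c s) : ∀ a ∈ s, 0 < a :=
  fun a ha => (Nat.zero_lt_two.trans_le h.two_le).trans_le (h.head_le a ha)

lemma IsRowModuli.coprime_set {N κ c : ℕ} {s : List ℕ} (h : IsRowModuli N κ c s) :
    (s.toFinset : Set ℕ).Pairwise Nat.Coprime := by
  intro a ha b hb hab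
  have : Std.Symm Nat.Coprime := ⟨fun _ _ h => h.symm⟩
  exact h.coprime.forall (List.mem_toFinset.1 ha) (List.mem_toFinset.1 hb) hab

lemma IsRowModuli.card_noisy_le {N κ c : ℕ} {s : List ℕ} (h : IsRowModuli N κ c s)
    (x : ℤ → ℂ) {δ : ℝ} (hδ : 0 ≤ δ) {T : Finset ℤ}
    (hT : T ⊆ freqRange N) (hTκ : T.card ≤ κ)
    (htail : ∑ ν ∈ freqRange N \ T, ‖x ν‖ ≤ κ * δ) {ω : ℤ} (hω : ω ∈ freqRange N) :
    (s.toFinset.filter fun s => ¬ noise N x s ω ≤ δ).card ≤ 2 * κ * Nat.log (s.headD 0) N :=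
  SFT.card_noisy_le h.two_le _ (fun a ha => h.head_le a (List.mem_toFinset.1 ha)) h.coprime_set x
    hδ hT hTκ htail hω

/-- The factor 4 together with the extra row makes `2 κ L` noisy rows a strict minority of `4 κ L +
1`. -/
lemma detRows_mostlyGood {N κ : ℕ} {s : List ℕ} (h : IsRowModuli N κ 4 s)
    (x : ℤ → ℂ) {δ : ℝ} (hδ : 0 ≤ δ) {T : Finset ℤ}
    (hT : T ⊆ freqRange N) (hTκ : T.card ≤ κ)
    (htail : ∑ ν ∈ freqRange N \ T, ‖x ν‖ ≤ κ * δ) : MostlyGood N (detRows s) x δ := by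
  classical
  intro ω hω
  have h1 := h.card_noisy_le x hδ hT hTκ htail hω
  have h2 : rowWeight (detRows s) = s.length := by
    simp [rowWeight, detRows, Function.comp_def]
  have h3 : goodWeight (detRows s) (fun s => noise N x s ω ≤ δ) =
      (s.toFinset.filter fun s => noise N x s ω ≤ δ).card := by
    rw [goodWeight, detRows, List.map_map, Finset.card_filter, ← List.sum_toFinset _ h.nodup]
    rfl
  have h4 := Finset.card_filter_add_card_filter_not (s := s.toFinset) fun s => noise N x s ω ≤ δ
  rw [List.toFinset_card_of_nodup h.nodup] at h4
  have h5 := h.length_eq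
  rw [h2, h3]
  have h6 : 4 * κ * Nat.log (s.headD 0) N = 2 * (2 * κ * Nat.log (s.headD 0) N) := by ring
  omega

/-! ## Random rows -/

/-- As `g` vanishes at multiplicity zero, the undrawn rows may be put back, which turns the sum into
one over all indices. -/
lemma sum_drawnRows (s : List ℕ) {l : ℕ} (τ : Fin l → Fin s.length) (g : ℕ × ℕ → ℕ)
    (hg : ∀ a, g (a, 0) = 0) :
    ((drawnRows s τ).map g).sum =
      ∑ j, g (s.get j, (Finset.univ.filter fun h => τ h = j).card) := by
  rw [Fin.sum_univ_def, drawnRows]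
  induction List.finRange s.length with
  | nil => rfl
  | cons j L ih =>
    rw [List.filterMap_cons, List.map_cons, List.sum_cons, ← ih]
    split_ifs with h
    · simp only [h]
      rw [hg, zero_add]
    · rfl

lemma mem_drawnRows {s : List ℕ} {l : ℕ} {τ : Fin l → Fin s.length} {r : ℕ × ℕ}
    (h : r ∈ drawnRows s τ) : r.1 ∈ s ∧ 1 ≤ r.2 := by
  obtain ⟨j, -, hj⟩ := List.mem_filterMap.1 h
  split_ifs at hj with h0
  simp only [Option.some.injEq] at hj
  subst hj
  exact ⟨List.get_mem _ _, Nat.one_le_iff_ne_zero.2 h0⟩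

lemma rowWeight_drawnRows (s : List ℕ) {l : ℕ} (τ : Fin l → Fin s.length) :
    rowWeight (drawnRows s τ) = l := by
  rw [rowWeight, sum_drawnRows s τ Prod.snd fun _ => rfl]
  have := Finset.card_eq_sum_card_fiberwise (f := τ) (s := Finset.univ) (t := Finset.univ)
    fun _ _ => Finset.mem_coe.2 (Finset.mem_univ _)
  rw [Finset.card_univ, Fintype.card_fin] at this
  exact this.symm

lemma goodWeight_drawnRows (s : List ℕ) {l : ℕ} (τ : Fin l → Fin s.length) (p : ℕ → Prop)
    [DecidablePred p] :
    goodWeight (drawnRows s τ) p = (Finset.univ.filter fun h => p (s.get (τ h))).card := by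
  classical
  rw [goodWeight, sum_drawnRows s τ _ fun _ => by simp]
  rw [Finset.card_eq_sum_card_fiberwise (f := τ) (s := Finset.univ.filter fun h => p (s.get (τ h)))
    (t := Finset.univ) fun _ _ => Finset.mem_coe.2 (Finset.mem_univ _)]
  refine Finset.sum_congr rfl fun j _ => ?_
  rw [Finset.filter_filter]
  dsimp only
  split_ifs with hp
  · congr 1
    refine Finset.filter_congr fun h _ => ?_
    constructor
    · rintro rfl
      exact ⟨hp, rfl⟩
    · exact fun h => h.2
  · rw [eq_comm, Finset.card_eq_zero, Finset.filter_eq_empty_iff]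
    rintro h - ⟨h1, rfl⟩
    exact hp h1

lemma drawnRows_length_le (s : List ℕ) {l : ℕ} (τ : Fin l → Fin s.length) :
    (drawnRows s τ).length ≤ s.length := by
  refine (List.length_filterMap_le _ _).trans ?_
  simp

/-! ## Tail bound for independent draws -/

/-- Exponential Markov inequality: give a draw the weight 4 in `B` and 1 elsewhere. The weights of
all sequences sum to `(K + 3 |B|) ^ l`, while a sequence with at least half of its draws in `B`
weighs at least `4 ^ (l / 2) = 2 ^ l`. -/
lemma card_bad_draws {K l : ℕ} (B : Finset (Fin K)) :
    (Finset.univ.filter fun τ : Fin l → Fin K =>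
      l ≤ 2 * (Finset.univ.filter fun h => τ h ∈ B).card).card * 2 ^ l ≤ (K + 3 * B.card) ^ l := by
  have h1 : ∑ j : Fin K, (if j ∈ B then 4 else 1) = K + 3 * B.card := by
    have : ∀ j : Fin K, (if j ∈ B then 4 else 1) = 1 + 3 * (if j ∈ B then 1 else 0) := by
      intro j
      split_ifs <;> rfl
    simp_rw [this]
    rw [Finset.sum_add_distrib, ← Finset.mul_sum]
    simp
  have h2 : (K + 3 * B.card) ^ l =
      ∑ τ : Fin l → Fin K, 4 ^ (Finset.univ.filter fun h => τ h ∈ B).card := by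
    rw [← h1]
    have := Finset.prod_univ_sum (fun _ : Fin l => (Finset.univ : Finset (Fin K)))
      (fun _ j => if j ∈ B then 4 else 1)
    rw [Finset.prod_const, Finset.card_univ, Fintype.card_fin, Fintype.piFinset_univ] at this
    rw [this]
    refine Finset.sum_congr rfl fun τ _ => ?_
    rw [Finset.prod_ite]
    simp
  rw [h2, ← smul_eq_mul, ← Finset.sum_const]
  refine (Finset.sum_le_sum (f := fun _ => 2 ^ l) fun τ hτ => ?_).trans
    (Finset.sum_le_sum_of_subset (Finset.subset_univ _))
  have := (Finset.mem_filter.1 hτ).2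
  calc 2 ^ l ≤ 2 ^ (2 * (Finset.univ.filter fun h => τ h ∈ B).card) :=
        Nat.pow_le_pow_right (by norm_num) this
    _ = _ := by rw [pow_mul]; norm_num

instance drawLaw_isProbability (K l : ℕ) [NeZero K] :
    MeasureTheory.IsProbabilityMeasure (drawLaw K l) := by
  have : MeasureTheory.IsProbabilityMeasure
      (ProbabilityTheory.uniformOn (Set.univ : Set (Fin K))) :=
    ProbabilityTheory.isProbabilityMeasure_uniformOn Set.finite_univ Set.univ_nonempty
  unfold drawLaw
  infer_instance

lemma drawLaw_le (K l : ℕ) [NeZero K] (A : Finset (Fin l → Fin K)) :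
    drawLaw K l A ≤ A.card * ((K : ENNReal)⁻¹) ^ l := by
  have : MeasureTheory.IsProbabilityMeasure
      (ProbabilityTheory.uniformOn (Set.univ : Set (Fin K))) :=
    ProbabilityTheory.isProbabilityMeasure_uniformOn Set.finite_univ Set.univ_nonempty
  have h1 : ∀ τ : Fin l → Fin K, drawLaw K l {τ} = ((K : ENNReal)⁻¹) ^ l := by
    intro τ
    rw [drawLaw, MeasureTheory.Measure.pi_singleton]
    have : ∀ j : Fin K, ProbabilityTheory.uniformOn (Set.univ : Set (Fin K)) {j} =
        (K : ENNReal)⁻¹ := by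
      intro j
      rw [ProbabilityTheory.uniformOn_univ]
      simp
    simp [this]
  calc drawLaw K l A = drawLaw K l (⋃ τ ∈ A, {τ}) := by
        congr 1
        ext τ
        simp
    _ ≤ ∑ τ ∈ A, drawLaw K l {τ} := MeasureTheory.measure_biUnion_finset_le _ _
    _ = _ := by simp [h1]

lemma five_sevenths_pow_le {N : ℕ} (hN : 0 < N) {σ : ℝ} (hσ : σ < 1) :
    (N : ℝ) * (5 / 7 : ℝ) ^ numDraws N σ ≤ 1 - σ := by
  have hN' : (0 : ℝ) < N := by exact_mod_cast hN
  have h0 : (0 : ℝ) < N / (1 - σ) := by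
    have : 0 < 1 - σ := by linarith
    positivity
  set l := numDraws N σ with hl
  have h1 : 21 * Real.log (N / (1 - σ)) ≤ l := Nat.le_ceil _
  -- There is room here: `5 / 7 ≤ 20 / 21 ≤ exp (-1 / 21)`, where 21 is the factor in the number of
  -- draws.
  have h2 : (5 / 7 : ℝ) ≤ Real.exp (-(1 / 21)) := by
    have := Real.add_one_le_exp (-(1 / 21 : ℝ))
    linarith
  have h3 : (5 / 7 : ℝ) ^ l ≤ Real.exp (-Real.log (N / (1 - σ))) := by
    calc (5 / 7 : ℝ) ^ l ≤ Real.exp (-(1 / 21)) ^ l := by gcongr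
      _ = Real.exp (l * (-(1 / 21))) := (Real.exp_nat_mul _ _).symm
      _ ≤ _ := Real.exp_le_exp.2 (by linarith)
  rw [Real.exp_neg, Real.exp_log h0] at h3
  calc (N : ℝ) * (5 / 7 : ℝ) ^ l ≤ N * (N / (1 - σ))⁻¹ := by gcongr
    _ = 1 - σ := by field_simp

/-- With factor 14 at most a seventh of the moduli is noisy, so `K + 3 |B| ≤ 10 K / 7` and a fixed
frequency fails with probability at most `(5 / 7) ^ l`. A union bound over the `N` frequencies
leaves at most `1 - σ`. The set `T` is fixed before the draws, as this requires. -/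
lemma drawnRows_mostlyGood {N κ : ℕ} (hN : 0 < N) {s : List ℕ} (h : IsRowModuli N κ 14 s)
    {σ : ℝ} (hσ1 : σ < 1) (x : ℤ → ℂ) {δ : ℝ} (hδ : 0 ≤ δ)
    {T : Finset ℤ} (hT : T ⊆ freqRange N) (hTκ : T.card ≤ κ)
    (htail : ∑ ν ∈ freqRange N \ T, ‖x ν‖ ≤ κ * δ) :
    ENNReal.ofReal σ ≤ drawLaw s.length (numDraws N σ)
      {τ | MostlyGood N (drawnRows s τ) x δ} := by
  classical
  set l := numDraws N σ with hl
  set K := s.length with hK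
  have hKpos : 0 < K := by rw [hK, h.length_eq]; omega
  have : NeZero K := ⟨hKpos.ne'⟩
  set B : ℤ → Finset (Fin K) := fun ω => Finset.univ.filter fun j => ¬ noise N x (s.get j) ω ≤ δ
    with hB
  set bad : ℤ → Finset (Fin l → Fin K) := fun ω => Finset.univ.filter fun τ =>
    l ≤ 2 * (Finset.univ.filter fun h => τ h ∈ B ω).card with hbad
  have hBc : ∀ ω ∈ freqRange N, 7 * (K + 3 * (B ω).card) ≤ 10 * K := by
    intro ω hω
    have h1 := h.card_noisy_le x hδ hT hTκ htail hω
    have h2 : (B ω).card ≤ (s.toFinset.filter fun s => ¬ noise N x s ω ≤ δ).card := by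
      refine Finset.card_le_card_of_injOn (fun j => s.get j) (fun j hj => ?_) ?_
      · exact Finset.mem_coe.2 (Finset.mem_filter.2
          ⟨List.mem_toFinset.2 (List.get_mem _ _), (Finset.mem_filter.1 hj).2⟩)
      · exact (List.nodup_iff_injective_get.1 h.nodup).injOn
    have h3 := h.length_eq
    have h4 : 14 * κ * Nat.log (s.headD 0) N = 7 * (2 * κ * Nat.log (s.headD 0) N) := by ring
    omega
  have hbadc : ∀ ω ∈ freqRange N, ((bad ω).card : ℝ) ≤ (5 / 7 : ℝ) ^ l * K ^ l := by
    intro ω hω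
    have h1 := card_bad_draws (l := l) (B ω)
    have h2 : ((bad ω).card : ℝ) * 2 ^ l ≤ ((K : ℝ) + 3 * (B ω).card) ^ l := by exact_mod_cast h1
    have h3 : ((K : ℝ) + 3 * (B ω).card) ≤ 10 / 7 * K := by
      have : (7 : ℝ) * (K + 3 * (B ω).card) ≤ 10 * K := by exact_mod_cast hBc ω hω
      linarith
    have h4 : ((K : ℝ) + 3 * (B ω).card) ^ l ≤ (10 / 7 * K) ^ l := by gcongr
    have h5 : (10 / 7 * (K : ℝ)) ^ l = (5 / 7 : ℝ) ^ l * K ^ l * 2 ^ l := by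
      rw [← mul_pow, ← mul_pow]
      congr 1
      ring
    rw [h5] at h4
    exact le_of_mul_le_mul_right (h2.trans h4) (by positivity)
  set A := (freqRange N).biUnion bad with hA
  have hAc : (A.card : ℝ) ≤ (1 - σ) * K ^ l := by
    have h1 : (A.card : ℝ) ≤ ∑ ω ∈ freqRange N, ((bad ω).card : ℝ) := by
      exact_mod_cast Finset.card_biUnion_le
    have h2 := Finset.sum_le_card_nsmul _ _ _ hbadc
    have h3 : (freqRange N).card = N := by
      rw [freqRange, Int.card_Ioc]
      omega
    rw [h3, nsmul_eq_mul] at h2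
    have h4 := five_sevenths_pow_le hN hσ1
    have h5 : (N : ℝ) * ((5 / 7 : ℝ) ^ l * K ^ l) = N * (5 / 7 : ℝ) ^ l * K ^ l := by ring
    rw [h5] at h2
    refine (h1.trans h2).trans ?_
    gcongr
  have hsub : ((A : Set (Fin l → Fin K)))ᶜ ⊆ {τ | MostlyGood N (drawnRows s τ) x δ} := by
    intro τ hτ ω hω
    rw [rowWeight_drawnRows, goodWeight_drawnRows]
    by_contra hle
    refine hτ (Finset.mem_coe.2 (Finset.mem_biUnion.2 ⟨ω, hω, Finset.mem_filter.2
      ⟨Finset.mem_univ _, ?_⟩⟩))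
    have h1 := Finset.card_filter_add_card_filter_not (s := (Finset.univ : Finset (Fin l)))
      fun h => noise N x (s.get (τ h)) ω ≤ δ
    rw [Finset.card_univ, Fintype.card_fin] at h1
    have h2 : (Finset.univ.filter fun h => τ h ∈ B ω) =
        Finset.univ.filter fun h => ¬ noise N x (s.get (τ h)) ω ≤ δ := by
      ext h
      simp [hB]
    rw [h2]
    omega
  have hmA : drawLaw K l A ≤ ENNReal.ofReal (1 - σ) := by
    refine (drawLaw_le K l A).trans ?_
    have hKl : (0 : ℝ) < (K : ℝ) ^ l := by positivity
    have h1 : (A.card : ENNReal) ≤ ENNReal.ofReal (1 - σ) * (K : ENNReal) ^ l := by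
      have h2 := ENNReal.ofReal_le_ofReal hAc
      rw [ENNReal.ofReal_natCast, ENNReal.ofReal_mul (by linarith),
        ENNReal.ofReal_pow (Nat.cast_nonneg _), ENNReal.ofReal_natCast] at h2
      exact h2
    calc (A.card : ENNReal) * ((K : ENNReal)⁻¹) ^ l
        ≤ ENNReal.ofReal (1 - σ) * (K : ENNReal) ^ l * ((K : ENNReal)⁻¹) ^ l := by gcongr
      _ = ENNReal.ofReal (1 - σ) := by
          rw [mul_assoc, ← mul_pow, ENNReal.mul_inv_cancel, one_pow, mul_one]
          · exact_mod_cast hKpos.ne'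
          · exact ENNReal.natCast_ne_top K
  refine le_trans ?_ (MeasureTheory.measure_mono hsub)
  rw [MeasureTheory.prob_compl_eq_one_sub (Finset.measurableSet A)]
  refine le_trans ?_ (tsub_le_tsub_left hmA 1)
  rw [← ENNReal.ofReal_one, ← ENNReal.ofReal_sub _ (by linarith)]
  exact ENNReal.ofReal_le_ofReal (by linarith)

/-! ## The Chinese remainder map -/

lemma centeredMod_modEq (a : ℤ) (N : ℕ) : (N : ℤ) ∣ centeredMod a N - a := by
  have h : (N : ℤ) ∣ a % (N : ℤ) - a := (Int.mod_modEq a N).symm.dvd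
  unfold centeredMod
  split_ifs
  · exact h
  · have := dvd_sub h (dvd_refl (N : ℤ))
    obtain ⟨q, hq⟩ := this
    exact ⟨q, by linear_combination hq⟩

lemma centeredMod_bounds (a : ℤ) {N : ℕ} (hN : 0 < N) :
    -(N : ℤ) < 2 * centeredMod a N ∧ 2 * centeredMod a N ≤ N := by
  have hN' : (0 : ℤ) < N := by exact_mod_cast hN
  have h1 := Int.emod_nonneg a hN'.ne'
  have h2 := Int.emod_lt_of_pos a hN'
  unfold centeredMod
  split_ifs <;> constructor <;> omega

lemma eq_of_dvd_of_bounds {N : ℕ} {a b : ℤ} (h : (N : ℤ) ∣ a - b) (ha : -(N : ℤ) < 2 * a)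
    (ha' : 2 * a ≤ N) (hb : -(N : ℤ) < 2 * b) (hb' : 2 * b ≤ N) : a = b := by
  have := Int.eq_zero_of_abs_lt_dvd h (by rw [abs_lt]; constructor <;> omega)
  omega

lemma mem_freqRange_iff {N : ℕ} {a : ℤ} :
    a ∈ freqRange N ↔ -(N : ℤ) < 2 * a ∧ 2 * a ≤ N := by
  rw [freqRange, Finset.mem_Ioc]
  omega

section Moduli
variable {D M : ℕ} {P : Fin D → ℕ}

lemma IsModuli.pos (h : IsModuli M P) (d : Fin D) : 0 < P d := (Nat.zero_le _).trans_lt (h.2 d)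

lemma IsModuli.bigN_pos (h : IsModuli M P) : 0 < bigN P := Finset.prod_pos fun d _ => h.pos d

lemma dvd_bigN (P : Fin D → ℕ) (d : Fin D) : P d ∣ bigN P := Finset.dvd_prod_of_mem P (Finset.mem_univ d)

lemma IsModuli.cofactor_eq (h : IsModuli M P) (d : Fin D) :
    bigN P / P d = ∏ j ∈ Finset.univ.erase d, P j := by
  rw [bigN, ← Finset.mul_prod_erase _ _ (Finset.mem_univ d), Nat.mul_div_cancel_left _ (h.pos d)]

lemma IsModuli.dvd_cofactor (h : IsModuli M P) {d j : Fin D} (hdj : d ≠ j) :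
    P d ∣ bigN P / P j := by
  rw [h.cofactor_eq]
  exact Finset.dvd_prod_of_mem P (Finset.mem_erase.2 ⟨hdj, Finset.mem_univ d⟩)

lemma IsModuli.coprime_cofactor (h : IsModuli M P) (d : Fin D) :
    Nat.Coprime (P d) (bigN P / P d) := by
  rw [h.cofactor_eq]
  exact Nat.Coprime.prod_right fun j hj => h.1 (Finset.ne_of_mem_erase hj).symm

/-- The frequency `∑ d, (Ñ / P_d) ω_d`, before reduction modulo `Ñ`. -/
def lineFreq (P : Fin D → ℕ) (ω : Fin D → ℤ) : ℤ := ∑ d, ((bigN P / P d : ℕ) : ℤ) * ω d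

lemma IsModuli.lineFreq_dvd (h : IsModuli M P) (ω : Fin D → ℤ) (d : Fin D) :
    (P d : ℤ) ∣ lineFreq P ω - ((bigN P / P d : ℕ) : ℤ) * ω d := by
  rw [lineFreq, ← Finset.add_sum_erase _ _ (Finset.mem_univ d), add_sub_cancel_left]
  exact Finset.dvd_sum fun j hj => Dvd.dvd.mul_right
    (by exact_mod_cast h.dvd_cofactor (Finset.ne_of_mem_erase hj).symm) _

lemma IsModuli.bigN_dvd (h : IsModuli M P) {a : ℤ} (ha : ∀ d, (P d : ℤ) ∣ a) :
    (bigN P : ℤ) ∣ a := by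
  rw [Int.natCast_dvd]
  refine Finset.prod_dvd_of_isRelPrime (fun i _ j _ hij => ?_) fun d _ => Int.natCast_dvd.1 (ha d)
  exact Nat.coprime_iff_isRelPrime.1 (h.1 hij)

lemma crtMap_eq_iff (h : IsModuli M P) {ω : Fin D → ℤ} {ν : ℤ} (hν : ν ∈ freqRange (bigN P)) :
    crtMap P ω = ν ↔ (bigN P : ℤ) ∣ lineFreq P ω - ν := by
  have h1 := centeredMod_modEq (lineFreq P ω) (bigN P)
  constructor
  · rintro rfl
    rw [dvd_sub_comm]
    exact h1
  · intro h2
    rw [mem_freqRange_iff] at hν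
    have h3 := centeredMod_bounds (lineFreq P ω) h.bigN_pos
    refine eq_of_dvd_of_bounds ?_ h3.1 h3.2 hν.1 hν.2
    obtain ⟨q, hq⟩ := dvd_add h1 h2
    exact ⟨q, by rw [crtMap, ← lineFreq]; linear_combination hq⟩

lemma crtMap_mem (h : IsModuli M P) (ω : Fin D → ℤ) : crtMap P ω ∈ freqRange (bigN P) :=
  mem_freqRange_iff.2 (centeredMod_bounds _ h.bigN_pos)

/-- Modulo `P d` only the `d`-th summand survives, and its cofactor `Ñ / P_d` is invertible there.
So the image determines every `ω d`, and multiplying `ν` by the inverses `u d` gives a preimage. -/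
theorem crtMap_bijOn (h : IsModuli M P) :
    Set.BijOn (crtMap P) (freqBox P) (freqRange (bigN P) : Set ℤ) := by
  refine ⟨fun ω _ => crtMap_mem h ω, ?_, ?_⟩
  · intro ω hω ω' hω' he
    funext d
    have h1 := (crtMap_eq_iff h (crtMap_mem h ω')).1 he
    have h2 : (bigN P : ℤ) ∣ lineFreq P ω - lineFreq P ω' := by
      have := dvd_add h1 (centeredMod_modEq (lineFreq P ω') (bigN P))
      rw [crtMap, ← lineFreq] at this
      simpa using this
    have h3 : (P d : ℤ) ∣ ((bigN P / P d : ℕ) : ℤ) * (ω d - ω' d) := by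
      have e1 := h.lineFreq_dvd ω d
      have e2 := h.lineFreq_dvd ω' d
      have e3 := (Int.natCast_dvd_natCast.2 (dvd_bigN P d)).trans h2
      have := dvd_sub (dvd_add e3 e2) e1
      obtain ⟨q, hq⟩ := this
      exact ⟨q, by linear_combination hq⟩
    have h4 : (P d : ℤ) ∣ ω d - ω' d :=
      (Nat.isCoprime_iff_coprime.2 (h.coprime_cofactor d)).dvd_of_dvd_mul_left h3
    exact eq_of_dvd_of_bounds h4 (hω d).1 (hω d).2 (hω' d).1 (hω' d).2
  · intro ν hν
    have hu : ∀ d, ∃ u : ℤ, (P d : ℤ) ∣ ((bigN P / P d : ℕ) : ℤ) * u - 1 := by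
      intro d
      obtain ⟨a, b, hab⟩ := Nat.isCoprime_iff_coprime.2 (h.coprime_cofactor d)
      exact ⟨b, -a, by linear_combination hab⟩
    choose u hu using hu
    refine ⟨fun d => centeredMod (u d * ν) (P d), fun d => centeredMod_bounds _ (h.pos d), ?_⟩
    rw [crtMap_eq_iff h hν]
    refine h.bigN_dvd fun d => ?_
    have e1 := h.lineFreq_dvd (fun d => centeredMod (u d * ν) (P d)) d
    have e2 := (centeredMod_modEq (u d * ν) (P d)).mul_left ((bigN P / P d : ℕ) : ℤ)
    have e3 := (hu d).mul_right ν
    have := dvd_add (dvd_add e1 e2) e3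
    obtain ⟨q, hq⟩ := this
    exact ⟨q, by linear_combination hq⟩

/-- Since `M D < P_d`, each of the `D` summands `(Ñ / P_d) M` is below `Ñ / D`. So frequencies of
the band need no reduction modulo `Ñ`. -/
lemma lineFreq_bounds (h : IsModuli M P) {ω : Fin D → ℤ} (hω : ∀ d, 2 * |ω d| ≤ M) :
    -(bigN P : ℤ) < 2 * lineFreq P ω ∧ 2 * lineFreq P ω ≤ bigN P := by
  suffices h0 : |2 * lineFreq P ω| < bigN P by
    rw [abs_lt] at h0
    exact ⟨h0.1, h0.2.le⟩
  have h1 : |2 * lineFreq P ω| ≤ ∑ d, ((bigN P / P d : ℕ) : ℤ) * M := by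
    rw [lineFreq, Finset.mul_sum]
    refine (Finset.abs_sum_le_sum_abs _ _).trans (Finset.sum_le_sum fun d _ => ?_)
    rw [abs_mul, abs_mul, Nat.abs_cast, abs_two]
    have := mul_le_mul_of_nonneg_left (hω d) (Nat.cast_nonneg (α := ℤ) (bigN P / P d))
    linarith
  refine h1.trans_lt ?_
  have hb : (0 : ℤ) < bigN P := by exact_mod_cast h.bigN_pos
  rcases Nat.eq_zero_or_pos D with rfl | hD
  · simpa using hb
  · have hD' : (0 : ℤ) < D := by exact_mod_cast hD
    refine lt_of_mul_lt_mul_left (a := (D : ℤ)) ?_ hD'.le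
    have : (D : ℤ) * bigN P = ∑ _d : Fin D, (bigN P : ℤ) := by simp
    rw [this, Finset.mul_sum]
    refine Finset.sum_lt_sum_of_nonempty ⟨⟨0, hD⟩, Finset.mem_univ _⟩ fun d _ => ?_
    have h2 : bigN P / P d * P d = bigN P := Nat.div_mul_cancel (dvd_bigN P d)
    have h3 := h.2 d
    have h4 : 0 < bigN P / P d := Nat.div_pos (Nat.le_of_dvd h.bigN_pos (dvd_bigN P d)) (h.pos d)
    have h5 := Nat.mul_lt_mul_of_pos_left h3 h4
    rw [h2] at h5
    zify at h5
    push_cast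
    linarith

end Moduli

/-! ## Fourier series of bandlimited functions -/

section Fourier
variable {D M : ℕ} {f : (Fin D → ℝ) → ℂ}

lemma IsBandlimited.periodic_int (hf : IsBandlimited M f) (x : Fin D → ℝ) (n : Fin D → ℤ) :
    f (fun d => x d + 2 * Real.pi * n d) = f x := by
  have h1 : ∀ (d : Fin D) (m : ℤ) (y : Fin D → ℝ),
      f (y + Pi.single d (2 * Real.pi * m)) = f y := by
    intro d m y
    have hp : Function.Periodic f (Pi.single d (2 * Real.pi)) := fun z => hf.periodic z d
    have := hp.zsmul m y
    rw [← this]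
    congr 2
    rw [← Pi.single_zsmul]
    simp [mul_comm]
  have h2 : ∀ s : Finset (Fin D), f (x + ∑ d ∈ s, Pi.single d (2 * Real.pi * (n d : ℝ))) = f x := by
    intro s
    induction s using Finset.induction_on with
    | empty => simp
    | insert d s hd ih =>
      rw [Finset.sum_insert hd, add_comm (Pi.single _ _), ← add_assoc]
      exact (h1 d (n d) _).trans ih
  rw [← h2 Finset.univ]
  congr 1
  funext d
  simp [Finset.univ_sum_single fun d => 2 * Real.pi * (n d : ℝ)]

/-- The function on the torus given by a periodic function. -/
def torusFun (f : (Fin D → ℝ) → ℂ) (z : UnitAddTorus (Fin D)) : ℂ :=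
  f fun d => 2 * Real.pi * (AddCircle.equivIco 1 0 (z d) : ℝ)

lemma IsBandlimited.torusFun_coe (hf : IsBandlimited M f) (x : Fin D → ℝ) :
    torusFun f (fun d => (x d : UnitAddCircle)) = f fun d => 2 * Real.pi * x d := by
  rw [← hf.periodic_int _ fun d => -⌊x d⌋, torusFun]
  congr 1
  funext d
  have : (AddCircle.equivIco 1 0 (x d : UnitAddCircle) : ℝ) = Int.fract (x d) := by
    rw [AddCircle.coe_equivIco_mk_apply]
    simp
  rw [this, Int.fract]
  push_cast
  ring

/-- Representatives in `[0, 1)` jump at 0, so continuity is checked after pulling back along the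
open quotient map from `ℝ^D`, where periodicity turns the function into `f` scaled by `2 π`. -/
lemma IsBandlimited.continuous_torusFun (hf : IsBandlimited M f) : Continuous (torusFun f) := by
  have hq : IsOpenQuotientMap (Pi.map fun (_ : Fin D) (x : ℝ) => (x : UnitAddCircle)) :=
    IsOpenQuotientMap.piMap fun _ => QuotientAddGroup.isOpenQuotientMap_mk
  rw [hq.isQuotientMap.continuous_iff]
  have : (torusFun f ∘ Pi.map fun (_ : Fin D) (x : ℝ) => (x : UnitAddCircle)) =
      fun x => f fun d => 2 * Real.pi * x d := funext fun x => hf.torusFun_coe x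
  rw [this]
  exact hf.continuous.comp (by fun_prop)

lemma mFourier_coe (ω : Fin D → ℤ) (x : Fin D → ℝ) :
    UnitAddTorus.mFourier ω (fun d => (x d : UnitAddCircle)) =
      Complex.exp (2 * Real.pi * Complex.I * ∑ d, (ω d : ℂ) * (x d : ℂ)) := by
  simp only [UnitAddTorus.mFourier, ContinuousMap.coe_mk, fourier_coe_apply]
  rw [← Complex.exp_sum, Finset.mul_sum]
  congr 1
  refine Finset.sum_congr rfl fun d _ => ?_
  push_cast
  ring

open scoped Pointwise in
-- Scaling by `2 π` carries the unit cube to `[0, 2π]^D`; its Jacobian is the normalizing factor in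
-- `fhat`, and half-open and closed cubes differ by a null set.
lemma IsBandlimited.mFourierCoeff_eq (hf : IsBandlimited M f) (ω : Fin D → ℤ) :
    UnitAddTorus.mFourierCoeff (torusFun f) ω = fhat f ω := by
  rw [UnitAddTorus.mFourierCoeff_eq_integral _ _ 0, fhat]
  have hpi : (0 : ℝ) < 2 * Real.pi := Real.two_pi_pos
  set g : (Fin D → ℝ) → ℂ := fun x =>
    Complex.exp (-Complex.I * (∑ d, (ω d : ℂ) * (x d : ℂ))) * f x with hg
  have hset : {x : Fin D → ℝ | ∀ i, x i ∈ Set.Ioc ((0 : Fin D → ℝ) i) ((0 : Fin D → ℝ) i + 1)} =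
      Set.univ.pi fun _ => Set.Ioc (0 : ℝ) 1 := by
    ext x
    simp
  have hint : ∀ x : Fin D → ℝ, UnitAddTorus.mFourier (-ω) (fun i => (x i : UnitAddCircle)) •
      torusFun f (fun i => (x i : UnitAddCircle)) = g ((2 * Real.pi) • x) := by
    intro x
    rw [hf.torusFun_coe, mFourier_coe, smul_eq_mul, hg]
    dsimp only
    congr 2
    rw [Finset.mul_sum, Finset.mul_sum]
    refine Finset.sum_congr rfl fun d _ => ?_
    simp
    ring
  simp_rw [hint]
  rw [hset, MeasureTheory.Measure.setIntegral_comp_smul _ _ _ hpi.ne']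
  have hsm : (2 * Real.pi) • (Set.univ.pi fun _ : Fin D => Set.Ioc (0 : ℝ) 1) =
      Set.univ.pi fun _ => Set.Ioc (0 : ℝ) (2 * Real.pi) := by
    rw [Set.smul_set_univ_pi]
    congr 1
    funext d
    rw [Pi.smul_apply, LinearOrderedField.smul_Ioc hpi]
    simp
  rw [hsm, MeasureTheory.volume_pi, MeasureTheory.setIntegral_congr_set
    (MeasureTheory.Measure.univ_pi_Ioc_ae_eq_Icc (f := fun _ : Fin D => (0 : ℝ)))]
  rw [Module.finrank_fin_fun, abs_of_pos (by positivity), Complex.real_smul]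
  simp [hg, Pi.zero_def]

/-- A finite set of frequencies outside of which the Fourier coefficients vanish. -/
def bandBox (D M : ℕ) : Finset (Fin D → ℤ) :=
  (Fintype.piFinset fun _ => Finset.Icc (-(M : ℤ)) M).filter fun ω => ∀ d, 2 * |ω d| ≤ M

lemma IsBandlimited.fhat_eq_zero (hf : IsBandlimited M f) {ω : Fin D → ℤ}
    (h : ω ∉ bandBox D M) : fhat f ω = 0 := by
  refine hf.band ω ?_
  by_contra hn
  push Not at hn
  refine h (Finset.mem_filter.2 ⟨Fintype.mem_piFinset.2 fun d => Finset.mem_Icc.2 ?_, hn⟩)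
  have := hn d
  rw [← abs_le]
  have := abs_nonneg (ω d)
  omega

/-- A continuous function with summable Fourier coefficients is everywhere the sum of its series.
Here the series is finite. Equality at every point is needed because the algorithms use point
samples. -/
lemma IsBandlimited.eq_sum (hf : IsBandlimited M f) (x : Fin D → ℝ) :
    f x = ∑ ω ∈ bandBox D M, fhat f ω * Complex.exp (Complex.I * ∑ d, (ω d : ℂ) * (x d : ℂ)) := by
  set F : C(UnitAddTorus (Fin D), ℂ) := ⟨torusFun f, hf.continuous_torusFun⟩ with hF
  have hc : UnitAddTorus.mFourierCoeff F = fhat f := funext hf.mFourierCoeff_eq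
  have hsum : Summable (UnitAddTorus.mFourierCoeff F) := by
    rw [hc]
    exact summable_of_ne_finset_zero (s := bandBox D M) fun ω hω => hf.fhat_eq_zero hω
  have h1 := UnitAddTorus.hasSum_mFourier_series_apply_of_summable hsum
    (fun d => ((x d / (2 * Real.pi) : ℝ) : UnitAddCircle))
  rw [hc] at h1
  have h2 : F (fun d => ((x d / (2 * Real.pi) : ℝ) : UnitAddCircle)) = f x := by
    change torusFun f _ = _
    rw [hf.torusFun_coe]
    congr 1
    funext d
    have := Real.pi_ne_zero
    field_simp
  rw [h2] at h1
  rw [← h1.tsum_eq, tsum_eq_sum (s := bandBox D M) fun ω hω => by rw [hf.fhat_eq_zero hω, zero_smul]]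
  refine Finset.sum_congr rfl fun ω _ => ?_
  rw [mFourier_coe, smul_eq_mul]
  congr 2
  rw [Finset.mul_sum, Finset.mul_sum]
  refine Finset.sum_congr rfl fun d _ => ?_
  have : (Real.pi : ℂ) ≠ 0 := by exact_mod_cast Real.pi_ne_zero
  push_cast
  field_simp

end Fourier

/-! ## Measurements of the one-dimensional function -/

lemma sum_exp_eq {n : ℕ} (hn : 0 < n) (m : ℤ) :
    (1 / (n : ℂ)) * ∑ p ∈ Finset.range n,
      Complex.exp (2 * Real.pi * Complex.I * m * p / n) = if (n : ℤ) ∣ m then 1 else 0 := by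
  have hn' : (n : ℂ) ≠ 0 := by exact_mod_cast hn.ne'
  set z := Complex.exp (2 * Real.pi * Complex.I * (m / n)) with hz
  have h1 : ∀ p : ℕ, Complex.exp (2 * Real.pi * Complex.I * m * p / n) = z ^ p := by
    intro p
    rw [hz, ← Complex.exp_nat_mul]
    congr 1
    field_simp
  simp_rw [h1]
  split_ifs with h
  · obtain ⟨q, rfl⟩ := h
    have : z = 1 := by
      rw [hz, Complex.exp_eq_one_iff]
      refine ⟨q, ?_⟩
      push_cast
      field_simp
    simp [this, hn']
  · have hz1 : z ≠ 1 := by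
      rw [hz, Ne, Complex.exp_eq_one_iff]
      rintro ⟨q, hq⟩
      have hpi : (2 * Real.pi * Complex.I : ℂ) ≠ 0 := Complex.two_pi_I_ne_zero
      have h2 : (m : ℂ) / n = q := by
        refine mul_left_cancel₀ hpi ?_
        rw [hq]
        ring
      rw [div_eq_iff hn'] at h2
      refine h ⟨q, ?_⟩
      have : (m : ℂ) = ((n * q : ℤ) : ℂ) := by
        rw [h2]
        push_cast
        ring
      exact_mod_cast this
    have hzn : z ^ n = 1 := by
      rw [hz, ← Complex.exp_nat_mul, Complex.exp_eq_one_iff]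
      exact ⟨m, by field_simp⟩
    rw [geom_sum_eq hz1, hzn]
    simp

section Transfer
variable {D M : ℕ} {P : Fin D → ℕ} {f : (Fin D → ℝ) → ℂ}

lemma fnew_eq_sum (hP : IsModuli M P) (hf : IsBandlimited M f) (x : ℝ) :
    fnew P f x = ∑ ω ∈ bandBox D M, fhat f ω * Complex.exp (Complex.I * lineFreq P ω * x) := by
  rw [fnew, hf.eq_sum]
  refine Finset.sum_congr rfl fun ω _ => ?_
  congr 2
  rw [mul_assoc, lineFreq]
  congr 1
  rw [Int.cast_sum, Finset.sum_mul]
  refine Finset.sum_congr rfl fun d _ => ?_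
  have hd : ((P d : ℕ) : ℂ) ≠ 0 := by exact_mod_cast (hP.pos d).ne'
  rw [curve, Int.cast_mul, Int.cast_natCast, Nat.cast_div (dvd_bigN P d) hd]
  push_cast
  ring

lemma sampleDFT_fnew (hP : IsModuli M P) (hf : IsBandlimited M f) {n : ℕ} (hn : 0 < n) (h : ℕ) :
    sampleDFT (fnew P f) n h =
      ∑ ω ∈ (bandBox D M).filter fun ω => (n : ℤ) ∣ lineFreq P ω - h, fhat f ω := by
  rw [sampleDFT]
  simp_rw [fnew_eq_sum hP hf, Finset.sum_mul]
  rw [Finset.sum_comm, Finset.mul_sum, Finset.sum_filter]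
  refine Finset.sum_congr rfl fun ω _ => ?_
  have h1 := sum_exp_eq hn (lineFreq P ω - h)
  have h2 : ∀ p : ℕ, fhat f ω * Complex.exp (Complex.I * lineFreq P ω *
      ((2 * Real.pi * (p : ℝ) / (n : ℝ) : ℝ) : ℂ)) *
      Complex.exp (-2 * (Real.pi : ℂ) * Complex.I * (h : ℂ) * (p : ℂ) / (n : ℂ)) =
      fhat f ω * Complex.exp (2 * Real.pi * Complex.I * ((lineFreq P ω - h : ℤ) : ℂ) * p / n) := by
    intro p
    rw [mul_assoc, ← Complex.exp_add]
    congr 2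
    push_cast
    ring
  simp_rw [h2]
  rw [← Finset.mul_sum, mul_left_comm, h1]
  split_ifs <;> simp

/-- The finite set underlying `freqBox`. -/
def boxFinset (P : Fin D → ℕ) : Finset (Fin D → ℤ) :=
  (Fintype.piFinset fun d => Finset.Icc (-(P d : ℤ)) (P d)).filter fun ω =>
    ∀ d, -(P d : ℤ) < 2 * ω d ∧ 2 * ω d ≤ (P d : ℤ)

lemma mem_boxFinset {ω : Fin D → ℤ} : ω ∈ boxFinset P ↔ ω ∈ freqBox P := by
  rw [boxFinset, Finset.mem_filter, freqBox, Set.mem_ofPred_eq, and_iff_right_iff_imp]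
  intro h
  refine Fintype.mem_piFinset.2 fun d => Finset.mem_Icc.2 ?_
  have := h d
  omega

lemma bandBox_subset (hP : IsModuli M P) : bandBox D M ⊆ boxFinset P := by
  intro ω hω
  rw [mem_boxFinset]
  intro d
  have h1 := (Finset.mem_filter.1 hω).2 d
  have h2 := hP.2 d
  have hD : 1 ≤ D := Fin.pos d
  have h3 : M ≤ M * D := Nat.le_mul_of_pos_right _ hD
  have h4 := neg_abs_le (ω d)
  have h5 := le_abs_self (ω d)
  omega

lemma crtMap_eq_lineFreq (hP : IsModuli M P) {ω : Fin D → ℤ} (hω : ω ∈ bandBox D M) :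
    crtMap P ω = lineFreq P ω :=
  (crtMap_eq_iff hP (mem_freqRange_iff.2 (lineFreq_bounds hP (Finset.mem_filter.1 hω).2))).2
    (by simp)

/-- The Fourier coefficients of `f`, indexed by the frequencies of `f_new`. -/
def lineHat (P : Fin D → ℕ) (f : (Fin D → ℝ) → ℂ) (ν : ℤ) : ℂ :=
  fhat f (Function.invFunOn (crtMap P) (freqBox P) ν)

lemma lineHat_crtMap (hP : IsModuli M P) {ω : Fin D → ℤ} (hω : ω ∈ freqBox P) :
    lineHat P f (crtMap P ω) = fhat f ω := by
  rw [lineHat, (crtMap_bijOn hP).injOn.leftInvOn_invFunOn hω]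

lemma sum_freqRange {β : Type} [AddCommMonoid β] (hP : IsModuli M P) (φ : ℤ → β) :
    ∑ ν ∈ freqRange (bigN P), φ ν = ∑ ω ∈ boxFinset P, φ (crtMap P ω) := by
  have hb := crtMap_bijOn hP
  refine (Finset.sum_nbij (crtMap P) (fun ω _ => crtMap_mem hP ω) ?_ ?_ fun _ _ => rfl).symm
  · exact hb.injOn.mono fun ω hω => mem_boxFinset.1 hω
  · intro ν hν
    obtain ⟨ω, hω, rfl⟩ := hb.surjOn hν
    exact ⟨ω, mem_boxFinset.2 hω, rfl⟩

/-- Orthogonality of roots of unity gives a sum over the band in `ℤ^D`. Under the bijection it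
becomes the alias sum over the whole one-dimensional range, the additional frequencies having
coefficient zero. -/
lemma isTable_fastMultiply (hP : IsModuli M P) (hf : IsBandlimited M f) {ns : List ℕ}
    (hns : ∀ n ∈ ns, 0 < n) :
    IsTable (bigN P) (lineHat P f) ns (fastMultiply ns (fnew P f)) := by
  intro n hn h _
  rw [fastMultiply, if_pos hn, sampleDFT_fnew hP hf (hns n hn), aliasSum, Finset.sum_filter,
    Finset.sum_filter, sum_freqRange hP]
  refine Finset.sum_subset_zero_on_sdiff (bandBox_subset hP) (fun ω hω => ?_) fun ω hω => ?_
  · rw [Finset.mem_sdiff, mem_boxFinset] at hω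
    rw [lineHat_crtMap hP hω.1, hf.fhat_eq_zero hω.2, ite_self]
  -- The detour through `lineFreq` rewrites the divisibility conditions on both sides in terms of
  -- `crtMap`.
  · rw [crtMap_eq_lineFreq hP hω, ← crtMap_eq_lineFreq hP hω,
      lineHat_crtMap hP (mem_boxFinset.1 (bandBox_subset hP hω))]

/-! ## From one to `D` dimensions -/

lemma fhat_eq_zero_of_notMem (hP : IsModuli M P) (hf : IsBandlimited M f) {ω : Fin D → ℤ}
    (h : ω ∉ boxFinset P) : fhat f ω = 0 :=
  hf.fhat_eq_zero fun hω => h (bandBox_subset hP hω)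

open Classical in
/-- The image of a set of frequencies of `f` under the Chinese remainder map. -/
def lineSet (P : Fin D → ℕ) (S : Finset (Fin D → ℤ)) : Finset ℤ :=
  (S.filter fun ω => ω ∈ freqBox P).image (crtMap P)

lemma lineSet_subset (hP : IsModuli M P) (S : Finset (Fin D → ℤ)) :
    lineSet P S ⊆ freqRange (bigN P) := by
  classical
  intro ν hν
  obtain ⟨ω, -, rfl⟩ := Finset.mem_image.1 hν
  exact crtMap_mem hP ω

lemma card_lineSet_le (S : Finset (Fin D → ℤ)) : (lineSet P S).card ≤ S.card := by
  classical
  exact Finset.card_image_le.trans (Finset.card_filter_le _ _)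

lemma crtMap_mem_lineSet (hP : IsModuli M P) {S : Finset (Fin D → ℤ)} {ω : Fin D → ℤ}
    (hω : ω ∈ freqBox P) : crtMap P ω ∈ lineSet P S ↔ ω ∈ S := by
  classical
  constructor
  · intro h
    obtain ⟨ω', hω', he⟩ := Finset.mem_image.1 h
    rw [Finset.mem_filter] at hω'
    rw [← (crtMap_bijOn hP).injOn hω'.2 hω he]
    exact hω'.1
  · exact fun h => Finset.mem_image_of_mem _ (Finset.mem_filter.2 ⟨h, hω⟩)

/-- A general `φ` covers the `l¹` and the `l²` tails together. Elements of `S` outside the box carry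
the coefficient zero, so `lineSet` may forget them. -/
lemma tsum_sub_indicator (hP : IsModuli M P) (hf : IsBandlimited M f) (S : Finset (Fin D → ℤ))
    (φ : ℂ → ℝ) (hφ : φ 0 = 0) :
    ∑' ω, φ ((fhat f - Set.indicator (S : Set (Fin D → ℤ)) (fhat f)) ω) =
      ∑ ν ∈ freqRange (bigN P) \ lineSet P S, φ (lineHat P f ν) := by
  classical
  rw [tsum_eq_sum (s := boxFinset P) fun ω hω => by
    rw [Pi.sub_apply, Set.indicator_apply, fhat_eq_zero_of_notMem hP hf hω]
    simp [hφ]]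
  rw [← Finset.filter_notMem_eq_sdiff, Finset.sum_filter, sum_freqRange hP]
  refine Finset.sum_congr rfl fun ω hω => ?_
  rw [mem_boxFinset] at hω
  rw [lineHat_crtMap hP hω, Pi.sub_apply, Set.indicator_apply]
  by_cases h : ω ∈ S
  · simp [(crtMap_mem_lineSet hP hω).2 h, h, hφ]
  · simp [(crtMap_mem_lineSet hP hω).not.2 h, h]

lemma l2norm_sub_pullback (hP : IsModuli M P) (hf : IsBandlimited M f) (out : List (ℤ × ℂ)) :
    l2norm (fhat f - pullback P out) =
      Real.sqrt (∑ ν ∈ freqRange (bigN P), ‖lineHat P f ν - vecOf out ν‖ ^ 2) := by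
  rw [l2norm, tsum_eq_sum (s := boxFinset P) fun ω hω => by
    rw [Pi.sub_apply, pullback, Set.indicator_of_notMem (by rwa [← mem_boxFinset]),
      fhat_eq_zero_of_notMem hP hf hω]
    simp]
  rw [sum_freqRange hP]
  congr 1
  refine Finset.sum_congr rfl fun ω hω => ?_
  rw [mem_boxFinset] at hω
  rw [lineHat_crtMap hP hω, Pi.sub_apply, pullback, Set.indicator_of_mem hω]

/-- `T` carries most of the mass of `x` among the sets of at most `κ` frequencies. -/
structure IsBestSet (N : ℕ) (x : ℤ → ℂ) (κ : ℕ) (T : Finset ℤ) : Prop where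
  subset : T ⊆ freqRange N
  card_le : T.card ≤ κ
  best : ∀ T' ⊆ freqRange N, T'.card ≤ κ →
    ∑ ν ∈ freqRange N \ T, ‖x ν‖ ≤ ∑ ν ∈ freqRange N \ T', ‖x ν‖

/-- Allowing fewer than `κ` elements ensures existence even if the range is smaller than `κ`. -/
lemma exists_isBestSet (N : ℕ) (x : ℤ → ℂ) (κ : ℕ) : ∃ T, IsBestSet N x κ T := by
  obtain ⟨T, hT, hmin⟩ := Finset.exists_min_image
    ((freqRange N).powerset.filter fun T => T.card ≤ κ)
    (fun T => ∑ ν ∈ freqRange N \ T, ‖x ν‖) ⟨∅, by simp⟩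
  rw [Finset.mem_filter, Finset.mem_powerset] at hT
  exact ⟨T, hT.1, hT.2, fun T' h1 h2 =>
    hmin T' (Finset.mem_filter.2 ⟨Finset.mem_powerset.2 h1, h2⟩)⟩

/-- The mean noise level outside of the set `T`. -/
def tailLevel (N : ℕ) (x : ℤ → ℂ) (κ : ℕ) (T : Finset ℤ) : ℝ :=
  (∑ ν ∈ freqRange N \ T, ‖x ν‖) / κ

lemma tailLevel_nonneg (N : ℕ) (x : ℤ → ℂ) (κ : ℕ) (T : Finset ℤ) : 0 ≤ tailLevel N x κ T :=
  div_nonneg (Finset.sum_nonneg fun _ _ => norm_nonneg _) (Nat.cast_nonneg _)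

lemma tail_le {N : ℕ} {x : ℤ → ℂ} {κ : ℕ} (hκ : 0 < κ) (T : Finset ℤ) :
    ∑ ν ∈ freqRange N \ T, ‖x ν‖ ≤ κ * tailLevel N x κ T := by
  have : (0 : ℝ) < κ := by exact_mod_cast hκ
  rw [tailLevel, mul_div_cancel₀ _ this.ne']

/-- With `δ` equal to the tail mass over `k * e`, the term `22 δ √k` is `22 (1 / e)` times the tail
mass over `√k`. Minimality of `T₀` compares its tail with that of any optimal support, whatever the
choice of ties. -/
lemma instanceOptimal_of_isGoodOutput (hP : IsModuli M P) (hf : IsBandlimited M f) {k e : ℕ}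
    (hk : 0 < k) (he : 0 < e) {T₀ : Finset ℤ}
    (hT₀ : IsBestSet (bigN P) (lineHat P f) (k * e) T₀) {out : List (ℤ × ℂ)}
    (hout : IsGoodOutput (bigN P) k (lineHat P f)
      (tailLevel (bigN P) (lineHat P f) (k * e) T₀) out) :
    InstanceOptimal k e (fhat f) (pullback P out) := by
  intro S T hS hT
  have h1 := error_le_of_isGoodOutput (tailLevel_nonneg _ _ _ _) hout (lineSet_subset hP S)
    ((card_lineSet_le S).trans hS.1.le)
  have h2 : l2norm (fhat f - Set.indicator (S : Set (Fin D → ℤ)) (fhat f)) =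
      Real.sqrt (∑ ν ∈ freqRange (bigN P) \ lineSet P S, ‖lineHat P f ν‖ ^ 2) := by
    rw [l2norm, tsum_sub_indicator hP hf S (fun z => ‖z‖ ^ 2) (by simp)]
  have h3 : l1norm (fhat f - Set.indicator (T : Set (Fin D → ℤ)) (fhat f)) =
      ∑ ν ∈ freqRange (bigN P) \ lineSet P T, ‖lineHat P f ν‖ := by
    rw [l1norm, tsum_sub_indicator hP hf T (fun z => ‖z‖) (by simp)]
  have h4 := hT₀.best (lineSet P T) (lineSet_subset hP T) ((card_lineSet_le T).trans hT.1.le)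
  rw [l2norm_sub_pullback hP hf, h2, h3]
  refine h1.trans (add_le_add_right ?_ _)
  have hk' : (0 : ℝ) < k := by exact_mod_cast hk
  have he' : (0 : ℝ) < e := by exact_mod_cast he
  rw [le_div_iff₀ (Real.sqrt_pos.2 hk'), mul_assoc, Real.mul_self_sqrt hk'.le, tailLevel]
  push_cast
  have h5 : 22 * ((∑ ν ∈ freqRange (bigN P) \ T₀, ‖lineHat P f ν‖) / (k * e : ℝ)) * k =
      22 * (1 / e) * ∑ ν ∈ freqRange (bigN P) \ T₀, ‖lineHat P f ν‖ := by
    field_simp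
  rw [h5]
  gcongr

end Transfer

/-! ## Error bounds of the two algorithms -/

/-- Zero is coprime only to 1, and all `s_j` are at least 2. -/
lemma IsIdModuli.pos {N : ℕ} {s t : List ℕ} {κ c : ℕ} (h : IsIdModuli N s t)
    (hs : IsRowModuli N κ c s) : ∀ a ∈ t, 0 < a := by
  intro a ha
  have hc := (List.pairwise_append.1 h.coprime).2.2 a ha
  obtain ⟨b, hb⟩ := List.exists_mem_of_ne_nil _ hs.ne_nil
  have h1 := hc b hb
  rcases Nat.eq_zero_or_pos a with rfl | h0
  · have h2 := hs.head_le b hb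
    have h3 := hs.two_le
    rw [Nat.coprime_zero_left] at h1
    omega
  · exact h0

lemma sizes_pos {rows : List (ℕ × ℕ)} {t : List ℕ} (hr : ∀ r ∈ rows, 0 < r.1)
    (ht : ∀ a ∈ t, 0 < a) : ∀ n ∈ sizes rows t, 0 < n := by
  intro n hn
  obtain ⟨r, hrr, hn⟩ := List.mem_flatMap.1 hn
  obtain ⟨a, ha, rfl⟩ := List.mem_map.1 hn
  refine Nat.mul_pos ?_ (hr r hrr)
  rcases List.mem_cons.1 ha with rfl | ha
  · exact one_pos
  · exact ht a ha

section Error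
variable {D M k e c : ℕ} {P : Fin D → ℕ} {s t : List ℕ} {f : (Fin D → ℝ) → ℂ}

lemma fourierApprox1_good (hP : IsModuli M P) (hf : IsBandlimited M f) {κ : ℕ}
    (hs : IsRowModuli (bigN P) κ c s) {rows : List (ℕ × ℕ)} (hrs : ∀ r ∈ rows, r.1 ∈ s) {δ : ℝ}
    (hgood : MostlyGood (bigN P) rows (lineHat P f) δ) :
    IsGoodOutput (bigN P) k (lineHat P f) δ (fourierApprox1 (bigN P) k rows (fnew P f)).val := by
  have hr : ∀ r ∈ rows, 0 < r.1 := fun r hr => hs.pos _ (hrs r hr)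
  exact approx1T_good (isTable_fastMultiply hP hf (sizes_pos hr (by simp))) hr hgood

lemma fourierApprox2_good (hP : IsModuli M P) (hf : IsBandlimited M f) {κ : ℕ}
    (hs : IsRowModuli (bigN P) κ c s) (ht : IsIdModuli (bigN P) s t) {rows : List (ℕ × ℕ)}
    (hrs : ∀ r ∈ rows, r.1 ∈ s) {δ : ℝ}
    (hgood : MostlyGood (bigN P) rows (lineHat P f) δ) :
    IsGoodOutput (bigN P) k (lineHat P f) δ
      (fourierApprox2 (bigN P) k rows t (fnew P f)).val := by
  have hr : ∀ r ∈ rows, 0 < r.1 := fun r hr => hs.pos _ (hrs r hr)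
  have ht0 := ht.pos hs
  obtain ⟨h1, -, h2⟩ := List.pairwise_append.1 ht.coprime
  refine approx2T_good (isTable_fastMultiply hP hf (sizes_pos hr ht0)) hr ht0 (fun r hrr => ?_)
    (fun r hrr a ha => (h2 a ha _ (hrs r hrr)).symm) h1 hgood
  exact ht.prod_ge.trans (Nat.mul_le_mul_left _ (hs.head_le _ (hrs r hrr)))

lemma mem_detRows {r : ℕ × ℕ} (h : r ∈ detRows s) : r.1 ∈ s ∧ r.2 = 1 := by
  obtain ⟨a, ha, rfl⟩ := List.mem_map.1 h
  exact ⟨ha, rfl⟩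

theorem fourierApprox1_det_error (hP : IsModuli M P) (hk : 2 ≤ k) (he : 2 ≤ e)
    (hs : IsRowModuli (bigN P) (k * e) 4 s) (hf : IsBandlimited M f) :
    InstanceOptimal k e (fhat f) (pullback P
      (fourierApprox1 (bigN P) k (detRows s) (fnew P f)).val) := by
  obtain ⟨T, hT⟩ := exists_isBestSet (bigN P) (lineHat P f) (k * e)
  refine instanceOptimal_of_isGoodOutput hP hf (by omega) (by omega) hT
    (fourierApprox1_good hP hf hs (fun r hr => (mem_detRows hr).1) ?_)
  exact detRows_mostlyGood hs _ (tailLevel_nonneg _ _ _ _) hT.subset hT.card_le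
    (tail_le (Nat.mul_pos (by omega) (by omega)) T)

theorem fourierApprox2_det_error (hP : IsModuli M P) (hk : 2 ≤ k) (he : 2 ≤ e)
    (hs : IsRowModuli (bigN P) (k * e) 4 s) (ht : IsIdModuli (bigN P) s t)
    (hf : IsBandlimited M f) :
    InstanceOptimal k e (fhat f) (pullback P
      (fourierApprox2 (bigN P) k (detRows s) t (fnew P f)).val) := by
  obtain ⟨T, hT⟩ := exists_isBestSet (bigN P) (lineHat P f) (k * e)
  refine instanceOptimal_of_isGoodOutput hP hf (by omega) (by omega) hT
    (fourierApprox2_good hP hf hs ht (fun r hr => (mem_detRows hr).1) ?_)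
  exact detRows_mostlyGood hs _ (tailLevel_nonneg _ _ _ _) hT.subset hT.card_le
    (tail_le (Nat.mul_pos (by omega) (by omega)) T)

theorem fourierApprox1_random_error (hP : IsModuli M P) (hk : 2 ≤ k) (he : 2 ≤ e)
    {σ : ℝ} (hσ : σ < 1)
    (hs : IsRowModuli (bigN P) (k * e) 14 s) (hf : IsBandlimited M f) :
    ENNReal.ofReal σ ≤ drawLaw s.length (numDraws (bigN P) σ)
      {τ | InstanceOptimal k e (fhat f) (pullback P
        (fourierApprox1 (bigN P) k (drawnRows s τ) (fnew P f)).val)} := by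
  obtain ⟨T, hT⟩ := exists_isBestSet (bigN P) (lineHat P f) (k * e)
  refine (drawnRows_mostlyGood hP.bigN_pos hs hσ (lineHat P f) (tailLevel_nonneg _ _ _ _) hT.subset
    hT.card_le (tail_le (Nat.mul_pos (by omega) (by omega)) T)).trans
    (MeasureTheory.measure_mono fun τ hτ => ?_)
  exact instanceOptimal_of_isGoodOutput hP hf (by omega) (by omega) hT
    (fourierApprox1_good hP hf hs (fun r hr => (mem_drawnRows hr).1) hτ)

theorem fourierApprox2_random_error (hP : IsModuli M P) (hk : 2 ≤ k) (he : 2 ≤ e)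
    {σ : ℝ} (hσ : σ < 1)
    (hs : IsRowModuli (bigN P) (k * e) 14 s) (ht : IsIdModuli (bigN P) s t)
    (hf : IsBandlimited M f) :
    ENNReal.ofReal σ ≤ drawLaw s.length (numDraws (bigN P) σ)
      {τ | InstanceOptimal k e (fhat f) (pullback P
        (fourierApprox2 (bigN P) k (drawnRows s τ) t (fnew P f)).val)} := by
  obtain ⟨T, hT⟩ := exists_isBestSet (bigN P) (lineHat P f) (k * e)
  refine (drawnRows_mostlyGood hP.bigN_pos hs hσ (lineHat P f) (tailLevel_nonneg _ _ _ _) hT.subset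
    hT.card_le (tail_le (Nat.mul_pos (by omega) (by omega)) T)).trans
    (MeasureTheory.measure_mono fun τ hτ => ?_)
  exact instanceOptimal_of_isGoodOutput hP hf (by omega) (by omega) hT
    (fourierApprox2_good hP hf hs ht (fun r hr => (mem_drawnRows hr).1) hτ)

end Error

/-! ## Primes in intervals -/

/-- Writing `n = w ^ 4` and using `log w ≤ w`, the Chebyshev bound becomes `w ^ 4 * log 2` minus
terms of order `w ^ 3`; `w ≥ 31` keeps these small enough. -/
lemma quarter_le_theta {n : ℕ} (hn : 10 ^ 6 ≤ n) : (n : ℝ) / 4 ≤ Chebyshev.theta n := by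
  refine le_trans ?_ (Chebyshev.theta_ge n)
  have hnr : (10 ^ 6 : ℝ) ≤ n := by exact_mod_cast hn
  have hn0 : (0 : ℝ) < n := by linarith
  set u := Real.sqrt n with hu
  set w := Real.sqrt u with hw
  have hu2 : u ^ 2 = n := Real.sq_sqrt hn0.le
  have hw2 : w ^ 2 = u := Real.sq_sqrt (Real.sqrt_nonneg _)
  have hu1 : 1000 ≤ u := Real.le_sqrt_of_sq_le (by linarith)
  have hw1 : 31 ≤ w := Real.le_sqrt_of_sq_le (by linarith)
  have hw0 : 0 < w := by linarith
  have hn4 : (n : ℝ) = w ^ 4 := by rw [← hu2, ← hw2]; ring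
  have hlw : Real.log w ≤ w := (Real.log_le_sub_one_of_pos hw0).trans (by linarith)
  have hln : Real.log n = 4 * Real.log w := by
    rw [hn4, Real.log_pow]
    norm_num
  have hl1 : Real.log ((n : ℝ) + 1) ≤ 1 + 4 * w := by
    have h1 : Real.log ((n : ℝ) + 1) ≤ Real.log (2 * n) :=
      Real.log_le_log (by linarith) (by linarith)
    rw [Real.log_mul (by norm_num) hn0.ne', hln] at h1
    have := Real.log_two_lt_d9
    linarith
  have hl2 := Real.log_two_gt_d9
  rw [hln, ← hw2, hn4] at *
  have h3 : 2 * w ^ 2 * (4 * Real.log w) ≤ 8 * w ^ 3 := by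
    have := mul_le_mul_of_nonneg_left hlw (sq_nonneg w)
    nlinarith
  have h4 : w ^ 4 * 0.69 ≤ w ^ 4 * Real.log 2 :=
    mul_le_mul_of_nonneg_left (by linarith) (by positivity)
  have h5 : 31 * w ^ 3 ≤ w ^ 4 := by nlinarith [pow_pos hw0 3]
  have h6 : 31 * w ≤ w ^ 3 := by nlinarith
  linarith

/-- `θ(X) - θ(z) ≥ X / 4 - 1.4 z`, which for `12 z ≤ X` exceeds `X / 8`; each prime of the interval
contributes at most `log X` to it. -/
lemma card_primes_Ioc {z X K : ℕ} (hX : 10 ^ 6 ≤ X) (hz : 12 * z ≤ X)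
    (hK : (K : ℝ) * (8 * Real.log X) ≤ X) : K ≤ ((Finset.Ioc z X).filter Nat.Prime).card := by
  have hXr : (10 ^ 6 : ℝ) ≤ X := by exact_mod_cast hX
  have hlog : 0 < Real.log X := Real.log_pos (by linarith)
  have h1 := quarter_le_theta hX
  have h2 := Chebyshev.theta_le_log4_mul_x (Nat.cast_nonneg (α := ℝ) z)
  have h3 : Chebyshev.theta X = Chebyshev.theta z +
      ∑ p ∈ (Finset.Ioc z X).filter Nat.Prime, Real.log p := by
    rw [Chebyshev.theta, Chebyshev.theta, Nat.floor_natCast, Nat.floor_natCast,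
      ← Finset.sum_union]
    · congr 1
      rw [← Finset.filter_union, Finset.Ioc_union_Ioc_eq_Ioc (Nat.zero_le _) (by omega)]
    · refine Finset.disjoint_filter_filter ?_
      exact Finset.Ioc_disjoint_Ioc_of_le le_rfl
  have h4 : ∑ p ∈ (Finset.Ioc z X).filter Nat.Prime, Real.log p ≤
      ((Finset.Ioc z X).filter Nat.Prime).card * Real.log X := by
    rw [← nsmul_eq_mul]
    refine Finset.sum_le_card_nsmul _ _ _ fun p hp => ?_
    rw [Finset.mem_filter, Finset.mem_Ioc] at hp
    exact Real.log_le_log (by exact_mod_cast hp.2.pos) (by exact_mod_cast hp.1.2)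
  have h5 : Real.log 4 ≤ 1.4 := by
    have : Real.log 4 = 2 * Real.log 2 := by
      rw [← Real.log_rpow (by norm_num)]
      norm_num
    have := Real.log_two_lt_d9
    linarith
  have h6 : (12 : ℝ) * z ≤ X := by exact_mod_cast hz
  have h7 : Real.log 4 * z ≤ 1.4 * z := mul_le_mul_of_nonneg_right h5 (Nat.cast_nonneg _)
  have h8 : (K : ℝ) * Real.log X ≤
      ((Finset.Ioc z X).filter Nat.Prime).card * Real.log X := by linarith
  exact_mod_cast le_of_mul_le_mul_right h8 hlog

lemma exists_primes_list {z X K : ℕ} (hX : 10 ^ 6 ≤ X) (hz : 12 * z ≤ X)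
    (hK : (K : ℝ) * (8 * Real.log X) ≤ X) :
    ∃ l : List ℕ, l.length = K ∧ l.Pairwise (· < ·) ∧ ∀ p ∈ l, p.Prime ∧ z < p ∧ p ≤ X := by
  have h := card_primes_Ioc hX hz hK
  set F := (Finset.Ioc z X).filter Nat.Prime with hF
  refine ⟨(F.sort (· ≤ ·)).take K, ?_, ?_, ?_⟩
  · rw [List.length_take, Finset.length_sort]
    omega
  · exact (F.sortedLT_sort).pairwise.sublist (List.take_sublist _ _)
  · intro p hp
    have := (Finset.mem_sort _).1 (List.mem_of_mem_take hp)
    rw [hF, Finset.mem_filter, Finset.mem_Ioc] at this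
    exact ⟨this.2, this.1⟩

lemma pairwise_coprime_of_primes {l : List ℕ} (h : l.Pairwise (· < ·))
    (hp : ∀ p ∈ l, p.Prime) : l.Pairwise Nat.Coprime :=
  h.imp_of_mem fun ha hb hab => (Nat.coprime_primes (hp _ ha) (hp _ hb)).2 hab.ne

/-! ## Moduli for the reduction to one dimension -/

/-- The moduli are `D` primes in `(m, m ^ 20]`. The exponent puts the upper end above the threshold
`10 ^ 6` already for `m = 2`. -/
lemma exists_moduli_pow {D M : ℕ} (h : 2 ≤ M * D) :
    ∃ P : Fin D → ℕ, IsModuli M P ∧ bigN P ≤ (M * D) ^ (20 * D) := by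
  set m := M * D with hm
  have hM : 1 ≤ M := by
    rcases Nat.eq_zero_or_pos M with rfl | h0
    · simp at hm
      omega
    · exact h0
  have hD : D ≤ m := Nat.le_mul_of_pos_left D hM
  have hX : 10 ^ 6 ≤ m ^ 20 := (by norm_num : 10 ^ 6 ≤ 2 ^ 20).trans (Nat.pow_le_pow_left h 20)
  have hmr : (2 : ℝ) ≤ m := by exact_mod_cast h
  have e1 : (2 : ℕ) ^ 18 * m ^ 2 ≤ m ^ 20 := by
    have : m ^ 20 = m ^ 18 * m ^ 2 := by ring
    rw [this]
    exact Nat.mul_le_mul_right _ (Nat.pow_le_pow_left h 18)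
  obtain ⟨l, hl, hlt, hlp⟩ := exists_primes_list (z := m) (K := D) hX (by nlinarith) (by
    have h1 : Real.log ((m ^ 20 : ℕ) : ℝ) ≤ 20 * m := by
      push_cast
      rw [Real.log_pow]
      have := Real.log_le_sub_one_of_pos (show (0 : ℝ) < m by linarith)
      push_cast
      linarith
    have h2 : (D : ℝ) ≤ m := by exact_mod_cast hD
    have h3 : (2 : ℝ) ^ 18 * m ^ 2 ≤ ((m ^ 20 : ℕ) : ℝ) := by exact_mod_cast e1
    have h4 : (D : ℝ) * (8 * Real.log ((m ^ 20 : ℕ) : ℝ)) ≤ m * (8 * (20 * m)) := by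
      have : 0 ≤ Real.log ((m ^ 20 : ℕ) : ℝ) := Real.log_natCast_nonneg _
      gcongr
    nlinarith)
  subst hl
  refine ⟨l.get, ⟨fun i j hij => ?_, fun d => (hlp _ (List.get_mem _ _)).2.1⟩, ?_⟩
  · refine (Nat.coprime_primes (hlp _ (List.get_mem _ _)).1 (hlp _ (List.get_mem _ _)).1).2 ?_
    exact fun he => hij ((List.nodup_iff_injective_get.1 (hlt.imp fun h => h.ne)) he)
  · refine (Finset.prod_le_pow_card _ _ (m ^ 20) fun d _ => (hlp _ (List.get_mem _ _)).2.2).trans ?_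
    rw [Finset.card_univ, Fintype.card_fin, pow_mul]

/-- A common prime factor divides `(j - i) * L`, hence `L`, hence 1. -/
lemma coprime_one_add_mul {i j L : ℕ} (h : j - i ∣ L) :
    Nat.Coprime (1 + i * L) (1 + j * L) := by
  refine Nat.Coprime.symm (Nat.coprime_of_dvd fun q hq h1 h2 => ?_)
  have h3 : q ∣ (j - i) * L := by
    have := (Nat.dvd_sub h1 h2)
    rwa [Nat.add_sub_add_left, ← Nat.sub_mul] at this
  have h4 : q ∣ L := by
    rcases hq.dvd_mul.1 h3 with h | h'
    · exact h.trans ‹_›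
    · exact h'
  have h5 : q ∣ 1 := (Nat.dvd_add_left (h4.mul_left i)).1 h2
  exact hq.one_lt.ne' (Nat.dvd_one.1 h5)

/-- The moduli `1 + (d + 1) * D! * m` of Gödel's β function: index differences divide `D!`, which
makes them coprime, and each is within a factor depending on `D` of `m`. -/
lemma exists_moduli_fixed_dim (D : ℕ) : ∃ B : ℕ, ∀ M : ℕ, 2 ≤ M * D →
    ∃ P : Fin D → ℕ, IsModuli M P ∧ (M * D) ^ D ≤ bigN P ∧ bigN P ≤ B * (M * D) ^ D := by
  refine ⟨(1 + D * D.factorial) ^ D, fun M h => ?_⟩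
  set m := M * D with hm
  have hlt : ∀ d : Fin D, m < 1 + (d + 1) * (D.factorial * m) := by
    intro d
    have h1 : 1 ≤ D.factorial := Nat.factorial_pos D
    have h2 : 1 * (1 * m) ≤ (d + 1) * (D.factorial * m) :=
      Nat.mul_le_mul (by omega) (Nat.mul_le_mul_right _ h1)
    omega
  have hcop : ∀ i j : Fin D, i < j → Nat.Coprime (1 + ((i : ℕ) + 1) * (D.factorial * m))
      (1 + ((j : ℕ) + 1) * (D.factorial * m)) := by
    intro i j hij
    have hij' : (i : ℕ) < j := hij
    refine coprime_one_add_mul ?_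
    exact (Nat.dvd_factorial (by omega) (by have := j.2; omega)).mul_right m
  refine ⟨fun d => 1 + (d + 1) * (D.factorial * m), ⟨fun i j hij => ?_, hlt⟩, ?_, ?_⟩
  · rcases lt_or_gt_of_ne hij with h | h
    · exact hcop i j h
    · exact (hcop j i h).symm
  · have := Finset.pow_card_le_prod Finset.univ
      (fun d : Fin D => 1 + ((d : ℕ) + 1) * (D.factorial * m)) m fun d _ => (hlt d).le
    rwa [Finset.card_univ, Fintype.card_fin] at this
  · rw [← mul_pow]
    have := Finset.prod_le_pow_card Finset.univ
      (fun d : Fin D => 1 + ((d : ℕ) + 1) * (D.factorial * m)) ((1 + D * D.factorial) * m)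
      fun d _ => by
        have h1 : ((d : ℕ) + 1) * (D.factorial * m) ≤ D * (D.factorial * m) :=
          Nat.mul_le_mul_right _ d.2
        have h2 : (1 + D * D.factorial) * m = m + D * (D.factorial * m) := by ring
        omega
    rwa [Finset.card_univ, Fintype.card_fin] at this

/-! ## Row and identification moduli -/

/-- The first modulus is prescribed, because it determines the number of rows; the others are primes
in `(b, X]`. -/
lemma exists_rowModuli {N κ c b X : ℕ} (hb : b.Prime) (hX : 10 ^ 6 ≤ X) (hbX : 12 * b ≤ X)
    (hK : ((c * κ * Nat.log b N : ℕ) : ℝ) * (8 * Real.log X) ≤ X) :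
    ∃ s : List ℕ, IsRowModuli N κ c s ∧ s.headD 0 = b ∧ ∀ a ∈ s, a.Prime ∧ b ≤ a ∧ a ≤ X := by
  obtain ⟨l, hl, hlt, hlp⟩ := exists_primes_list hX hbX hK
  have hp : ∀ a ∈ b :: l, a.Prime ∧ b ≤ a ∧ a ≤ X := by
    intro a ha
    rcases List.mem_cons.1 ha with rfl | ha
    · exact ⟨hb, le_rfl, by omega⟩
    · exact ⟨(hlp a ha).1, (hlp a ha).2.1.le, (hlp a ha).2.2⟩
  have hinc : (b :: l).Pairwise (· < ·) :=
    List.pairwise_cons.2 ⟨fun a ha => (hlp a ha).2.1, hlt⟩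
  refine ⟨b :: l, ⟨hb.two_le, hinc, ?_, ?_⟩, rfl, hp⟩
  · exact pairwise_coprime_of_primes hinc fun a ha => (hp a ha).1
  · rw [List.length_cons, hl]
    rfl

/-- All primes up to `y` are taken: their product is `exp (θ y) ≥ exp (y / 4)`, far above `2 ^ (y /
10 ^ 6)`, and there are at most `y` of them. -/
lemma exists_idModuli {N y : ℕ} (hN : 0 < N) (hy : 10 ^ 6 ≤ y) (hNy : N ≤ 2 ^ (y / 10 ^ 6)) :
    ∃ t : List ℕ, t.Pairwise (· < ·) ∧ (∀ a ∈ t, a.Prime ∧ a ≤ y) ∧ N ≤ t.prod ∧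
      t.sum ≤ y ^ 2 := by
  set F := (Finset.Ioc 0 y).filter Nat.Prime with hF
  have hprod : (F.sort (· ≤ ·)).prod = primorial y := by
    have h1 : (F.sort (· ≤ ·)).prod = ∏ p ∈ F, p := by
      conv_rhs => rw [← Finset.sort_toFinset F (· ≤ ·)]
      rw [List.prod_toFinset _ (Finset.sort_nodup _ _), List.map_id']
    rw [h1, primorial]
    refine Finset.prod_congr ?_ fun _ _ => rfl
    ext p
    simp only [hF, Finset.mem_filter, Finset.mem_Ioc, Finset.mem_range]
    constructor
    · rintro ⟨h1, h2⟩
      exact ⟨by omega, h2⟩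
    · rintro ⟨h1, h2⟩
      exact ⟨⟨h2.pos, by omega⟩, h2⟩
  have hmem : ∀ a ∈ F.sort (· ≤ ·), a.Prime ∧ a ≤ y := by
    intro a ha
    have := (Finset.mem_sort _).1 ha
    rw [hF, Finset.mem_filter, Finset.mem_Ioc] at this
    exact ⟨this.2, this.1.2⟩
  refine ⟨F.sort (· ≤ ·), (F.sortedLT_sort).pairwise, hmem, ?_, ?_⟩
  · rw [hprod]
    have h1 := quarter_le_theta hy
    rw [Chebyshev.theta_eq_log_primorial, Nat.floor_natCast] at h1
    have h2 : Real.log N ≤ Real.log (primorial y) := by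
      refine le_trans ?_ h1
      have h3 : Real.log N ≤ Real.log ((2 ^ (y / 10 ^ 6) : ℕ) : ℝ) :=
        Real.log_le_log (by exact_mod_cast hN) (by exact_mod_cast hNy)
      push_cast at h3
      rw [Real.log_pow] at h3
      have h4 : ((y / 10 ^ 6 : ℕ) : ℝ) ≤ y / 10 ^ 6 := by
        have := Nat.cast_div_le (α := ℝ) (m := y) (n := 10 ^ 6)
        norm_num at this ⊢
        exact this
      have h5 := Real.log_two_lt_d9
      have h6 : ((y / 10 ^ 6 : ℕ) : ℝ) * Real.log 2 ≤ ((y / 10 ^ 6 : ℕ) : ℝ) * 1 :=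
        mul_le_mul_of_nonneg_left (by linarith) (Nat.cast_nonneg _)
      have h7 : (0 : ℝ) ≤ y := Nat.cast_nonneg _
      linarith
    have h3 : (N : ℝ) ≤ primorial y :=
      (Real.log_le_log_iff (by exact_mod_cast hN) (by exact_mod_cast primorial_pos y)).1 h2
    exact_mod_cast h3
  · have h1 := List.sum_le_card_nsmul (F.sort (· ≤ ·)) y fun a ha => (hmem a ha).2
    have h2 : F.card ≤ y := (Finset.card_filter_le _ _).trans (by simp)
    rw [Finset.length_sort, smul_eq_mul] at h1
    nlinarith

/-! ## Elementary estimates -/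

lemma clog_le_three_mul_log {n : ℕ} (hn : 2 ≤ n) : (Nat.clog 2 n : ℝ) ≤ 3 * Real.log n := by
  have hnr : (2 : ℝ) ≤ n := by exact_mod_cast hn
  have h1 : 2 ^ (Nat.clog 2 n - 1) < n := Nat.pow_pred_clog_lt_self (by norm_num) (by omega)
  have h2 : ((2 ^ (Nat.clog 2 n - 1) : ℕ) : ℝ) ≤ n := by exact_mod_cast h1.le
  have h3 := Real.log_le_log (by positivity) h2
  push_cast at h3
  rw [Real.log_pow] at h3
  have h4 : 1 ≤ Nat.clog 2 n := Nat.clog_pos (by norm_num) hn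
  push_cast [h4] at h3
  have h5 := Real.log_two_gt_d9
  have h6 := Real.log_le_log (by norm_num) hnr
  have h7 : (1 : ℝ) ≤ Nat.clog 2 n := by exact_mod_cast h4
  nlinarith

lemma natLog_mul_log_le (b : ℕ) {N : ℕ} (hN : N ≠ 0) :
    (Nat.log b N : ℝ) * Real.log b ≤ Real.log N := by
  rcases Nat.eq_zero_or_pos b with rfl | hb
  · simpa using Real.log_natCast_nonneg N
  have h1 : ((b ^ Nat.log b N : ℕ) : ℝ) ≤ N := by exact_mod_cast Nat.pow_log_le_self b hN
  have h2 := Real.log_le_log (by exact_mod_cast pow_pos hb _) h1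
  push_cast at h2
  rwa [Real.log_pow] at h2

lemma log_le_clog (n : ℕ) : Real.log n ≤ Nat.clog 2 n * Real.log 2 := by
  rcases Nat.eq_zero_or_pos n with rfl | hn
  · simp
  have h1 : (n : ℝ) ≤ ((2 ^ Nat.clog 2 n : ℕ) : ℝ) := by
    exact_mod_cast Nat.le_pow_clog (by norm_num) n
  have h2 := Real.log_le_log (by exact_mod_cast hn) h1
  push_cast at h2
  rwa [Real.log_pow] at h2

/-! ## Choice of the moduli -/

/-- Moduli for Fourier Approximate 2. -/
lemma exists_moduli_approx2 {N κ c : ℕ} (hκ : 4 ≤ κ) (hN : κ < N) (hc : c ≤ 14) :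
    ∃ s t : List ℕ, IsRowModuli N κ c s ∧ IsIdModuli N s t ∧
      (∀ a ∈ s, a ≤ 10 ^ 8 * (κ * Nat.clog 2 N)) ∧ t.sum ≤ (10 ^ 6 * Nat.clog 2 N) ^ 2 ∧
      κ ≤ s.headD 0 := by
  set ℓ := Nat.clog 2 N with hℓ
  have hℓ1 : 1 ≤ ℓ := Nat.clog_pos (by norm_num) (by omega)
  set y := 10 ^ 6 * ℓ with hy
  -- Choosing `b > y` makes the `s_j` exceed, and so differ from, all primes used as `t_i`; `b > κ`
  -- makes the number of rows `O(κ log N / log κ)`.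
  obtain ⟨b, hb, hb1, hb2⟩ := Nat.exists_prime_lt_and_le_two_mul (max κ y) (by omega)
  have hbκ : κ < b := (le_max_left _ _).trans_lt hb1
  have hby : y < b := (le_max_right _ _).trans_lt hb1
  set X := 10 ^ 8 * (κ * ℓ) with hX
  have hκℓ : κ ≤ κ * ℓ := Nat.le_mul_of_pos_right _ hℓ1
  have hℓκ : ℓ ≤ κ * ℓ := Nat.le_mul_of_pos_left _ (by omega)
  have hbX : 12 * b ≤ X := by
    have : max κ y ≤ 10 ^ 6 * (κ * ℓ) := max_le (by omega) (by omega)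
    omega
  have hK : ((c * κ * Nat.log b N : ℕ) : ℝ) * (8 * Real.log X) ≤ X := by
    have hbr : (10 ^ 6 : ℝ) ≤ b := by
      have : 10 ^ 6 ≤ b := by omega
      exact_mod_cast this
    have hlb : 0 < Real.log b := Real.log_pos (by linarith)
    -- The factor `log X` in the prime count is thus absorbed by the `1 / log b` in the number of
    -- rows, so `X` of order `κ log N` suffices.
    have h1 : Real.log X ≤ 4 * Real.log b := by
      have h2 : X ≤ b ^ 4 := by
        have e1 : 10 ^ 8 ≤ b ^ 2 := (by norm_num : 10 ^ 8 ≤ (10 ^ 6) ^ 2).trans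
          (Nat.pow_le_pow_left (by omega) 2)
        have e2 : κ * ℓ ≤ b * b := Nat.mul_le_mul hbκ.le (by omega)
        calc X ≤ b ^ 2 * (b * b) := Nat.mul_le_mul e1 e2
          _ = b ^ 4 := by ring
      have h3 := Real.log_le_log (x := (X : ℝ)) (y := ((b ^ 4 : ℕ) : ℝ))
        (by
          have : 0 < X := by omega
          exact_mod_cast this) (by exact_mod_cast h2)
      push_cast at h3
      rw [Real.log_pow] at h3
      exact_mod_cast h3
    have h2 := natLog_mul_log_le b (N := N) (by omega)
    have h3 := log_le_clog N
    rw [← hℓ] at h3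
    have h4 := Real.log_two_lt_d9
    have hℓr : (0 : ℝ) ≤ ℓ := Nat.cast_nonneg _
    have hκr : (0 : ℝ) ≤ κ := Nat.cast_nonneg _
    have h5 : (Nat.log b N : ℝ) * Real.log b ≤ ℓ := by nlinarith
    have hcr : (c : ℝ) ≤ 14 := by exact_mod_cast hc
    have hXr : (X : ℝ) = 10 ^ 8 * (κ * ℓ) := by rw [hX]; push_cast; ring
    rw [hXr] at h1 ⊢
    push_cast
    have hc0 : (0 : ℝ) ≤ c := Nat.cast_nonneg _
    calc (c : ℝ) * κ * Nat.log b N * (8 * Real.log (10 ^ 8 * (κ * ℓ)))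
        ≤ c * κ * Nat.log b N * (8 * (4 * Real.log b)) := by gcongr
      _ = 32 * c * κ * (Nat.log b N * Real.log b) := by ring
      _ ≤ 32 * 14 * κ * ℓ := by gcongr
      _ ≤ 10 ^ 8 * (κ * ℓ) := by nlinarith [mul_nonneg hκr hℓr]
  obtain ⟨s, hs, hsb, hsp⟩ := exists_rowModuli hb (by omega) hbX hK
  obtain ⟨t, ht, htp, htN, htsum⟩ := exists_idModuli (N := N) (y := y) (by omega) (by omega) (by
    rw [hy, Nat.mul_div_cancel_left _ (by norm_num)]
    exact Nat.le_pow_clog (by norm_num) N)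
  refine ⟨s, t, hs, ⟨ht, fun a ha => ?_, ?_, ?_⟩, fun a ha => (hsp a ha).2.2, htsum, ?_⟩
  · rw [hsb]
    exact (htp a ha).2.trans_lt hby
  · rw [hsb]
    exact htN.trans (Nat.le_mul_of_pos_right _ hb.pos)
  · rw [List.pairwise_append]
    refine ⟨pairwise_coprime_of_primes ht fun a ha => (htp a ha).1, hs.coprime, ?_⟩
    intro a ha a' ha'
    refine (Nat.coprime_primes (htp a ha).1 (hsp a' ha').1).2 ?_
    have := (htp a ha).2
    have := (hsp a' ha').2.1
    omega
  · rw [hsb]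
    exact hbκ.le

/-- Row moduli for Fourier Approximate 1. -/
lemma exists_moduli_approx1 {N κ c : ℕ} (hκ : 4 ≤ κ) (hN : κ < N) (hc : c ≤ 14) :
    ∃ s : List ℕ, IsRowModuli N κ c s ∧
      (∀ a ∈ s, a ≤ 10 ^ 9 * (κ * Nat.log κ N * Nat.clog 2 (κ * Nat.log κ N))) ∧
      κ ≤ s.headD 0 := by
  -- No `t_i` are involved here, so `b` only has to exceed `κ`, and `X` can be bounded in terms of
  -- `κ * Nat.log κ N` alone.
  obtain ⟨b, hb, hb1, hb2⟩ := Nat.exists_prime_lt_and_le_two_mul κ (by omega)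
  have hL1 : 1 ≤ Nat.log κ N := Nat.log_pos (by omega) hN.le
  set q := κ * Nat.log κ N with hq
  have hqκ : κ ≤ q := Nat.le_mul_of_pos_right _ hL1
  set r := Nat.clog 2 q with hr
  have hr1 : 1 ≤ r := Nat.clog_pos (by norm_num) (by omega)
  have hqr : q ≤ q * r := Nat.le_mul_of_pos_right _ hr1
  set X := 10 ^ 9 * (q * r) with hX
  have hK : ((c * κ * Nat.log b N : ℕ) : ℝ) * (8 * Real.log X) ≤ X := by
    have hrr : (1 : ℝ) ≤ r := by exact_mod_cast hr1
    have h1 : Real.log X ≤ 32 * r := by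
      have h2 : X ≤ 2 ^ (32 * r) := by
        have e1 : q ≤ 2 ^ r := Nat.le_pow_clog (by norm_num) q
        have e2 : r ≤ 2 ^ r := Nat.lt_two_pow_self.le
        calc X ≤ 2 ^ 30 * (2 ^ r * 2 ^ r) :=
              Nat.mul_le_mul (by norm_num) (Nat.mul_le_mul e1 e2)
          _ = 2 ^ (30 + (r + r)) := by rw [pow_add, pow_add]
          _ ≤ 2 ^ (32 * r) := Nat.pow_le_pow_right (by norm_num) (by omega)
      have h3 := Real.log_le_log (x := (X : ℝ)) (y := ((2 ^ (32 * r) : ℕ) : ℝ))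
        (by
          have : 0 < X := by omega
          exact_mod_cast this) (by exact_mod_cast h2)
      push_cast at h3
      rw [Real.log_pow] at h3
      push_cast at h3
      have h4 := Real.log_two_lt_d9
      nlinarith
    have h2 : (c * κ * Nat.log b N : ℕ) ≤ 14 * q := by
      rw [hq, mul_assoc]
      exact Nat.mul_le_mul hc (Nat.mul_le_mul_left _ (Nat.log_anti_left (by omega) hb1.le))
    have h3 : ((c * κ * Nat.log b N : ℕ) : ℝ) ≤ 14 * q := by exact_mod_cast h2
    have hXr : (X : ℝ) = 10 ^ 9 * (q * r) := by rw [hX]; push_cast; ring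
    have h0 : 0 ≤ Real.log X := Real.log_natCast_nonneg _
    calc ((c * κ * Nat.log b N : ℕ) : ℝ) * (8 * Real.log X) ≤ 14 * q * (8 * (32 * r)) := by gcongr
      _ ≤ X := by
        rw [hXr]
        have : (0 : ℝ) ≤ q * r := by positivity
        nlinarith
  obtain ⟨s, hs, hsb, hsp⟩ := exists_rowModuli hb (by omega) (by omega) hK
  exact ⟨s, hs, fun a ha => (hsp a ha).2.2, hsb ▸ hb1.le⟩

/-- The number of rows is at most `15 κ log N / log κ`. -/
lemma IsRowModuli.length_mul_log_le {N κ c : ℕ} {s : List ℕ} (h : IsRowModuli N κ c s)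
    (hκ : 4 ≤ κ) (hN : κ < N) (hc : c ≤ 14) (hb : κ ≤ s.headD 0) :
    (s.length : ℝ) * Real.log κ ≤ 15 * κ * Real.log N := by
  have hκr : (4 : ℝ) ≤ κ := by exact_mod_cast hκ
  have hlκ : 0 < Real.log κ := Real.log_pos (by linarith)
  have h1 := natLog_mul_log_le (s.headD 0) (N := N) (by omega)
  have h2 : Real.log κ ≤ Real.log (s.headD 0) :=
    Real.log_le_log (by linarith) (by exact_mod_cast hb)
  have h3 : Real.log κ ≤ Real.log N := Real.log_le_log (by linarith) (by exact_mod_cast hN.le)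
  have h4 : (Nat.log (s.headD 0) N : ℝ) * Real.log κ ≤ Real.log N :=
    (mul_le_mul_of_nonneg_left h2 (Nat.cast_nonneg _)).trans h1
  have hcr : (c : ℝ) ≤ 14 := by exact_mod_cast hc
  have hc0 : (0 : ℝ) ≤ c := Nat.cast_nonneg _
  rw [h.length_eq]
  push_cast
  calc ((c : ℝ) * κ * Nat.log (s.headD 0) N + 1) * Real.log κ
      = c * (κ * (Nat.log (s.headD 0) N * Real.log κ)) + Real.log κ := by ring
    _ ≤ 14 * (κ * Real.log N) + 1 * Real.log N := by
        have : 0 ≤ Real.log N := hlκ.le.trans h3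
        gcongr
        linarith
    _ ≤ _ := by nlinarith

lemma IsRowModuli.length_le {N κ c : ℕ} {s : List ℕ} (h : IsRowModuli N κ c s)
    (hκ : 4 ≤ κ) (hN : κ < N) (hc : c ≤ 14) (hb : κ ≤ s.headD 0) :
    s.length ≤ 15 * (κ * Nat.log κ N) := by
  have h1 : Nat.log (s.headD 0) N ≤ Nat.log κ N := Nat.log_anti_left (by omega) hb
  have hL1 : 1 ≤ Nat.log κ N := Nat.log_pos (by omega) hN.le
  have h2 : c * (κ * Nat.log (s.headD 0) N) ≤ 14 * (κ * Nat.log κ N) :=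
    Nat.mul_le_mul hc (Nat.mul_le_mul_left _ h1)
  have h3 : 0 < κ * Nat.log κ N := Nat.mul_pos (by omega) hL1
  rw [h.length_eq, mul_assoc]
  omega

/-! ## Numbers of samples -/

/-- Coinciding points only lower the count, so the sum of the array lengths `s_j (1 + ∑ t_i)` is a
bound. -/
lemma card_evalPoints_le {D : ℕ} (P : Fin D → ℕ) (rows : List (ℕ × ℕ)) (t : List ℕ) {X : ℕ}
    (hX : ∀ r ∈ rows, r.1 ≤ X) :
    (evalPoints P (sizes rows t)).card ≤ rows.length * (X * (t.sum + 1)) := by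
  have h1 : (evalPoints P (sizes rows t)).card ≤ (sizes rows t).sum := by
    refine Finset.card_image_le.trans (Finset.card_biUnion_le.trans ?_)
    refine (Finset.sum_le_sum (g := fun n => n) fun n _ => Finset.card_image_le.trans
      (by simp)).trans ?_
    generalize sizes rows t = l
    induction l with
    | nil => simp
    | cons a l ih =>
      rw [List.toFinset_cons, List.sum_cons]
      by_cases h : a ∈ l.toFinset
      · rw [Finset.insert_eq_of_mem h]
        omega
      · rw [Finset.sum_insert h]
        omega
  refine h1.trans ?_
  rw [sizes, List.flatMap_def, List.sum_flatten, List.map_map]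
  refine sum_map_le _ _ _ fun r hr => ?_
  simp only [Function.comp_apply]
  rw [List.sum_map_mul_right, List.map_id', List.sum_cons, mul_comm, add_comm 1]
  exact Nat.mul_le_mul_right _ (hX r hr)

/-! ## Running times and sample counts for the chosen moduli -/

/-- Largest modulus `O(κ ℓ)`, `∑ t_i = O(ℓ²)` and logarithmic terms `O(ℓ)` multiply to `κ ℓ³ W`. The
weight `W` stays free: it is the number of rows in the deterministic case, the number of draws in
the random one. -/
lemma approx2T_cost_le {D N k κ : ℕ} (P : Fin D → ℕ) (hκ : 4 ≤ κ) (hN : κ < N) (hk : 2 * k ≤ κ)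
    {rows : List (ℕ × ℕ)} {t : List ℕ} (hne : rows ≠ [])
    (hpos : ∀ r ∈ rows, 1 ≤ r.1 ∧ 1 ≤ r.2)
    (hle : ∀ r ∈ rows, r.1 ≤ 10 ^ 8 * (κ * Nat.clog 2 N))
    (hlen : rows.length ≤ 15 * (κ * Nat.log κ N)) (ht : ∀ a ∈ t, 0 < a)
    (hsum : t.sum ≤ (10 ^ 6 * Nat.clog 2 N) ^ 2) :
    (∀ G, (approx2T N k rows t G).steps ≤ 10 ^ 25 * (κ * Nat.clog 2 N ^ 3 * rowWeight rows)) ∧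
      (evalPoints P (sizes rows t)).card ≤ 10 ^ 25 * (κ * Nat.clog 2 N ^ 3 * rowWeight rows) := by
  set ℓ := Nat.clog 2 N with hℓ
  have hℓ1 : 1 ≤ ℓ := Nat.clog_pos (by norm_num) (by omega)
  have hlw : rows.length ≤ rowWeight rows := length_le_rowWeight fun r hr => (hpos r hr).2
  have hw1 : 1 ≤ rowWeight rows := (List.length_pos_iff.2 hne).trans_le hlw
  set W := rowWeight rows with hW
  have hsq : ℓ ≤ ℓ ^ 2 := by nlinarith
  have hN2 : N ≤ 2 ^ ℓ := Nat.le_pow_clog (by norm_num) N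
  have hlog : Nat.log κ N ≤ ℓ :=
    (Nat.log_anti_left (by norm_num) (by omega)).trans (Nat.log_le_clog 2 N)
  have hclog : Nat.clog 2 (rows.length * (10 ^ 8 * (κ * ℓ))) ≤ 35 * ℓ := by
    have h1 : rows.length * (10 ^ 8 * (κ * ℓ)) ≤ 2 ^ (31 + 4 * ℓ) := by
      have hκ2 : κ ≤ 2 ^ ℓ := hN.le.trans hN2
      have hℓ2 : ℓ ≤ 2 ^ ℓ := Nat.lt_two_pow_self.le
      calc rows.length * (10 ^ 8 * (κ * ℓ))
          ≤ (15 * (2 ^ ℓ * 2 ^ ℓ)) * (10 ^ 8 * (2 ^ ℓ * 2 ^ ℓ)) := by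
            refine Nat.mul_le_mul (hlen.trans ?_) ?_
            · exact Nat.mul_le_mul_left _ (Nat.mul_le_mul hκ2 (hlog.trans hℓ2))
            · exact Nat.mul_le_mul_left _ (Nat.mul_le_mul hκ2 hℓ2)
        _ = 15 * 10 ^ 8 * 2 ^ (4 * ℓ) := by ring
        _ ≤ 2 ^ 31 * 2 ^ (4 * ℓ) := Nat.mul_le_mul_right _ (by norm_num)
        _ = 2 ^ (31 + 4 * ℓ) := by rw [pow_add]
    exact (Nat.clog_le_of_le_pow h1).trans (by omega)
  have hκW : κ ≤ κ * ℓ ^ 3 * W := by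
    rw [mul_assoc]
    exact Nat.le_mul_of_pos_right _ (Nat.mul_pos (pow_pos hℓ1 3) hw1)
  constructor
  · intro G
    refine (approx2T_steps N k rows t G _ ht (fun r hr => (hpos r hr).2)
      (fun r hr => (hpos r hr).1) hle hne).trans ?_
    rw [← hW]
    have h2 : t.sum + 1 + Nat.clog 2 (rows.length * (10 ^ 8 * (κ * ℓ))) ≤ 2 * 10 ^ 12 * ℓ ^ 2 := by
      have : (10 ^ 6 * ℓ) ^ 2 = 10 ^ 12 * ℓ ^ 2 := by ring
      omega
    have h3 := Nat.mul_le_mul_left (10 ^ 8 * (κ * ℓ) * W) h2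
    have h4 : 10 ^ 8 * (κ * ℓ) * W * (2 * 10 ^ 12 * ℓ ^ 2) =
        2 * 10 ^ 20 * (κ * ℓ ^ 3 * W) := by ring
    omega
  · refine (card_evalPoints_le P rows t hle).trans ?_
    have h2 : t.sum + 1 ≤ 2 * 10 ^ 12 * ℓ ^ 2 := by
      have : (10 ^ 6 * ℓ) ^ 2 = 10 ^ 12 * ℓ ^ 2 := by ring
      omega
    have h3 := Nat.mul_le_mul hlw (Nat.mul_le_mul_left (10 ^ 8 * (κ * ℓ)) h2)
    have h4 : W * (10 ^ 8 * (κ * ℓ) * (2 * 10 ^ 12 * ℓ ^ 2)) =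
        2 * 10 ^ 20 * (κ * ℓ ^ 3 * W) := by ring
    omega

lemma log_bigN_le {D M A : ℕ} {P : Fin D → ℕ} (hP : IsModuli M P)
    (hA : bigN P ≤ (M * D) ^ (A * D)) :
    Real.log (bigN P) ≤ A * (D * Real.log ((M : ℝ) * D)) := by
  have h1 : ((bigN P : ℕ) : ℝ) ≤ (((M * D) ^ (A * D) : ℕ) : ℝ) := by exact_mod_cast hA
  have h2 := Real.log_le_log (by exact_mod_cast hP.bigN_pos) h1
  push_cast at h2
  rw [Real.log_pow] at h2
  push_cast at h2
  linarith

lemma one_le_of_one_lt_bigN {D M A : ℕ} {P : Fin D → ℕ} (hN : 1 < bigN P)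
    (hA : bigN P ≤ (M * D) ^ (A * D)) : 1 ≤ A ∧ 1 ≤ D := by
  constructor <;> by_contra h <;> (obtain rfl : _ = 0 := Nat.lt_one_iff.1 (not_le.1 h))
  · simp at hA; omega
  · simp at hA; omega

lemma rowWeight_detRows (s : List ℕ) : rowWeight (detRows s) = s.length := by
  simp [rowWeight, detRows, Function.comp_def]

lemma one_le_log {x : ℝ} (hx : 4 ≤ x) : 1 ≤ Real.log x := by
  have h := Real.add_one_le_exp (1 : ℝ)
  rw [Real.le_log_iff_exp_le (by linarith)]
  linarith [Real.exp_one_lt_d9]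

lemma log_div_one_sub {x σ : ℝ} (hx : 0 < x) (hσ : σ < 1) :
    Real.log (x / (1 - σ)) = Real.log x + Real.log (1 / (1 - σ)) := by
  rw [Real.log_div hx.ne' (by linarith), Real.log_div one_ne_zero (by linarith), Real.log_one]
  ring

lemma log_one_div_one_sub_nonneg {σ : ℝ} (h0 : 0 ≤ σ) (hσ : σ < 1) :
    0 ≤ Real.log (1 / (1 - σ)) := by
  refine Real.log_nonneg ?_
  rw [le_div_iff₀ (by linarith)]
  linarith

lemma numDraws_le {N : ℕ} {σ : ℝ} (hN : 4 ≤ N) (h0 : 0 ≤ σ) (hσ : σ < 1) :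
    (numDraws N σ : ℝ) ≤ 22 * Real.log (N / (1 - σ)) := by
  have hNr : (4 : ℝ) ≤ N := by exact_mod_cast hN
  have h1 : 1 ≤ Real.log (N / (1 - σ)) := by
    rw [log_div_one_sub (by linarith) hσ]
    linarith [one_le_log hNr, log_one_div_one_sub_nonneg h0 hσ]
  have h2 := Nat.ceil_lt_add_one (a := 21 * Real.log ((N : ℝ) / (1 - σ))) (by linarith)
  unfold numDraws
  linarith

lemma numDraws_pos {N : ℕ} {σ : ℝ} (hN : 4 ≤ N) (h0 : 0 ≤ σ) (hσ : σ < 1) :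
    1 ≤ numDraws N σ := by
  have hNr : (4 : ℝ) ≤ N := by exact_mod_cast hN
  refine Nat.ceil_pos.2 ?_
  rw [log_div_one_sub (by linarith) hσ]
  linarith [one_le_log hNr, log_one_div_one_sub_nonneg h0 hσ]

lemma drawnRows_ne_nil (s : List ℕ) {l : ℕ} (hl : 1 ≤ l) (τ : Fin l → Fin s.length) :
    drawnRows s τ ≠ [] := by
  intro h
  have := rowWeight_drawnRows s τ
  rw [h] at this
  simp [rowWeight] at this
  omega

theorem fourierApprox2_det_cost (A : ℕ) : ∃ C : ℝ, ∀ (D M k e : ℕ) (P : Fin D → ℕ),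
    2 ≤ M * D → IsModuli M P → bigN P ≤ (M * D) ^ (A * D) →
    2 ≤ k → 2 ≤ e → (k * e) ^ 2 < bigN P →
    ∃ s t : List ℕ, IsRowModuli (bigN P) (k * e) 4 s ∧ IsIdModuli (bigN P) s t ∧
      (∀ f : (Fin D → ℝ) → ℂ,
        ((fourierApprox2 (bigN P) k (detRows s) t (fnew P f)).steps : ℝ)
          ≤ C * ((k : ℝ) ^ 2 * (D : ℝ) ^ 4 * Real.log ((M : ℝ) * D) ^ 4
            / (Real.log ((k : ℝ) * e) * (1 / (e : ℝ)) ^ 2))) ∧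
      ((evalPoints P (sizes (detRows s) t)).card : ℝ)
          ≤ C * ((k : ℝ) ^ 2 * (D : ℝ) ^ 4 * Real.log ((M : ℝ) * D) ^ 4
            / (Real.log ((k : ℝ) * e) * (1 / (e : ℝ)) ^ 2)) := by
  -- `405 = 27 * 15`: `ℓ ≤ 3 log N` is cubed, and the number of rows is at most `15 κ log N / log
  -- κ`.
  refine ⟨405 * 10 ^ 25 * A ^ 4, fun D M k e P hMD hP hA hk he hN2 => ?_⟩
  have hκ : 4 ≤ k * e := Nat.mul_le_mul hk he
  have hN : k * e < bigN P := by nlinarith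
  obtain ⟨s, t, hs, ht, hle, hsum, hhead⟩ :=
    exists_moduli_approx2 (c := 4) hκ hN (by norm_num)
  have hcost := approx2T_cost_le (k := k) P hκ hN (by nlinarith) (rows := detRows s) (t := t)
    (by simpa [detRows] using hs.ne_nil)
    (fun r hr => ⟨hs.pos _ (mem_detRows hr).1, (mem_detRows hr).2.ge⟩)
    (fun r hr => hle _ (mem_detRows hr).1)
    (by simpa [detRows] using hs.length_le hκ hN (by norm_num) hhead)
    (ht.pos hs) hsum
  rw [rowWeight_detRows] at hcost
  have hK := hs.length_mul_log_le hκ hN (by norm_num) hhead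
  have hκr : (4 : ℝ) ≤ ((k * e : ℕ) : ℝ) := by exact_mod_cast hκ
  have hlκ : 0 < Real.log ((k * e : ℕ) : ℝ) := Real.log_pos (by linarith)
  have hℓ := clog_le_three_mul_log (n := bigN P) (by omega)
  have hΛ := log_bigN_le hP hA
  have hΛ0 := Real.log_natCast_nonneg (bigN P)
  set Λ := Real.log (bigN P)
  set ℓ := Nat.clog 2 (bigN P)
  have he0 : (e : ℝ) ≠ 0 := by positivity
  have key : ((10 ^ 25 * (k * e * ℓ ^ 3 * s.length) : ℕ) : ℝ) ≤
      405 * 10 ^ 25 * A ^ 4 * ((k : ℝ) ^ 2 * (D : ℝ) ^ 4 * Real.log ((M : ℝ) * D) ^ 4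
            / (Real.log ((k : ℝ) * e) * (1 / (e : ℝ)) ^ 2)) := by
    have h1 : (405 * 10 ^ 25 * A ^ 4 * ((k : ℝ) ^ 2 * (D : ℝ) ^ 4 * Real.log ((M : ℝ) * D) ^ 4
            / (Real.log ((k : ℝ) * e) * (1 / (e : ℝ)) ^ 2))) =
        405 * 10 ^ 25 * ((k * e : ℕ) : ℝ) ^ 2 * (A * (D * Real.log ((M : ℝ) * D))) ^ 4 /
          Real.log ((k * e : ℕ) : ℝ) := by
      push_cast at hlκ ⊢
      field_simp
    rw [h1, le_div_iff₀ hlκ]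
    have h2 : (ℓ : ℝ) ^ 3 ≤ (3 * Λ) ^ 3 := by gcongr
    calc ((10 ^ 25 * (k * e * ℓ ^ 3 * s.length) : ℕ) : ℝ) * Real.log ((k * e : ℕ) : ℝ)
        = 10 ^ 25 * ((k * e : ℕ) : ℝ) * (ℓ : ℝ) ^ 3 *
            (s.length * Real.log ((k * e : ℕ) : ℝ)) := by push_cast; ring
      _ ≤ 10 ^ 25 * ((k * e : ℕ) : ℝ) * (3 * Λ) ^ 3 * (15 * ((k * e : ℕ) : ℝ) * Λ) := by gcongr
      _ = 405 * 10 ^ 25 * ((k * e : ℕ) : ℝ) ^ 2 * Λ ^ 4 := by ring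
      _ ≤ _ := by gcongr
  exact ⟨s, t, hs, ht, fun f => (Nat.cast_le.2 (hcost.1 _)).trans key,
    (Nat.cast_le.2 hcost.2).trans key⟩

theorem fourierApprox2_random_cost (A : ℕ) : ∃ C : ℝ, ∀ (D M k e : ℕ) (P : Fin D → ℕ),
    2 ≤ M * D → IsModuli M P → bigN P ≤ (M * D) ^ (A * D) →
    2 ≤ k → 2 ≤ e → k * e < bigN P →
    ∃ s t : List ℕ, IsRowModuli (bigN P) (k * e) 14 s ∧ IsIdModuli (bigN P) s t ∧
      ∀ σ : ℝ, 2 / 3 ≤ σ → σ < 1 → ∀ τ : Fin (numDraws (bigN P) σ) → Fin s.length,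
        (∀ f : (Fin D → ℝ) → ℂ,
          ((fourierApprox2 (bigN P) k (drawnRows s τ) t (fnew P f)).steps : ℝ)
            ≤ C * ((k : ℝ) * (D : ℝ) ^ 4 / (1 / (e : ℝ)) * Real.log ((M : ℝ) * D) ^ 3
              * Real.log ((M : ℝ) * D / (1 - σ)))) ∧
        ((evalPoints P (sizes (drawnRows s τ) t)).card : ℝ)
            ≤ C * ((k : ℝ) * (D : ℝ) ^ 4 / (1 / (e : ℝ)) * Real.log ((M : ℝ) * D) ^ 3
              * Real.log ((M : ℝ) * D / (1 - σ))) := by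
  -- `594 = 27 * 22`: `ℓ ≤ 3 log N` is cubed, and the number of draws is at most `22 log (N / (1 -
  -- σ))`.
  refine ⟨594 * 10 ^ 25 * A ^ 4, fun D M k e P hMD hP hA hk he hN => ?_⟩
  have hκ : 4 ≤ k * e := Nat.mul_le_mul hk he
  obtain ⟨s, t, hs, ht, hle, hsum, hhead⟩ :=
    exists_moduli_approx2 (c := 14) hκ hN (by norm_num)
  refine ⟨s, t, hs, ht, fun σ hσ0 hσ τ => ?_⟩
  have hlpos : 1 ≤ numDraws (bigN P) σ := numDraws_pos (by omega) (by linarith) hσ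
  have hcost := approx2T_cost_le (k := k) P hκ hN (by nlinarith) (rows := drawnRows s τ) (t := t)
    (drawnRows_ne_nil s hlpos τ)
    (fun r hr => ⟨hs.pos _ (mem_drawnRows hr).1, (mem_drawnRows hr).2⟩)
    (fun r hr => hle _ (mem_drawnRows hr).1)
    ((drawnRows_length_le s τ).trans (hs.length_le hκ hN (by norm_num) hhead))
    (ht.pos hs) hsum
  rw [rowWeight_drawnRows] at hcost
  have hl := numDraws_le (N := bigN P) (σ := σ) (by omega) (by linarith) hσ
  have hℓ := clog_le_three_mul_log (n := bigN P) (by omega)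
  have hΛ := log_bigN_le hP hA
  have hΛ0 := Real.log_natCast_nonneg (bigN P)
  obtain ⟨hA1, hD1⟩ := one_le_of_one_lt_bigN (by omega) hA
  have hMDr : (2 : ℝ) ≤ (M : ℝ) * D := by exact_mod_cast hMD
  have hL0 : 0 ≤ Real.log ((M : ℝ) * D) := Real.log_nonneg (by linarith)
  have hσ1 := log_one_div_one_sub_nonneg (by linarith) hσ
  -- Only `log N` gains the factor `A D`; the term `log (1 / (1 - σ))` is nonnegative and may be
  -- multiplied by it because `A D ≥ 1`.
  have hlog : Real.log (bigN P / (1 - σ)) ≤ A * (D * Real.log ((M : ℝ) * D / (1 - σ))) := by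
    rw [log_div_one_sub (by exact_mod_cast hP.bigN_pos) hσ,
      log_div_one_sub (x := (M : ℝ) * D) (by linarith) hσ]
    have h1 : (1 : ℝ) ≤ A * D := by exact_mod_cast Nat.mul_pos hA1 hD1
    nlinarith
  have hlog0 : 0 ≤ Real.log (bigN P / (1 - σ)) := by
    rw [log_div_one_sub (by exact_mod_cast hP.bigN_pos) hσ]
    linarith
  set Λ := Real.log (bigN P)
  set ℓ := Nat.clog 2 (bigN P)
  have he0 : (e : ℝ) ≠ 0 := by positivity
  have key : ((10 ^ 25 * (k * e * ℓ ^ 3 * numDraws (bigN P) σ) : ℕ) : ℝ) ≤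
      594 * 10 ^ 25 * A ^ 4 * ((k : ℝ) * (D : ℝ) ^ 4 / (1 / (e : ℝ)) * Real.log ((M : ℝ) * D) ^ 3
              * Real.log ((M : ℝ) * D / (1 - σ))) := by
    calc ((10 ^ 25 * (k * e * ℓ ^ 3 * numDraws (bigN P) σ) : ℕ) : ℝ)
        = 10 ^ 25 * (k * e) * (ℓ : ℝ) ^ 3 * numDraws (bigN P) σ := by push_cast; ring
      _ ≤ 10 ^ 25 * (k * e) * (3 * (A * (D * Real.log ((M : ℝ) * D)))) ^ 3 *
            (22 * (A * (D * Real.log ((M : ℝ) * D / (1 - σ))))) := by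
          have h1 : (ℓ : ℝ) ≤ 3 * (A * (D * Real.log ((M : ℝ) * D))) := by linarith
          have h2 : (numDraws (bigN P) σ : ℝ) ≤
            22 * (A * (D * Real.log ((M : ℝ) * D / (1 - σ)))) := by linarith
          gcongr
      _ = _ := by
          field_simp
          ring
  exact ⟨fun f => (Nat.cast_le.2 (hcost.1 _)).trans key, (Nat.cast_le.2 hcost.2).trans key⟩

lemma approx1_card_evalPoints_le {D N κ : ℕ} (P : Fin D → ℕ) (hκ : 4 ≤ κ) (hN : κ < N)
    {rows : List (ℕ × ℕ)}
    (hle : ∀ r ∈ rows, r.1 ≤ 10 ^ 9 * (κ * Nat.log κ N * Nat.clog 2 (κ * Nat.log κ N))) :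
    ((evalPoints P (sizes rows [])).card : ℝ) ≤
      3 * 10 ^ 9 * (rows.length * (κ * Nat.log κ N) * Real.log (κ * Nat.log κ N)) := by
  have hL1 : 1 ≤ Nat.log κ N := Nat.log_pos (by omega) hN.le
  have hq : 4 ≤ κ * Nat.log κ N := hκ.trans (Nat.le_mul_of_pos_right _ hL1)
  have h1 := card_evalPoints_le P rows [] hle
  have h2 := clog_le_three_mul_log (n := κ * Nat.log κ N) (by omega)
  have h3 : ((evalPoints P (sizes rows [])).card : ℝ) ≤
      ((rows.length * (10 ^ 9 * (κ * Nat.log κ N * Nat.clog 2 (κ * Nat.log κ N))) : ℕ) : ℝ) := by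
    exact_mod_cast (by simpa using h1)
  refine h3.trans ?_
  push_cast at h2
  calc ((rows.length * (10 ^ 9 * (κ * Nat.log κ N * Nat.clog 2 (κ * Nat.log κ N))) : ℕ) : ℝ)
      = rows.length * (10 ^ 9 * (κ * Nat.log κ N * (Nat.clog 2 (κ * Nat.log κ N) : ℕ))) := by
        push_cast
        ring
    _ ≤ rows.length * (10 ^ 9 * (κ * Nat.log κ N * (3 * Real.log (κ * Nat.log κ N)))) := by
        gcongr
    _ = _ := by ring

lemma approx1T_steps_le {N k : ℕ} (hN : 4 ≤ N) (hk : 2 * k ≤ N) {rows : List (ℕ × ℕ)}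
    (h1 : ∀ r ∈ rows, 1 ≤ r.2) (hW : 1 ≤ rowWeight rows) (G) :
    ((approx1T N k rows G).steps : ℝ) ≤ 20040 * (N * (rowWeight rows + Real.log N)) := by
  have h2 : ((approx1T N k rows G).steps : ℝ) ≤
      ((20035 * (N * rowWeight rows) + 10 * N * Nat.clog 2 N + 2 + 2 * k : ℕ) : ℝ) :=
    Nat.cast_le.2 (approx1T_steps N k rows G h1 hW)
  have h3 := clog_le_three_mul_log (n := N) (by omega)
  have hNr : (4 : ℝ) ≤ N := by exact_mod_cast hN
  have hkr : 2 * (k : ℝ) ≤ N := by exact_mod_cast hk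
  have hWr : (1 : ℝ) ≤ rowWeight rows := by exact_mod_cast hW
  have h4 := one_le_log hNr
  have h5 : (N : ℝ) * Nat.clog 2 N ≤ N * (3 * Real.log N) := by gcongr
  have h6 : (N : ℝ) ≤ N * Real.log N := by nlinarith
  have h7 : (N : ℝ) ≤ N * rowWeight rows := by nlinarith
  push_cast at h2
  nlinarith

theorem fourierApprox1_cost : ∃ C : ℝ, ∀ (D M k e : ℕ) (P : Fin D → ℕ),
    IsModuli M P → 2 ≤ k → 2 ≤ e → k * e < bigN P →
    (∃ s : List ℕ, IsRowModuli (bigN P) (k * e) 4 s ∧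
      (∀ f : (Fin D → ℝ) → ℂ,
        ((fourierApprox1 (bigN P) k (detRows s) (fnew P f)).steps : ℝ)
          ≤ C * ((bigN P : ℝ) * (k * e) * Real.logb (k * e) (bigN P))) ∧
      ((evalPoints P (sizes (detRows s) [])).card : ℝ)
          ≤ C * (((k : ℝ) * e) ^ 2 * (Nat.log (k * e) (bigN P) : ℝ) ^ 2
            * Real.log ((k : ℝ) * e * Nat.log (k * e) (bigN P)))) ∧
    (∃ s : List ℕ, IsRowModuli (bigN P) (k * e) 14 s ∧
      ∀ σ : ℝ, 2 / 3 ≤ σ → σ < 1 → ∀ τ : Fin (numDraws (bigN P) σ) → Fin s.length,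
        (∀ f : (Fin D → ℝ) → ℂ,
          ((fourierApprox1 (bigN P) k (drawnRows s τ) (fnew P f)).steps : ℝ)
            ≤ C * ((bigN P : ℝ) * Real.log ((bigN P : ℝ) / (1 - σ)))) ∧
        ((evalPoints P (sizes (drawnRows s τ) [])).card : ℝ)
            ≤ C * ((numDraws (bigN P) σ : ℝ)
              * ((k : ℝ) * e * Nat.log (k * e) (bigN P))
              * Real.log ((k : ℝ) * e * Nat.log (k * e) (bigN P)))) := by
  -- `3 * 10 ^ 9 * 15` from the deterministic sample count, which dominates the constants of the
  -- other three bounds.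
  refine ⟨45 * 10 ^ 9, fun D M k e P hP hk he hN => ?_⟩
  have hκ : 4 ≤ k * e := Nat.mul_le_mul hk he
  have h2k : 2 * k ≤ k * e := by nlinarith
  have hκr : (4 : ℝ) ≤ (k : ℝ) * e := by exact_mod_cast hκ
  have hNr : (4 : ℝ) ≤ bigN P := by exact_mod_cast hκ.trans hN.le
  have hlN := one_le_log hNr
  have hL1 : 1 ≤ Nat.log (k * e) (bigN P) := Nat.log_pos (by omega) hN.le
  have hL1r : (1 : ℝ) ≤ Nat.log (k * e) (bigN P) := by exact_mod_cast hL1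
  have hlq : 0 ≤ Real.log ((k : ℝ) * e * Nat.log (k * e) (bigN P)) :=
    Real.log_nonneg (by nlinarith)
  constructor
  · obtain ⟨s, hs, hle, hhead⟩ := exists_moduli_approx1 (c := 4) hκ hN (by norm_num)
    have hne : 1 ≤ s.length := List.length_pos_iff.2 hs.ne_nil
    refine ⟨s, hs, fun f => ?_, ?_⟩
    · refine (approx1T_steps_le (hκ.trans hN.le) (h2k.trans hN.le)
        (fun r hr => (mem_detRows hr).2.ge) (by rwa [rowWeight_detRows]) _).trans ?_
      rw [rowWeight_detRows]
      have hK := hs.length_mul_log_le hκ hN (by norm_num) hhead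
      push_cast at hK
      have hlκ := one_le_log hκr
      have hlκ' := Real.log_le_sub_one_of_pos (x := (k : ℝ) * e) (by linarith)
      -- Fifteen parts come from the number of rows; the sixteenth absorbs `log N`, using `log κ ≤
      -- κ`.
      have h3 : ((s.length : ℝ) + Real.log (bigN P)) ≤
          16 * ((k * e) * Real.logb (k * e) (bigN P)) := by
        rw [Real.logb, ← mul_div_assoc, ← mul_div_assoc, le_div_iff₀ (by linarith)]
        nlinarith
      have h4 : 0 ≤ (k * e : ℝ) * Real.logb (k * e) (bigN P) :=
        mul_nonneg (by linarith) (Real.logb_nonneg (by linarith) (by linarith))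
      calc 20040 * ((bigN P : ℝ) * (s.length + Real.log (bigN P)))
          ≤ 20040 * ((bigN P : ℝ) * (16 * ((k * e) * Real.logb (k * e) (bigN P)))) := by gcongr
        _ ≤ _ := by nlinarith [mul_nonneg (by linarith : (0:ℝ) ≤ bigN P) h4]
    · refine (approx1_card_evalPoints_le P hκ hN fun r hr => hle _ (mem_detRows hr).1).trans ?_
      have h5 : ((detRows s).length : ℝ) ≤
          15 * ((k : ℝ) * e * Nat.log (k * e) (bigN P)) := by
        have := hs.length_le hκ hN (by norm_num) hhead
        rw [detRows, List.length_map]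
        exact_mod_cast this
      push_cast
      calc 3 * 10 ^ 9 * (((detRows s).length : ℝ) * (k * e * Nat.log (k * e) (bigN P)) *
            Real.log (k * e * Nat.log (k * e) (bigN P)))
          ≤ 3 * 10 ^ 9 * ((15 * ((k : ℝ) * e * Nat.log (k * e) (bigN P))) *
            (k * e * Nat.log (k * e) (bigN P)) *
            Real.log (k * e * Nat.log (k * e) (bigN P))) := by gcongr
        _ = _ := by ring
  · obtain ⟨s, hs, hle, -⟩ := exists_moduli_approx1 (c := 14) hκ hN (by norm_num)
    refine ⟨s, hs, fun σ hσ0 hσ τ => ⟨fun f => ?_, ?_⟩⟩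
    · refine (approx1T_steps_le (hκ.trans hN.le) (h2k.trans hN.le)
        (fun r hr => (mem_drawnRows hr).2) ?_ _).trans ?_
      · rw [rowWeight_drawnRows]
        exact numDraws_pos (hκ.trans hN.le) (by linarith) hσ
      rw [rowWeight_drawnRows]
      have hl := numDraws_le (N := bigN P) (σ := σ) (hκ.trans hN.le) (by linarith) hσ
      have h6 : Real.log (bigN P) ≤ Real.log ((bigN P : ℝ) / (1 - σ)) := by
        rw [log_div_one_sub (by linarith) hσ]
        linarith [log_one_div_one_sub_nonneg (by linarith) hσ]
      calc 20040 * ((bigN P : ℝ) * (numDraws (bigN P) σ + Real.log (bigN P)))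
          ≤ 20040 * ((bigN P : ℝ) * (22 * Real.log ((bigN P : ℝ) / (1 - σ)) +
              Real.log ((bigN P : ℝ) / (1 - σ)))) := by gcongr
        _ ≤ _ := by
          nlinarith [mul_nonneg (by linarith : (0:ℝ) ≤ bigN P)
            (by linarith : 0 ≤ Real.log ((bigN P : ℝ) / (1 - σ)))]
    · refine (approx1_card_evalPoints_le P hκ hN fun r hr => hle _ (mem_drawnRows hr).1).trans ?_
      have h5 : ((drawnRows s τ).length : ℝ) ≤ numDraws (bigN P) σ := by
        have := length_le_rowWeight (rows := drawnRows s τ) fun r hr => (mem_drawnRows hr).2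
        rw [rowWeight_drawnRows] at this
        exact_mod_cast this
      push_cast
      gcongr
      norm_num

end SFT

end

/-! ### Assembly of the clauses -/

theorem mainTheorem3 :
    -- the Chinese remainder map is a bijection
    (∀ (D M : ℕ) (P : Fin D → ℕ), SFT.IsModuli M P →
      Set.BijOn (SFT.crtMap P) (SFT.freqBox P) (SFT.freqRange (SFT.bigN P) : Set ℤ)) ∧
    -- moduli with `log Ñ = O(D log (M D))`, and, for fixed `D`, with `Ñ = Θ((M D)^D)`
    (∃ A : ℕ, ∀ D M : ℕ, 2 ≤ M * D → ∃ P : Fin D → ℕ, SFT.IsModuli M P ∧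
      SFT.bigN P ≤ (M * D) ^ (A * D)) ∧
    (∀ D : ℕ, ∃ B : ℕ, ∀ M : ℕ, 2 ≤ M * D → ∃ P : Fin D → ℕ, SFT.IsModuli M P ∧
      (M * D) ^ D ≤ SFT.bigN P ∧ SFT.bigN P ≤ B * (M * D) ^ D) ∧
    -- Fourier Approximate 2, deterministic: error
    (∀ (D M k e : ℕ) (P : Fin D → ℕ) (s t : List ℕ) (f : (Fin D → ℝ) → ℂ),
      SFT.IsModuli M P → 2 ≤ k → 2 ≤ e → (k * e) ^ 2 < SFT.bigN P →
      SFT.IsRowModuli (SFT.bigN P) (k * e) 4 s → SFT.IsIdModuli (SFT.bigN P) s t →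
      SFT.IsBandlimited M f →
      SFT.InstanceOptimal k e (SFT.fhat f) (SFT.pullback P
        (SFT.fourierApprox2 (SFT.bigN P) k (SFT.detRows s) t (SFT.fnew P f)).val)) ∧
    -- Fourier Approximate 2, deterministic: steps and samples
    (∀ A : ℕ, ∃ C : ℝ, ∀ (D M k e : ℕ) (P : Fin D → ℕ),
      2 ≤ M * D → SFT.IsModuli M P → SFT.bigN P ≤ (M * D) ^ (A * D) →
      2 ≤ k → 2 ≤ e → (k * e) ^ 2 < SFT.bigN P →
      ∃ s t : List ℕ,
        SFT.IsRowModuli (SFT.bigN P) (k * e) 4 s ∧ SFT.IsIdModuli (SFT.bigN P) s t ∧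
        (∀ f : (Fin D → ℝ) → ℂ,
          ((SFT.fourierApprox2 (SFT.bigN P) k (SFT.detRows s) t (SFT.fnew P f)).steps : ℝ)
            ≤ C * ((k : ℝ) ^ 2 * (D : ℝ) ^ 4 * Real.log ((M : ℝ) * D) ^ 4
              / (Real.log ((k : ℝ) * e) * (1 / (e : ℝ)) ^ 2))) ∧
        ((SFT.evalPoints P (SFT.sizes (SFT.detRows s) t)).card : ℝ)
            ≤ C * ((k : ℝ) ^ 2 * (D : ℝ) ^ 4 * Real.log ((M : ℝ) * D) ^ 4
              / (Real.log ((k : ℝ) * e) * (1 / (e : ℝ)) ^ 2))) ∧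
    -- Fourier Approximate 2, randomized: success probability
    (∀ (D M k e : ℕ) (σ : ℝ) (P : Fin D → ℕ) (s t : List ℕ) (f : (Fin D → ℝ) → ℂ),
      SFT.IsModuli M P → 2 ≤ k → 2 ≤ e → k * e < SFT.bigN P → 2 / 3 ≤ σ → σ < 1 →
      SFT.IsRowModuli (SFT.bigN P) (k * e) 14 s → SFT.IsIdModuli (SFT.bigN P) s t →
      SFT.IsBandlimited M f →
      ENNReal.ofReal σ ≤ SFT.drawLaw s.length (SFT.numDraws (SFT.bigN P) σ)
        {τ | SFT.InstanceOptimal k e (SFT.fhat f) (SFT.pullback P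
          (SFT.fourierApprox2 (SFT.bigN P) k (SFT.drawnRows s τ) t (SFT.fnew P f)).val)}) ∧
    -- Fourier Approximate 2, randomized: steps and samples
    (∀ A : ℕ, ∃ C : ℝ, ∀ (D M k e : ℕ) (P : Fin D → ℕ),
      2 ≤ M * D → SFT.IsModuli M P → SFT.bigN P ≤ (M * D) ^ (A * D) →
      2 ≤ k → 2 ≤ e → k * e < SFT.bigN P →
      ∃ s t : List ℕ,
        SFT.IsRowModuli (SFT.bigN P) (k * e) 14 s ∧ SFT.IsIdModuli (SFT.bigN P) s t ∧
        ∀ σ : ℝ, 2 / 3 ≤ σ → σ < 1 →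
          ∀ τ : Fin (SFT.numDraws (SFT.bigN P) σ) → Fin s.length,
            (∀ f : (Fin D → ℝ) → ℂ,
              ((SFT.fourierApprox2 (SFT.bigN P) k (SFT.drawnRows s τ) t
                  (SFT.fnew P f)).steps : ℝ)
                ≤ C * ((k : ℝ) * (D : ℝ) ^ 4 / (1 / (e : ℝ)) * Real.log ((M : ℝ) * D) ^ 3
                  * Real.log ((M : ℝ) * D / (1 - σ)))) ∧
            ((SFT.evalPoints P (SFT.sizes (SFT.drawnRows s τ) t)).card : ℝ)
                ≤ C * ((k : ℝ) * (D : ℝ) ^ 4 / (1 / (e : ℝ)) * Real.log ((M : ℝ) * D) ^ 3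
                  * Real.log ((M : ℝ) * D / (1 - σ)))) ∧
    -- Fourier Approximate 1, deterministic: error
    (∀ (D M k e : ℕ) (P : Fin D → ℕ) (s : List ℕ) (f : (Fin D → ℝ) → ℂ),
      SFT.IsModuli M P → 2 ≤ k → 2 ≤ e → k * e < SFT.bigN P →
      SFT.IsRowModuli (SFT.bigN P) (k * e) 4 s → SFT.IsBandlimited M f →
      SFT.InstanceOptimal k e (SFT.fhat f) (SFT.pullback P
        (SFT.fourierApprox1 (SFT.bigN P) k (SFT.detRows s) (SFT.fnew P f)).val)) ∧
    -- Fourier Approximate 1, randomized: success probability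
    (∀ (D M k e : ℕ) (σ : ℝ) (P : Fin D → ℕ) (s : List ℕ) (f : (Fin D → ℝ) → ℂ),
      SFT.IsModuli M P → 2 ≤ k → 2 ≤ e → k * e < SFT.bigN P → 2 / 3 ≤ σ → σ < 1 →
      SFT.IsRowModuli (SFT.bigN P) (k * e) 14 s → SFT.IsBandlimited M f →
      ENNReal.ofReal σ ≤ SFT.drawLaw s.length (SFT.numDraws (SFT.bigN P) σ)
        {τ | SFT.InstanceOptimal k e (SFT.fhat f) (SFT.pullback P
          (SFT.fourierApprox1 (SFT.bigN P) k (SFT.drawnRows s τ) (SFT.fnew P f)).val)}) ∧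
    -- Fourier Approximate 1, both variants: steps and samples
    (∃ C : ℝ, ∀ (D M k e : ℕ) (P : Fin D → ℕ),
      SFT.IsModuli M P → 2 ≤ k → 2 ≤ e → k * e < SFT.bigN P →
      (∃ s : List ℕ, SFT.IsRowModuli (SFT.bigN P) (k * e) 4 s ∧
        (∀ f : (Fin D → ℝ) → ℂ,
          ((SFT.fourierApprox1 (SFT.bigN P) k (SFT.detRows s) (SFT.fnew P f)).steps : ℝ)
            ≤ C * ((SFT.bigN P : ℝ) * (k * e) * Real.logb (k * e) (SFT.bigN P))) ∧
        ((SFT.evalPoints P (SFT.sizes (SFT.detRows s) [])).card : ℝ)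
            ≤ C * (((k : ℝ) * e) ^ 2 * (Nat.log (k * e) (SFT.bigN P) : ℝ) ^ 2
              * Real.log ((k : ℝ) * e * Nat.log (k * e) (SFT.bigN P)))) ∧
      (∃ s : List ℕ, SFT.IsRowModuli (SFT.bigN P) (k * e) 14 s ∧
        ∀ σ : ℝ, 2 / 3 ≤ σ → σ < 1 →
          ∀ τ : Fin (SFT.numDraws (SFT.bigN P) σ) → Fin s.length,
            (∀ f : (Fin D → ℝ) → ℂ,
              ((SFT.fourierApprox1 (SFT.bigN P) k (SFT.drawnRows s τ)
                  (SFT.fnew P f)).steps : ℝ)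
                ≤ C * ((SFT.bigN P : ℝ) * Real.log ((SFT.bigN P : ℝ) / (1 - σ)))) ∧
            ((SFT.evalPoints P (SFT.sizes (SFT.drawnRows s τ) [])).card : ℝ)
                ≤ C * ((SFT.numDraws (SFT.bigN P) σ : ℝ)
                  * ((k : ℝ) * e * Nat.log (k * e) (SFT.bigN P))
                  * Real.log ((k : ℝ) * e * Nat.log (k * e) (SFT.bigN P))))) := by
  exact ⟨fun _ _ _ h => SFT.crtMap_bijOn h,
    ⟨20, fun _ _ h => SFT.exists_moduli_pow h⟩,
    SFT.exists_moduli_fixed_dim,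
    fun _ _ _ _ _ _ _ _ hP hk he _ hs ht hf => SFT.fourierApprox2_det_error hP hk he hs ht hf,
    SFT.fourierApprox2_det_cost,
    fun _ _ _ _ _ _ _ _ _ hP hk he _ _ hσ hs ht hf =>
      SFT.fourierApprox2_random_error hP hk he hσ hs ht hf,
    SFT.fourierApprox2_random_cost,
    fun _ _ _ _ _ _ _ hP hk he _ hs hf => SFT.fourierApprox1_det_error hP hk he hs hf,
    fun _ _ _ _ _ _ _ _ hP hk he _ _ hσ hs hf =>
      SFT.fourierApprox1_random_error hP hk he hσ hs hf,
    SFT.fourierApprox1_cost⟩
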